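/- **Theorem 3.1.** Let $d\in\{2,3\}$ and let $\Omega\subset\mathbb R^d$ be a bounded domain (open, connected) with Lipschitz boundary $\Gamma=\partial\Omega$, partitioned by a finite set $\mathcal T_h$ of (closed, possibly nonconvex) polygons ($d=2$) or polyhedra ($d=3$) with disjoint interiors. Let $\mathcal E_h$ be its finite set of edges or flat faces $e$: they are connected, overlap only in sets of zero surface measure, make up $\partial T$ for each $T\in\mathcal T_h$, and the ones contained in $\Gamma$ make up $\Gamma$. A face contained in $\Gamma$ belongs to exactly one element, and every other face is shared by exactly two. Write $h_T=\operatorname{diam}T$, let $\mathbf n$ be the outward unit normal on $\partial T$, and let $P_r$ denote polynomials of total degree at most $r$, with $P_r=\{0\}$ for $r<0$. Let $k\ge 1$ be an integer and let $\Gamma_d,\Gamma_n\subset\Gamma$ be resolved by the partition: up to sets of zero surface measure, each face contained in $\Gamma$ is contained in $\Gamma_d$ or disjoint from it, and likewise for $\Gamma_n$. Let $f\in L^2(\Omega)$, $g_1\in L^2(\Gamma_d)$, $g_2\in L^2(\Gamma_n)$. Let $V_h$ be the space of triples $v=\{v_0,v_b,v_n\mathbf n\}$ with $v_0|_T\in P_k(T)$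 for all $T\in\mathcal T_h$, and $v_b|_e\in P_k(e)$, $v_n|_e\in P_{k-1}(e)$ for all $e\in\mathcal E_h$, where $v_b$ and the vector $v_n\mathbf n$ have a common value on each face shared by two elements (so $v_n$ changes sign with $\mathbf n$). Let $$W_h=\{w:\ w|_T\in P_{k-2}(T)\ \ \forall T\in\mathcal T_h\},\qquad V_h^g=\{v\in V_h:\ v_b=Q_bg_1\text{ on }\Gamma_d,\ v_n=Q_ng_2\text{ on }\Gamma_n\},$$ where, on each face $e$, $Q_b$ and $Q_n$ are the $L^2$ projections onto $P_k(e)$ and $P_{k-1}(e)$; $V_h^0$ is $V_h^g$ for $g_1=g_2=0$. For $v\in V_h$ let $\Delta_{w,h}v\in W_h$ be determined on each $T$ by $$(\Delta_{w,h}v,\varphi)_T=(v_0,\Delta\varphi)_T-\langle v_b,\nabla\varphi\cdot\mathbf n\rangle_{\partial T}+\langle v_n,\varphi\rangle_{\partial T}\qquad\forall\varphi\in P_{k-2}(T),$$ and let $$s(\sigma,v)=\sum_{T\in\mathcal T_h}\Big(h_T^{-3}\int_{\partial T}(\sigma_0-\sigma_b)(v_0-v_b)\,ds+h_T^{-1}\int_{\partial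 T}(\nabla\sigma_0\cdot\mathbf n-\sigma_n)(\nabla v_0\cdot\mathbf n-v_n)\,ds\Big).$$ Assume that $\Gamma_d\cap\Gamma_n$ has positive surface measure and that $\Gamma_d\cup\Gamma_n$ is a closed proper subset of $\Gamma$. Then there is exactly one pair $(u_h,\lambda_h)\in V_h^g\times W_h$ such that $$s(u_h,v)+(\Delta_{w,h}v,\lambda_h)=0\quad\forall v\in V_h^0,\qquad (\Delta_{w,h}u_h,w)=(f,w)\quad\forall w\in W_h.$$ -/

import Mathlib

open MeasureTheory
open scoped Topology

noncomputable section

namespace PDWG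

/-- Euclidean space `ℝ^d`. The surface measure (arc length for `d = 2`, area for `d = 3`) is
`μHE[d - 1]`, the Hausdorff measure normalised so as to agree with Lebesgue measure on
`(d - 1)`-dimensional affine subspaces. -/
abbrev Pt (d : ℕ) := EuclideanSpace ℝ (Fin d)

/-! ### Polynomials -/

/-- Real polynomials in `d` variables. -/
abbrev Poly (d : ℕ) := MvPolynomial (Fin d) ℝ

/-- `P_r`: the polynomials of total degree at most `r`. For negative `r` this is `{0}`. -/
def polySpace (d : ℕ) (r : ℤ) : Submodule ℝ (Poly d) :=
  MvPolynomial.restrictSupport ℝ {a : Fin d →₀ ℕ | ((∑ i, a i : ℕ) : ℤ) ≤ r}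

/-- Value of a polynomial at a point. -/
def evalAt {d : ℕ} (p : Poly d) (x : Pt d) : ℝ := MvPolynomial.eval (fun i => x i) p

/-- The Laplacian of a polynomial. -/
def lap {d : ℕ} (p : Poly d) : Poly d := ∑ i, MvPolynomial.pderiv i (MvPolynomial.pderiv i p)

/-- The directional derivative `∇p(x) · n`. -/
def dirDeriv {d : ℕ} (p : Poly d) (n x : Pt d) : ℝ := ∑ i, evalAt (MvPolynomial.pderiv i p) x * n i

/-- `P_r(S)`: the functions on `S` that are restrictions of polynomials of degree at most `r`. -/
def polyOn {d : ℕ} (S : Set (Pt d)) (r : ℤ) : Set (S → ℝ) :=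
  {q | ∃ p ∈ polySpace d r, ∀ x : S, q x = evalAt p x}

/-! ### Polytopal partitions -/

/-- `S` is a finite nonempty union of nondegenerate `m`-dimensional simplices, that is, a compact
and possibly nonconvex polyhedral set of pure dimension `m`. -/
def IsPolyhedral {d : ℕ} (m : ℕ) (S : Set (Pt d)) : Prop :=
  ∃ 𝒮 : Set (Affine.Simplex ℝ (Pt d) m), 𝒮.Finite ∧ 𝒮.Nonempty ∧
    S = ⋃ s ∈ 𝒮, convexHull ℝ (Set.range s.points)

/-- `n` is the outward unit normal of `T` along the flat piece `e` of its boundary: `e` lies in a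
hyperplane orthogonal to `n`, and at almost every point of `e`, `T` lies on the side of `-n`. -/
structure IsOutwardUnitNormal {d : ℕ} (T e : Set (Pt d)) (n : Pt d) : Prop where
  norm_eq_one : ‖n‖ = 1
  orthogonal : ∀ x ∈ e, ∀ y ∈ e, inner ℝ n (x - y) = 0
  outward : ∀ᵐ x ∂((μHE[d - 1] : Measure (Pt d)).restrict e),
    ∀ᶠ t in 𝓝[>] (0 : ℝ), x - t • n ∈ interior T ∧ x + t • n ∉ T

/-- A finite element partition of `Ω` into (closed, possibly nonconvex) polygons, `d = 2`, or
polyhedra, `d = 3`, with its set of edges/flat faces. A face `e` belongs to the boundary of the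
element `T` when `e ⊆ frontier T`. Hanging nodes are allowed: a straight piece of `frontier T` may
be subdivided into several faces, one for each neighbour. -/
structure PolytopalMesh {d : ℕ} (Ω : Set (Pt d)) where
  /-- The elements. -/
  elems : Finset (Set (Pt d))
  /-- The edges (`d = 2`) or flat faces (`d = 3`). -/
  faces : Finset (Set (Pt d))
  /-- `normal T e` is the outward unit normal of `T` on `e` (only used if `e ⊆ frontier T`). -/
  normal : Set (Pt d) → Set (Pt d) → Pt d
  elem_polyhedral : ∀ T ∈ elems, IsPolyhedral d T
  elem_connected : ∀ T ∈ elems, IsConnected (interior T)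
  elem_disjoint : ∀ T ∈ elems, ∀ T' ∈ elems, T ≠ T' → Disjoint (interior T) (interior T')
  iUnion_elems : ⋃ T ∈ elems, T = closure Ω
  face_polyhedral : ∀ e ∈ faces, IsPolyhedral (d - 1) e
  face_connected : ∀ e ∈ faces, IsConnected e
  /-- Distinct faces do not overlap. -/
  face_disjoint : ∀ e ∈ faces, ∀ e' ∈ faces, e ≠ e' →
    (μHE[d - 1] : Measure (Pt d)) (e ∩ e') = 0
  isOutwardUnitNormal : ∀ T ∈ elems, ∀ e ∈ faces, e ⊆ frontier T →
    IsOutwardUnitNormal T e (normal T e)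
  /-- The boundary of each element is the union of its faces. -/
  frontier_elem : ∀ T ∈ elems, frontier T = ⋃ e ∈ {e | e ∈ faces ∧ e ⊆ frontier T}, e
  /-- The boundary of the domain is the union of the boundary faces. -/
  frontier_domain : frontier Ω = ⋃ e ∈ {e | e ∈ faces ∧ e ⊆ frontier Ω}, e
  /-- A boundary face belongs to exactly one element. -/
  boundary_face : ∀ e ∈ faces, e ⊆ frontier Ω → {T | T ∈ elems ∧ e ⊆ frontier T}.ncard = 1
  /-- An interior face is shared by exactly two elements. -/
  interior_face : ∀ e ∈ faces, ¬ e ⊆ frontier Ω → {T | T ∈ elems ∧ e ⊆ frontier T}.ncard = 2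

namespace PolytopalMesh

variable {d : ℕ} {Ω : Set (Pt d)} (M : PolytopalMesh Ω)

/-! ### Integrals -/

/-- The surface measure on the face `e`. -/
def faceMeasure (e : Set (Pt d)) : Measure e :=
  (μHE[d - 1] : Measure (Pt d)).comap (Subtype.val : e → Pt d)

open Classical in
/-- `∫_{∂T} F ds`, where `F` is given separately on each face. -/
def boundaryIntegral (T : Set (Pt d)) (F : (e : M.faces) → e.1 → ℝ) : ℝ :=
  ∑ e : M.faces with e.1 ⊆ frontier T, ∫ x, F e x ∂(faceMeasure e.1)

/-! ### Weak functions -/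

/-- Piecewise polynomials, one on each element. As elements have nonempty interior, a polynomial
is identified with its restriction to the element. -/
abbrev PiecewisePoly := M.elems → Poly d

/-- Triples `{v₀, v_b, v_n n}`: `v₀` is a polynomial on each element, `v_b` a real function on each
face, and `v_n n` a vector field on each face; the last two are single valued, that is, common to
the elements that share the face. -/
abbrev WeakFunction :=
  M.PiecewisePoly × ((e : M.faces) → e.1 → ℝ) × ((e : M.faces) → e.1 → Pt d)

variable {M} in
/-- The interior component `v₀`. -/
def WeakFunction.v0 (v : M.WeakFunction) (T : M.elems) : Poly d := v.1 T

variable {M} in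
/-- The boundary component `v_b`. -/
def WeakFunction.vb (v : M.WeakFunction) (e : M.faces) (x : e.1) : ℝ := v.2.1 e x

variable {M} in
/-- The vector-valued component `v_n n`. -/
def WeakFunction.vnn (v : M.WeakFunction) (e : M.faces) (x : e.1) : Pt d := v.2.2 e x

variable {M} in
/-- The scalar `v_n` as seen from the element `T`: the component of `v_n n` along the outward
normal of `T`. -/
def WeakFunction.vn (v : M.WeakFunction) (T : M.elems) (e : M.faces) (x : e.1) : ℝ :=
  inner ℝ (v.vnn e x) (M.normal T.1 e.1)

/-- The weak finite element space `V_h`: `v₀ ∈ P_k(T)`, `v_b ∈ P_k(e)`, and `v_n n` is normal to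
`e` with `v_n ∈ P_{k-1}(e)`. -/
def Vh (k : ℕ) : Set M.WeakFunction :=
  {v | (∀ T, v.v0 T ∈ polySpace d k) ∧
    (∀ e, v.vb e ∈ polyOn e.1 k) ∧
    (∀ (T : M.elems) (e : M.faces), e.1 ⊆ frontier T.1 →
      v.vn T e ∈ polyOn e.1 ((k : ℤ) - 1) ∧
      ∀ x, v.vnn e x = v.vn T e x • M.normal T.1 e.1)}

/-- The space `W_h` of piecewise polynomials of degree at most `k - 2` (`{0}` for `k = 1`). -/
def Wh (k : ℕ) : Set M.PiecewisePoly := {w | ∀ T, w T ∈ polySpace d ((k : ℤ) - 2)}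

/-- `q` is the `L²` projection of `g` onto `P_r(e)`. -/
def IsL2Projection (e : Set (Pt d)) (r : ℤ) (g : Pt d → ℝ) (q : e → ℝ) : Prop :=
  q ∈ polyOn e r ∧ ∀ φ ∈ polyOn e r, ∫ x, (g x - q x) * φ x ∂(faceMeasure e) = 0

/-- The partition resolves the boundary portion `Γ`: up to a set of surface measure zero, each
boundary face is either contained in `Γ` or disjoint from it. -/
def Resolves (Γ : Set (Pt d)) : Prop :=
  ∀ e ∈ M.faces, e ⊆ frontier Ω →
    (μHE[d - 1] : Measure (Pt d)) (e \ Γ) = 0 ∨ (μHE[d - 1] : Measure (Pt d)) (e ∩ Γ) = 0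

/-- `e` is one of the faces that make up `Γ`. -/
def IsFaceOf (Γ e : Set (Pt d)) : Prop :=
  e ⊆ frontier Ω ∧ (μHE[d - 1] : Measure (Pt d)) (e \ Γ) = 0

/-- The hyperplane `V_h^g` of the `v ∈ V_h` with `v_b = Q_b g₁` on `Γ_d` and `v_n = Q_n g₂` on
`Γ_n`. -/
def Vhg (k : ℕ) (Γd Γn : Set (Pt d)) (g₁ g₂ : Pt d → ℝ) : Set M.WeakFunction :=
  {v | v ∈ M.Vh k ∧
    (∀ e : M.faces, IsFaceOf (Ω := Ω) Γd e.1 → IsL2Projection e.1 k g₁ (v.vb e)) ∧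
    (∀ e : M.faces, IsFaceOf (Ω := Ω) Γn e.1 →
      ∀ T : M.elems, e.1 ⊆ frontier T.1 → IsL2Projection e.1 ((k : ℤ) - 1) g₂ (v.vn T e))}

/-- The subspace `V_h^0`. -/
def Vh0 (k : ℕ) (Γd Γn : Set (Pt d)) : Set M.WeakFunction := M.Vhg k Γd Γn 0 0

/-! ### The discrete weak Laplacian and the scheme -/

/-- `q ∈ P_r(T)` satisfies
`(q, φ)_T = (v₀, Δφ)_T - ⟨v_b, ∇φ · n⟩_{∂T} + ⟨v_n, φ⟩_{∂T}` for all `φ ∈ P_r(T)`. -/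
def IsDiscreteWeakLaplacian (r : ℤ) (T : M.elems) (v : M.WeakFunction) (q : Poly d) : Prop :=
  q ∈ polySpace d r ∧ ∀ φ ∈ polySpace d r,
    ∫ x in T.1, evalAt q x * evalAt φ x =
      (∫ x in T.1, evalAt (v.v0 T) x * evalAt (lap φ) x)
        - M.boundaryIntegral T.1 (fun e x => v.vb e x * dirDeriv φ (M.normal T.1 e.1) x)
        + M.boundaryIntegral T.1 (fun e x => v.vn T e x * evalAt φ x)

open Classical in
/-- The discrete weak Laplacian `Δ_{w,r,T} v`: the unique polynomial in `P_r(T)` with the above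
property. -/
def weakLaplacian (r : ℤ) (T : M.elems) (v : M.WeakFunction) : Poly d :=
  if h : ∃ q, M.IsDiscreteWeakLaplacian r T v q then h.choose else 0

/-- `Δ_{w,h} v`, computed element by element with `r = k - 2`. -/
def weakLaplacianH (k : ℕ) (v : M.WeakFunction) : M.PiecewisePoly :=
  fun T => M.weakLaplacian ((k : ℤ) - 2) T v

/-- The `L²(Ω)` inner product of two piecewise polynomials. -/
def innerPP (p w : M.PiecewisePoly) : ℝ := ∑ T : M.elems, ∫ x in T.1, evalAt (p T) x * evalAt (w T) x

/-- The `L²(Ω)` inner product `(f, w)`, with `w` a piecewise polynomial. -/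
def load (f : Pt d → ℝ) (w : M.PiecewisePoly) : ℝ := ∑ T : M.elems, ∫ x in T.1, f x * evalAt (w T) x

/-- The local stabilizer `s_T(σ, v)`; here `h_T` is the diameter of `T`. -/
def stabT (T : M.elems) (σ v : M.WeakFunction) : ℝ :=
  (Metric.diam T.1 ^ 3)⁻¹ * M.boundaryIntegral T.1 (fun e x =>
      (evalAt (σ.v0 T) x - σ.vb e x) * (evalAt (v.v0 T) x - v.vb e x))
  + (Metric.diam T.1)⁻¹ * M.boundaryIntegral T.1 (fun e x =>
      (dirDeriv (σ.v0 T) (M.normal T.1 e.1) x - σ.vn T e x) *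
        (dirDeriv (v.v0 T) (M.normal T.1 e.1) x - v.vn T e x))

/-- The stabilizer `s(σ, v)`. -/
def stab (σ v : M.WeakFunction) : ℝ := ∑ T : M.elems, M.stabT T σ v

/-- `(u, lam)` solves the primal-dual weak Galerkin scheme of order `k` for the data
`f`, `g₁` on `Γ_d`, `g₂` on `Γ_n`. -/
structure IsSolution (k : ℕ) (Γd Γn : Set (Pt d)) (f g₁ g₂ : Pt d → ℝ)
    (u : M.WeakFunction) (lam : M.PiecewisePoly) : Prop where
  u_mem : u ∈ M.Vhg k Γd Γn g₁ g₂
  lam_mem : lam ∈ M.Wh k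
  dual_eq : ∀ v ∈ M.Vh0 k Γd Γn, M.stab u v + M.innerPP (M.weakLaplacianH k v) lam = 0
  primal_eq : ∀ w ∈ M.Wh k, M.innerPP (M.weakLaplacianH k u) w = M.load f w

end PolytopalMesh

end PDWG

end

open MeasureTheory
open scoped Topology

noncomputable section

namespace PDWG

/-! ### Polynomials as functions -/

section Polynomials

variable {d : ℕ}

/-! The scheme is a square linear system in finite dimension. `V_h^g` is a nonempty translate of
`V_h^0`, because the projections of the data exist and are unique. It therefore suffices that the
homogeneous saddle point system on `V_h^0 × W_h` has only the zero solution
(`existsUnique_of_injective`).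

Let `(u, λ)` solve the homogeneous system. Testing with `(u, -λ)` gives `s(u, u) = 0`, so on every
face `u_b` is the trace of `u₀` and `u_n` its normal derivative. By Green's formula (`green`) the
weak Laplacian of `u` is then tested like the true Laplacian of `u₀`, which lies in `P_{k-2}` on
each element, and so `Δu₀ = 0`. As `u_b` and `u_n n` are single valued, the Cauchy data of `u₀`
match across interior faces; they vanish on some face of `Γ_d ∩ Γ_n`. Unique continuation gives `u =
0` (`primal_eq_zero`). The components of `v` can now be varied freely in `(Δ_w v, λ) = 0`. From `v₀`
follows `Δλ = 0`; from `v_b` and `v_n` follows that the Cauchy data of `λ` match across interior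
faces and vanish on a boundary face free of both conditions. Again unique continuation applies
(`dual_eq_zero`).

Unique continuation has an algebraic and a geometric half. A harmonic polynomial with zero Cauchy
data on a flat face vanishes, by induction on the degree (`eq_zero_of_lap_eq_zero_of_cauchy`).
Vanishing spreads to all elements because those of a connected domain are linked through interior
faces (`forall_elems_of_closed_under_neighbours`).

The geometry rests on generic lines: almost every line in a given direction meets the faces
transversally and only at points where the element is locally a half space (`ae_line_regular`,
`eventually_of_isRegularAt`). This also yields the divergence theorem on a nonconvex element
(`integral_fderiv`): its indicator is a signed sum of indicators of face shadows, and each shadow is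
integrated by Fubini along the direction. -/

lemma analyticOnNhd_evalAt (p : Poly d) : AnalyticOnNhd ℝ (evalAt p) Set.univ := by
  intro x _
  have := AnalyticAt.aeval_mvPolynomial (𝕜 := ℝ) (A := ℝ) (z := x)
    (f := fun (y : Pt d) (i : Fin d) => y i)
    (fun i => (EuclideanSpace.proj (𝕜 := ℝ) i : Pt d →L[ℝ] ℝ).analyticAt x) p
  simp only [MvPolynomial.aeval_eq_eval] at this
  exact this

lemma contDiff_evalAt (p : Poly d) {n : WithTop ℕ∞} : ContDiff ℝ n (evalAt p) :=
  (analyticOnNhd_evalAt p).contDiff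

@[fun_prop]
lemma continuous_evalAt (p : Poly d) : Continuous (evalAt p) :=
  (contDiff_evalAt p (n := 0)).continuous

@[simp] lemma evalAt_add (p q : Poly d) (x : Pt d) : evalAt (p + q) x = evalAt p x + evalAt q x := by
  simp [evalAt]

@[simp] lemma evalAt_sub (p q : Poly d) (x : Pt d) : evalAt (p - q) x = evalAt p x - evalAt q x := by
  simp [evalAt]

@[simp] lemma evalAt_mul (p q : Poly d) (x : Pt d) : evalAt (p * q) x = evalAt p x * evalAt q x := by
  simp [evalAt]

@[simp] lemma evalAt_smul (c : ℝ) (p : Poly d) (x : Pt d) : evalAt (c • p) x = c * evalAt p x := by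
  simp [evalAt]

@[simp] lemma evalAt_zero (x : Pt d) : evalAt (0 : Poly d) x = 0 := by
  simp [evalAt]

@[simp] lemma evalAt_sum {ι : Type*} (s : Finset ι) (p : ι → Poly d) (x : Pt d) :
    evalAt (∑ i ∈ s, p i) x = ∑ i ∈ s, evalAt (p i) x := by
  simp [evalAt]

lemma eq_zero_of_evalAt_eq_zero {p : Poly d} (h : ∀ x, evalAt p x = 0) : p = 0 := by
  apply MvPolynomial.funext
  intro x
  simpa [evalAt] using h (WithLp.toLp 2 x)

/-- The derivative of a polynomial in the direction `v`, as a derivation. -/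
def dirDerivation (v : Pt d) : Derivation ℝ (Poly d) (Poly d) :=
  ∑ i, v i • MvPolynomial.pderiv i

lemma dirDerivation_apply (v : Pt d) (p : Poly d) :
    dirDerivation v p = ∑ i, v i • MvPolynomial.pderiv i p := by
  simp only [dirDerivation, ← Derivation.coeFnAddMonoidHom_apply, map_sum, Finset.sum_apply]
  simp [Derivation.coeFnAddMonoidHom_apply]

lemma evalAt_dirDerivation (v x : Pt d) (p : Poly d) :
    evalAt (dirDerivation v p) x = dirDeriv p v x := by
  simp [dirDerivation_apply, dirDeriv, mul_comm]

lemma dirDerivation_add (v w : Pt d) (p : Poly d) :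
    dirDerivation (v + w) p = dirDerivation v p + dirDerivation w p := by
  simp [dirDerivation_apply, add_smul, Finset.sum_add_distrib]

lemma dirDerivation_smul (c : ℝ) (v : Pt d) (p : Poly d) :
    dirDerivation (c • v) p = c • dirDerivation v p := by
  simp [dirDerivation_apply, mul_smul, Finset.smul_sum]

/-- The commutator of two derivations is a derivation, and this one kills the variables. -/
lemma pderiv_pderiv_comm (i j : Fin d) (p : Poly d) :
    MvPolynomial.pderiv i (MvPolynomial.pderiv j p) =
      MvPolynomial.pderiv j (MvPolynomial.pderiv i p) := by
  have h : ⁅(MvPolynomial.pderiv i : Derivation ℝ (Poly d) (Poly d)),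
      (MvPolynomial.pderiv j : Derivation ℝ (Poly d) (Poly d))⁆ = 0 := by
    apply MvPolynomial.derivation_ext
    intro k
    simp [Derivation.commutator_apply, MvPolynomial.pderiv_X, Pi.single_apply, apply_ite]
  have := congrArg (fun D => D p) h
  simpa [Derivation.commutator_apply, sub_eq_zero] using this

lemma lap_dirDerivation (v : Pt d) (p : Poly d) :
    lap (dirDerivation v p) = dirDerivation v (lap p) := by
  simp only [lap, dirDerivation_apply, map_sum, Derivation.map_smul]
  refine Finset.sum_congr rfl fun i _ => Finset.sum_congr rfl fun j _ => ?_
  rw [pderiv_pderiv_comm i j, pderiv_pderiv_comm i j]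

lemma hasDerivAt_evalAt_line (p : Poly d) (x v : Pt d) (t : ℝ) :
    HasDerivAt (fun s : ℝ => evalAt p (x + s • v)) (dirDeriv p v (x + t • v)) t := by
  simp only [← evalAt_dirDerivation]
  induction p using MvPolynomial.induction_on with
  | C a => simpa [evalAt, dirDerivation_apply] using hasDerivAt_const t a
  | add p q hp hq =>
    simp only [map_add, evalAt_add]
    exact hp.add hq
  | mul_X p i hp =>
    have hX : HasDerivAt (fun s : ℝ => evalAt (MvPolynomial.X i : Poly d) (x + s • v)) (v i) t := by
      have := ((hasDerivAt_id t).mul_const (v i)).const_add (x i)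
      simpa [evalAt] using this
    have hD : dirDerivation v (MvPolynomial.X i : Poly d) = MvPolynomial.C (v i) := by
      simp [dirDerivation_apply, MvPolynomial.pderiv_X, Pi.single_apply, MvPolynomial.smul_eq_C_mul]
    have h := hp.mul hX
    have h2 : evalAt (dirDerivation v (p * MvPolynomial.X i)) (x + t • v) =
        evalAt (dirDerivation v p) (x + t • v) * evalAt (MvPolynomial.X i : Poly d) (x + t • v) +
          evalAt p (x + t • v) * v i := by
      rw [Derivation.leibniz, hD, smul_eq_mul, smul_eq_mul, evalAt_add, evalAt_mul, evalAt_mul]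
      simp only [evalAt, MvPolynomial.eval_C]
      ring
    rw [h2]
    simp only [evalAt_mul]
    exact h

lemma fderiv_evalAt (p : Poly d) (x v : Pt d) : fderiv ℝ (evalAt p) x v = dirDeriv p v x := by
  have h1 := ((contDiff_evalAt p (n := 1)).differentiable (by simp) x).hasFDerivAt
  have h2 : HasDerivAt (fun s : ℝ => evalAt p (x + s • v)) (fderiv ℝ (evalAt p) x v) 0 := by
    have h3 : HasDerivAt (fun s : ℝ => x + s • v) v 0 := by
      simpa using ((hasDerivAt_id (0 : ℝ)).smul_const v).const_add x
    have h4 : HasFDerivAt (evalAt p) (fderiv ℝ (evalAt p) x) (x + (0 : ℝ) • v) := by simpa using h1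
    exact h4.comp_hasDerivAt 0 h3
  simpa using h2.unique (hasDerivAt_evalAt_line p x v 0)

lemma pderiv_mem_polySpace {r : ℤ} {p : Poly d} (hp : p ∈ polySpace d r) (i : Fin d) :
    MvPolynomial.pderiv i p ∈ polySpace d (r - 1) := by
  rw [polySpace, MvPolynomial.restrictSupport_eq_span] at hp
  induction hp using Submodule.span_induction with
  | mem x hx =>
    obtain ⟨a, ha, rfl⟩ := hx
    simp only [MvPolynomial.pderiv_monomial, polySpace, MvPolynomial.monomial_mem_restrictSupport]
    by_cases h : a i = 0
    · right; simp [h]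
    · left
      have hle : Finsupp.single i 1 ≤ a := by
        rw [Finsupp.single_le_iff]; omega
      have hs : ∑ j, a j = ∑ j, (a - Finsupp.single i 1 : Fin d →₀ ℕ) j + 1 := by
        conv_lhs => rw [← tsub_add_cancel_of_le hle]
        simp only [Finsupp.add_apply, Finset.sum_add_distrib]
        simp [Finsupp.single_apply]
      simp only [Set.mem_ofPred_eq] at ha ⊢
      rw [hs] at ha
      push_cast at ha ⊢
      linarith
  | zero => simp
  | add x y _ _ hx hy => rw [map_add]; exact add_mem hx hy
  | smul c x _ hx => rw [Derivation.map_smul]; exact Submodule.smul_mem _ c hx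

lemma polySpace_mono {r s : ℤ} (h : r ≤ s) : polySpace d r ≤ polySpace d s :=
  MvPolynomial.restrictSupport_mono _ fun _ ha => le_trans ha h

lemma polySpace_of_neg {r : ℤ} (hr : r < 0) {p : Poly d} (hp : p ∈ polySpace d r) : p = 0 := by
  rw [polySpace, MvPolynomial.mem_restrictSupport_iff] at hp
  rw [← MvPolynomial.support_eq_empty, ← Finset.coe_eq_empty, Set.eq_empty_iff_forall_notMem]
  intro a ha
  have := hp ha
  simp only [Set.mem_ofPred_eq] at this
  omega

lemma exists_mem_polySpace (p : Poly d) : ∃ m : ℕ, p ∈ polySpace d m := by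
  refine ⟨p.support.sup fun a => ∑ i, a i, ?_⟩
  rw [polySpace, MvPolynomial.mem_restrictSupport_iff]
  intro a ha
  have := Finset.le_sup (f := fun a : Fin d →₀ ℕ => ∑ i, a i) ha
  simp only [Set.mem_ofPred_eq]
  exact_mod_cast this

lemma dirDerivation_mem_polySpace {r : ℤ} {p : Poly d} (hp : p ∈ polySpace d r) (v : Pt d) :
    dirDerivation v p ∈ polySpace d (r - 1) := by
  rw [dirDerivation_apply]
  exact Submodule.sum_mem _ fun i _ => Submodule.smul_mem _ _ (pderiv_mem_polySpace hp i)

lemma lap_mem_polySpace {r : ℤ} {p : Poly d} (hp : p ∈ polySpace d r) :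
    lap p ∈ polySpace d (r - 2) := by
  have : r - 2 = r - 1 - 1 := by ring
  rw [this]
  exact Submodule.sum_mem _ fun i _ => pderiv_mem_polySpace (pderiv_mem_polySpace hp i) i

instance finiteDimensional_polySpace (r : ℤ) : FiniteDimensional ℝ (polySpace d r) := by
  have hfin : {a : Fin d →₀ ℕ | ((∑ i, a i : ℕ) : ℤ) ≤ r}.Finite := by
    have h1 : ((Set.univ : Set (Fin d)).pi fun _ => Set.Iic r.toNat).Finite :=
      Set.Finite.pi fun _ => Set.finite_Iic _
    refine Set.Finite.of_finite_image (h1.subset ?_) (f := fun a : Fin d →₀ ℕ => (a : Fin d → ℕ))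
      (DFunLike.coe_injective.injOn)
    rintro _ ⟨a, ha, rfl⟩ i _
    have : a i ≤ ∑ j, a j := Finset.single_le_sum (f := fun j => a j) (fun _ _ => Nat.zero_le _)
      (Finset.mem_univ i)
    simp only [Set.mem_ofPred_eq, Set.mem_Iic] at ha ⊢
    omega
  have := hfin.to_subtype
  exact Module.Finite.of_basis (MvPolynomial.basisRestrictSupport ℝ _)

lemma lap_add (p q : Poly d) : lap (p + q) = lap p + lap q := by
  simp [lap, Finset.sum_add_distrib]

lemma lap_smul (c : ℝ) (p : Poly d) : lap (c • p) = c • lap p := by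
  simp [lap, Finset.smul_sum]

/-- A polynomial which vanishes near a point of a hyperplane, within the hyperplane, vanishes on
the hyperplane. -/
lemma evalAt_eq_zero_of_eventually {V : Submodule ℝ (Pt d)} {p : Poly d} {x₀ : Pt d} {w₀ : V}
    (h : ∀ᶠ w : V in 𝓝 w₀, evalAt p (x₀ + w) = 0) (w : V) : evalAt p (x₀ + w) = 0 := by
  have han : AnalyticOnNhd ℝ (fun w : V => evalAt p (x₀ + w)) Set.univ := by
    intro w _
    have h1 : AnalyticAt ℝ (fun w : V => x₀ + (w : Pt d)) w :=
      analyticAt_const.add (V.subtypeL.analyticAt w)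
    exact AnalyticAt.comp (g := evalAt p) (analyticOnNhd_evalAt p _ (Set.mem_univ _)) h1
  have := han.eqOn_zero_of_preconnected_of_eventuallyEq_zero isPreconnected_univ (Set.mem_univ w₀) h
  exact this (Set.mem_univ w)

/-- A line tangent to the hyperplane stays in it, so `p` is constant along that line. -/
lemma evalAt_dirDerivation_eq_zero {n x₀ : Pt d} {p : Poly d}
    (h : ∀ w : Pt d, inner ℝ n w = 0 → evalAt p (x₀ + w) = 0) {u : Pt d} (hu : inner ℝ n u = 0)
    (w : Pt d) (hw : inner ℝ n w = 0) : evalAt (dirDerivation u p) (x₀ + w) = 0 := by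
  have h1 := hasDerivAt_evalAt_line p (x₀ + w) u 0
  have h2 : (fun s : ℝ => evalAt p (x₀ + w + s • u)) = fun _ => 0 := by
    ext s
    rw [add_assoc]
    exact h _ (by simp [inner_add_right, inner_smul_right, hu, hw])
  rw [h2] at h1
  simpa [evalAt_dirDerivation] using h1.unique (hasDerivAt_const 0 0)

lemma dirDerivation_single (i : Fin d) (p : Poly d) :
    dirDerivation (EuclideanSpace.single i 1) p = MvPolynomial.pderiv i p := by
  simp [dirDerivation_apply]

/-- The Laplacian splits into the second normal derivative and second tangential derivatives. -/
lemma lap_eq_normal_add_tangential {n : Pt d} (hn : ‖n‖ = 1) (p : Poly d) :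
    lap p = dirDerivation n (dirDerivation n p) +
      ∑ i, dirDerivation (EuclideanSpace.single i 1 - n i • n)
        (dirDerivation (EuclideanSpace.single i 1 - n i • n) p) := by
  have hn2 : ∑ i, n i * n i = 1 := by
    have := EuclideanSpace.real_norm_sq_eq n
    rw [hn] at this
    simpa [pow_two] using this.symm
  have hsub : ∀ (i : Fin d) (q : Poly d), dirDerivation (EuclideanSpace.single i 1 - n i • n) q =
      MvPolynomial.pderiv i q - n i • dirDerivation n q := by
    intro i q
    rw [sub_eq_add_neg, ← neg_smul, dirDerivation_add, dirDerivation_smul, dirDerivation_single,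
      neg_smul, ← sub_eq_add_neg]
  have hpd : ∀ i, MvPolynomial.pderiv i (dirDerivation n p) =
      dirDerivation n (MvPolynomial.pderiv i p) := by
    intro i
    simp only [dirDerivation_apply, map_sum, Derivation.map_smul]
    exact Finset.sum_congr rfl fun j _ => by rw [pderiv_pderiv_comm]
  have h1 : ∑ i, n i • MvPolynomial.pderiv i (dirDerivation n p) =
      dirDerivation n (dirDerivation n p) := (dirDerivation_apply n _).symm
  have h2 : ∑ i, n i • dirDerivation n (MvPolynomial.pderiv i p) =
      dirDerivation n (dirDerivation n p) := by
    rw [← h1]; exact Finset.sum_congr rfl fun i _ => by rw [hpd]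
  -- Expanding the tangential squares, the cross terms give `-2 ∂ₙ²` and `∑ nᵢ² = 1` gives back
  -- `∂ₙ²`.
  simp only [hsub, map_sub, Derivation.map_smul, smul_sub, Finset.sum_sub_distrib, smul_smul]
  rw [h1, h2, ← Finset.sum_smul, hn2, one_smul, lap]
  abel

/-- A harmonic polynomial with vanishing Cauchy data on a hyperplane is zero. -/
theorem eq_zero_of_lap_eq_zero_of_cauchy {n x₀ : Pt d} (hn : ‖n‖ = 1) {p : Poly d}
    (hlap : lap p = 0)
    (h0 : ∀ w : Pt d, inner ℝ n w = 0 → evalAt p (x₀ + w) = 0)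
    (h1 : ∀ w : Pt d, inner ℝ n w = 0 → evalAt (dirDerivation n p) (x₀ + w) = 0) : p = 0 := by
  obtain ⟨m, hm⟩ := exists_mem_polySpace p
  -- The degree bound is shifted by one so that the induction starts at `P_{-1} = {0}`.
  have key : ∀ (m : ℕ) (p : Poly d), p ∈ polySpace d ((m : ℤ) - 1) → lap p = 0 →
      (∀ w : Pt d, inner ℝ n w = 0 → evalAt p (x₀ + w) = 0) →
      (∀ w : Pt d, inner ℝ n w = 0 → evalAt (dirDerivation n p) (x₀ + w) = 0) → p = 0 := by
    intro m
    induction m with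
    | zero => intro p hp _ _ _; exact polySpace_of_neg (by norm_num) hp
    | succ m ih =>
      intro p hp hlap h0 h1
      -- The normal derivative is harmonic of lower degree. Its own normal derivative on the
      -- hyperplane is `Δp` minus tangential second derivatives of `p`, all of which vanish there.
      have hD : dirDerivation n p = 0 := by
        apply ih
        · simpa using dirDerivation_mem_polySpace hp n
        · rw [lap_dirDerivation, hlap, map_zero]
        · exact h1
        · intro w hw
          have h := congrArg (fun q => evalAt q (x₀ + w)) (lap_eq_normal_add_tangential hn p)
          simp only [hlap, evalAt_add, evalAt_sum, evalAt_zero] at h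
          rw [Finset.sum_eq_zero, add_zero] at h
          · exact h.symm
          · intro i _
            have hi : inner ℝ n (EuclideanSpace.single i 1 - n i • n) = 0 := by
              simp [inner_sub_right, inner_smul_right, hn, EuclideanSpace.inner_single_right]
            exact evalAt_dirDerivation_eq_zero (fun w hw => evalAt_dirDerivation_eq_zero h0 hi w hw)
              hi w hw
      apply eq_zero_of_evalAt_eq_zero
      intro x
      set s := inner ℝ n (x - x₀) with hs
      have hw : inner ℝ n (x - x₀ - s • n) = 0 := by
        rw [inner_sub_right, inner_smul_right, real_inner_self_eq_norm_sq, hn, ← hs]; ring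
      -- Since `∂ₙ p = 0`, `p` is constant along normal lines, and each of them meets the
      -- hyperplane, where `p = 0`.
      have hconst : ∀ t : ℝ, evalAt p (x₀ + (x - x₀ - s • n) + t • n) =
          evalAt p (x₀ + (x - x₀ - s • n) + (0 : ℝ) • n) := by
        intro t
        have hd : ∀ t, HasDerivAt (fun t : ℝ => evalAt p (x₀ + (x - x₀ - s • n) + t • n)) 0 t := by
          intro t
          have := hasDerivAt_evalAt_line p (x₀ + (x - x₀ - s • n)) n t
          rwa [← evalAt_dirDerivation, hD, evalAt_zero] at this
        exact is_const_of_deriv_eq_zero (fun t => (hd t).differentiableAt) (fun t => (hd t).deriv) t 0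
      have := hconst s
      rw [zero_smul, add_zero, h0 _ hw] at this
      convert this using 2
      abel
  exact key (m + 1) p (by simpa using hm) hlap h0 h1

end Polynomials

/-! ### Surface measure on hyperplanes -/

section Hyperplanes

variable {d : ℕ}

/-- The direction of the hyperplanes orthogonal to `n`. -/
abbrev perp (n : Pt d) : Submodule ℝ (Pt d) := (ℝ ∙ n)ᗮ

/-- The hyperplane through `x₀` orthogonal to `n`, parametrised by its direction. -/
def hyperplaneMap (n x₀ : Pt d) : perp n →ᵃ[ℝ] Pt d :=
  (perp n).subtype.toAffineMap + AffineMap.const ℝ _ x₀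

lemma hyperplaneMap_apply (n x₀ : Pt d) (w : perp n) : hyperplaneMap n x₀ w = x₀ + w := by
  simp [hyperplaneMap, add_comm]

lemma isometry_hyperplaneMap (n x₀ : Pt d) : Isometry (hyperplaneMap n x₀) := by
  refine Isometry.of_dist_eq fun a b => ?_
  simp [hyperplaneMap_apply, Subtype.dist_eq]

lemma measurableEmbedding_hyperplaneMap (n x₀ : Pt d) :
    MeasurableEmbedding (hyperplaneMap n x₀) :=
  (isometry_hyperplaneMap n x₀).isClosedEmbedding.measurableEmbedding

lemma mem_range_hyperplaneMap {n x₀ x : Pt d} :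
    x ∈ Set.range (hyperplaneMap n x₀) ↔ inner ℝ n (x - x₀) = 0 := by
  rw [← Submodule.mem_orthogonal_singleton_iff_inner_right]
  constructor
  · rintro ⟨w, rfl⟩
    simp [hyperplaneMap_apply]
  · intro h
    exact ⟨⟨x - x₀, h⟩, by simp [hyperplaneMap_apply]⟩

lemma finrank_perp {n : Pt d} (hn : ‖n‖ = 1) : Module.finrank ℝ (perp n) = d - 1 := by
  have h1 : n ≠ 0 := by rintro rfl; simp at hn
  have h2 := (ℝ ∙ n).finrank_add_finrank_orthogonal
  rw [finrank_span_singleton h1, finrank_euclideanSpace_fin] at h2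
  simp only [perp]
  omega

/-- Isometries preserve Hausdorff measure, which on a space of dimension `d - 1` is Lebesgue measure
in the normalisation `μHE[d - 1]`. -/
lemma map_hyperplaneMap {n : Pt d} (hn : ‖n‖ = 1) (x₀ : Pt d) :
    (volume : Measure (perp n)).map (hyperplaneMap n x₀) =
      (μHE[d - 1] : Measure (Pt d)).restrict (Set.range (hyperplaneMap n x₀)) := by
  rw [← (isometry_hyperplaneMap n x₀).map_euclideanHausdorffMeasure, ← finrank_perp hn,
    InnerProductSpace.euclideanHausdorffMeasure_eq_volume]

lemma volume_preimage_hyperplaneMap {n : Pt d} (hn : ‖n‖ = 1) (x₀ : Pt d) (A : Set (Pt d)) :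
    volume (hyperplaneMap n x₀ ⁻¹' A) =
      (μHE[d - 1] : Measure (Pt d)) (A ∩ Set.range (hyperplaneMap n x₀)) := by
  rw [← (measurableEmbedding_hyperplaneMap n x₀).map_apply, map_hyperplaneMap hn,
    Measure.restrict_apply' (measurableEmbedding_hyperplaneMap n x₀).measurableSet_range]

lemma setIntegral_hyperplaneMap {n : Pt d} (hn : ‖n‖ = 1) (x₀ : Pt d) {A : Set (Pt d)}
    (hA : MeasurableSet A) (hsub : A ⊆ Set.range (hyperplaneMap n x₀)) (f : Pt d → ℝ) :
    ∫ w in hyperplaneMap n x₀ ⁻¹' A, f (hyperplaneMap n x₀ w) =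
      ∫ x in A, f x ∂(μHE[d - 1] : Measure (Pt d)) := by
  rw [← (measurableEmbedding_hyperplaneMap n x₀).setIntegral_map, map_hyperplaneMap hn,
    Measure.restrict_restrict hA, Set.inter_eq_left.2 hsub]

/-- Lebesgue measure is the product of the measures on the span of `n` and on its orthogonal
complement; a unit `n` identifies the span with `ℝ` isometrically. -/
lemma measurePreserving_orthogonal {n : Pt d} (hn : ‖n‖ = 1) (x₀ : Pt d) :
    MeasurePreserving (fun p : ℝ × perp n => x₀ + (p.2 : Pt d) + p.1 • n)
      (volume.prod volume) volume := by
  have h1 := ((ℝ ∙ n).measurePreserving_measurableEquivProd x₀).symm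
  rw [InnerProductSpace.euclideanHausdorffMeasure_eq_volume] at h1
  have h2 := (LinearIsometryEquiv.toSpanUnitSingleton (𝕜 := ℝ) n hn).measurePreserving.prod
    (MeasurePreserving.id (volume : Measure (perp n)))
  have hfun : (fun p : ℝ × perp n => x₀ + (p.2 : Pt d) + p.1 • n) =
      ((ℝ ∙ n).measurableEquivProd x₀).symm ∘
        Prod.map (LinearIsometryEquiv.toSpanUnitSingleton (𝕜 := ℝ) n hn) id := by
    funext p
    simp only [Function.comp, Submodule.measurableEquivProd_symm_apply, Prod.map,
      LinearIsometryEquiv.toSpanUnitSingleton_apply, vadd_eq_add, id]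
    abel
  rw [hfun]
  exact h1.comp h2

/-- Slanted coordinates: Lebesgue measure is `|n · v|` times the product of Lebesgue measure along
`v` and of surface measure on a hyperplane orthogonal to `n`. -/
lemma measurePreserving_slanted {n : Pt d} (hn : ‖n‖ = 1) (x₀ : Pt d) {v : Pt d}
    (hv : inner ℝ n v ≠ 0) :
    MeasurePreserving (fun p : ℝ × perp n => hyperplaneMap n x₀ p.2 + p.1 • v)
      ((ENNReal.ofReal |inner ℝ n v| • volume).prod volume) volume := by
  set c := inner ℝ n v with hc
  have hw : v - c • n ∈ perp n := by
    rw [Submodule.mem_orthogonal_singleton_iff_inner_right, inner_sub_right, inner_smul_right,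
      real_inner_self_eq_norm_sq, hn, ← hc]
    ring
  have h1 : MeasurePreserving (fun t : ℝ => c * t) (ENNReal.ofReal |c| • volume) volume := by
    refine ⟨by fun_prop, ?_⟩
    rw [Measure.map_smul, Real.smul_map_volume_mul_left hv]
  -- The orthogonal coordinates of `x₀ + w + t v` are `c t` and `w + t (v - c n)`. The slanted map
  -- is thus a scaling, which accounts for `|c|`, combined with a shear by translations.
  have h2 : MeasurePreserving (fun p : ℝ × perp n => (c * p.1, p.1 • (⟨_, hw⟩ : perp n) + p.2))
      ((ENNReal.ofReal |c| • volume).prod volume) (volume.prod volume) := by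
    refine h1.skew_product (g := fun t w => t • (⟨_, hw⟩ : perp n) + w) (by fun_prop) ?_
    exact Filter.Eventually.of_forall fun t => map_add_left_eq_self volume _
  convert (measurePreserving_orthogonal hn x₀).comp h2 using 1
  funext p
  simp only [Function.comp, hyperplaneMap_apply, Submodule.coe_add, Submodule.coe_smul, smul_sub,
    smul_smul, mul_comm c]
  abel

lemma slanted_injective {n : Pt d} (x₀ : Pt d) {v : Pt d} (hv : inner ℝ n v ≠ 0) :
    Function.Injective (fun p : ℝ × perp n => hyperplaneMap n x₀ p.2 + p.1 • v) := by
  rintro ⟨t, w⟩ ⟨t', w'⟩ h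
  have hz : ∀ w : perp n, inner ℝ n (w : Pt d) = 0 := fun w =>
    Submodule.mem_orthogonal_singleton_iff_inner_right.1 w.2
  simp only [hyperplaneMap_apply] at h
  have h1 := congrArg (inner ℝ n) h
  simp only [inner_add_right, inner_smul_right, hz, add_zero, add_right_inj] at h1
  obtain rfl : t = t' := mul_right_cancel₀ hv h1
  simp only [add_left_inj, add_right_inj] at h
  rw [Subtype.ext h]

lemma measurableEmbedding_slanted {n : Pt d} (x₀ : Pt d) {v : Pt d} (hv : inner ℝ n v ≠ 0) :
    MeasurableEmbedding (fun p : ℝ × perp n => hyperplaneMap n x₀ p.2 + p.1 • v) := by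
  refine Continuous.measurableEmbedding ?_ (slanted_injective x₀ hv)
  have := (isometry_hyperplaneMap n x₀).continuous
  fun_prop

/-- Almost every line in a given transversal direction avoids a null set of a hyperplane. -/
lemma ae_line_notMem_of_null {n : Pt d} (hn : ‖n‖ = 1) {x₀ v : Pt d} (hv : inner ℝ n v ≠ 0)
    {A : Set (Pt d)} (hA : A ⊆ Set.range (hyperplaneMap n x₀))
    (hA0 : (μHE[d - 1] : Measure (Pt d)) A = 0) :
    ∀ᵐ x : Pt d, ∀ t : ℝ, x + t • v ∉ A := by
  rw [ae_iff, ← (measurePreserving_slanted hn x₀ hv).measure_preimage_emb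
    (measurableEmbedding_slanted x₀ hv)]
  refine measure_mono_null (t := Set.univ ×ˢ (hyperplaneMap n x₀ ⁻¹' A)) ?_ ?_
  · rintro ⟨s, w⟩ h
    simp only [not_forall, not_not, Set.mem_preimage, Set.mem_ofPred_eq] at h
    obtain ⟨t, ht⟩ := h
    refine ⟨trivial, ?_⟩
    obtain ⟨w', hw'⟩ := hA ht
    -- A transversal line meets the hyperplane only once, so the exceptional set lies in the
    -- cylinder over `A`.
    have := @slanted_injective d n x₀ v hv (s + t, w) (0, w') (by simp [hw', add_smul, add_assoc])
    simp only [Prod.mk.injEq] at this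
    obtain ⟨h1, rfl⟩ := this
    rw [Set.mem_preimage, hw']
    exact ht
  · rw [Measure.prod_prod, volume_preimage_hyperplaneMap hn, measure_mono_null Set.inter_subset_left hA0,
      mul_zero]

lemma volume_hyperplane {n : Pt d} (hn : ‖n‖ = 1) (x₀ : Pt d) :
    volume (Set.range (hyperplaneMap n x₀)) = 0 := by
  have hv : inner ℝ n n ≠ (0 : ℝ) := by simp [hn]
  rw [← (measurePreserving_slanted hn x₀ hv).measure_preimage_emb
    (measurableEmbedding_slanted x₀ hv)]
  refine measure_mono_null (t := {(0 : ℝ)} ×ˢ Set.univ) ?_ ?_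
  · rintro ⟨t, w⟩ ⟨w', hw'⟩
    have := @slanted_injective d n x₀ n hv (t, w) (0, w') (by simp [hw'])
    simp only [Prod.mk.injEq] at this
    simp [this.1]
  · rw [Measure.prod_prod]
    simp

/-- Almost every line in a direction parallel to a hyperplane avoids the hyperplane. -/
lemma ae_line_notMem_hyperplane {n : Pt d} (hn : ‖n‖ = 1) (x₀ : Pt d) {v : Pt d}
    (hv : inner ℝ n v = 0) :
    ∀ᵐ x : Pt d, ∀ t : ℝ, x + t • v ∉ Set.range (hyperplaneMap n x₀) := by
  rw [ae_iff]
  -- A line parallel to the hyperplane that meets it lies in it, so the exceptional points are on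
  -- the hyperplane itself.
  refine measure_mono_null ?_ (volume_hyperplane hn x₀)
  intro x hx
  simp only [not_forall, not_not, Set.mem_ofPred_eq, mem_range_hyperplaneMap] at hx ⊢
  obtain ⟨t, ht⟩ := hx
  rw [add_sub_right_comm, inner_add_right, inner_smul_right, hv] at ht
  simpa using ht

end Hyperplanes

/-! ### Polyhedral sets -/

section Polyhedral

variable {d : ℕ}

lemma IsPolyhedral.isCompact {m : ℕ} {S : Set (Pt d)} (h : IsPolyhedral m S) : IsCompact S := by
  obtain ⟨𝒮, hfin, -, rfl⟩ := h
  exact hfin.isCompact_biUnion fun s _ => (Set.finite_range _).isCompact_convexHull ℝ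

lemma IsPolyhedral.nonempty {m : ℕ} {S : Set (Pt d)} (h : IsPolyhedral m S) : S.Nonempty := by
  obtain ⟨𝒮, -, ⟨s, hs⟩, rfl⟩ := h
  exact ⟨s.points 0, Set.mem_biUnion hs (subset_convexHull ℝ _ ⟨0, rfl⟩)⟩

/-- In an affine space of its own dimension a nondegenerate simplex is convex with nonempty
interior, hence lies in the closure of that interior. -/
lemma preimage_convexHull_subset_closure_interior {V : Type*} [NormedAddCommGroup V]
    [NormedSpace ℝ V] [FiniteDimensional ℝ V] {m : ℕ} {p : Fin (m + 1) → Pt d}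
    (hp : AffineIndependent ℝ p) (L : V →ᵃ[ℝ] Pt d) (hL : Function.Injective L)
    (hm : Module.finrank ℝ V = m) (hS : convexHull ℝ (Set.range p) ⊆ Set.range L) :
    L ⁻¹' convexHull ℝ (Set.range p) ⊆
      closure (interior (L ⁻¹' convexHull ℝ (Set.range p))) := by
  have hex : ∀ i, ∃ w, L w = p i := fun i =>
    hS (subset_convexHull ℝ _ (Set.mem_range_self i))
  choose q hq using hex
  have hLq : L ∘ q = p := funext hq
  have hpre : L ⁻¹' (convexHull ℝ (Set.range p)) = convexHull ℝ (Set.range q) := by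
    rw [← hLq, Set.range_comp, ← AffineMap.image_convexHull, Set.preimage_image_eq _ hL]
  have hind : AffineIndependent ℝ q := by
    apply AffineIndependent.of_comp L
    rwa [hLq]
  have hspan : affineSpan ℝ (Set.range q) = ⊤ := by
    rw [hind.affineSpan_eq_top_iff_card_eq_finrank_add_one, hm]
    simp
  have hinter := (interior_convexHull_nonempty_iff_affineSpan_eq_top (s := Set.range q)).2 hspan
  rw [hpre, (convex_convexHull ℝ (Set.range q)).closure_interior_eq_closure_of_nonempty_interior
    hinter]
  exact subset_closure

/-- A polyhedral set is the closure of its interior relative to an affine space of its own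
dimension. -/
lemma IsPolyhedral.preimage_subset_closure_interior {V : Type*} [NormedAddCommGroup V]
    [NormedSpace ℝ V] [FiniteDimensional ℝ V] {m : ℕ} {S : Set (Pt d)} (h : IsPolyhedral m S)
    (L : V →ᵃ[ℝ] Pt d) (hL : Function.Injective L) (hm : Module.finrank ℝ V = m)
    (hS : S ⊆ Set.range L) : L ⁻¹' S ⊆ closure (interior (L ⁻¹' S)) := by
  obtain ⟨𝒮, hfin, -, hU⟩ := h
  intro w hw
  have hw' : L w ∈ S := hw
  rw [hU, Set.mem_iUnion₂] at hw'
  obtain ⟨s, hs, hws⟩ := hw'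
  have hsub : convexHull ℝ (Set.range s.points) ⊆ S := by
    rw [hU]
    exact Set.subset_biUnion_of_mem (u := fun s : Affine.Simplex ℝ (Pt d) m =>
      convexHull ℝ (Set.range s.points)) hs
  exact closure_mono (interior_mono (Set.preimage_mono hsub))
    (preimage_convexHull_subset_closure_interior s.independent L hL hm (hsub.trans hS) hws)

lemma IsPolyhedral.subset_closure_interior {T : Set (Pt d)} (h : IsPolyhedral d T) :
    T ⊆ closure (interior T) := by
  simpa using h.preimage_subset_closure_interior (AffineMap.id ℝ (Pt d)) Function.injective_id
    (by simp) (by simp)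

end Polyhedral

/-! ### Geometry of the mesh -/

lemma inter_frontier_nonempty_of_isPreconnected {X : Type*} [TopologicalSpace X] {s T : Set X}
    (hs : IsPreconnected s) (h1 : (s ∩ T).Nonempty) (h2 : (s ∩ Tᶜ).Nonempty) :
    (s ∩ frontier T).Nonempty := by
  by_contra h
  have hno : ∀ x ∈ s, x ∈ interior T ∨ x ∉ closure T := by
    intro x hx
    by_contra! hc
    exact h ⟨x, hx, hc.2, hc.1⟩
  obtain ⟨a, ha, haT⟩ := h1
  obtain ⟨b, hb, hbT⟩ := h2
  obtain ⟨x, -, hx1, hx2⟩ := hs (interior T) (closure T)ᶜ isOpen_interior isClosed_closure.isOpen_compl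
    (fun x hx => hno x hx)
    ⟨a, ha, (hno a ha).resolve_right fun h => h (subset_closure haT)⟩
    ⟨b, hb, (hno b hb).resolve_left fun h => hbT (interior_subset h)⟩
  exact hx2 (interior_subset_closure hx1)

namespace PolytopalMesh

variable {d : ℕ} {Ω : Set (Pt d)} (M : PolytopalMesh Ω)

lemma exists_elem_of_face {e : Set (Pt d)} (he : e ∈ M.faces) :
    ∃ T ∈ M.elems, e ⊆ frontier T := by
  have h : {T | T ∈ M.elems ∧ e ⊆ frontier T}.ncard ≠ 0 := by
    by_cases hb : e ⊆ frontier Ω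
    · rw [M.boundary_face e he hb]; norm_num
    · rw [M.interior_face e he hb]; norm_num
  obtain ⟨T, hT⟩ := Set.nonempty_of_ncard_ne_zero h
  exact ⟨T, hT.1, hT.2⟩

lemma isCompact_face {e : Set (Pt d)} (he : e ∈ M.faces) : IsCompact e :=
  (M.face_polyhedral e he).isCompact

lemma isCompact_elem {T : Set (Pt d)} (hT : T ∈ M.elems) : IsCompact T :=
  (M.elem_polyhedral T hT).isCompact

lemma isClosed_elem {T : Set (Pt d)} (hT : T ∈ M.elems) : IsClosed T :=
  (M.isCompact_elem hT).isClosed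

lemma norm_normal {T e : Set (Pt d)} (hT : T ∈ M.elems) (he : e ∈ M.faces)
    (heT : e ⊆ frontier T) : ‖M.normal T e‖ = 1 :=
  (M.isOutwardUnitNormal T hT e he heT).norm_eq_one

lemma face_subset_hyperplane {T e : Set (Pt d)} (hT : T ∈ M.elems) (he : e ∈ M.faces)
    (heT : e ⊆ frontier T) {x₀ : Pt d} (hx₀ : x₀ ∈ e) :
    e ⊆ Set.range (hyperplaneMap (M.normal T e) x₀) := fun x hx =>
  mem_range_hyperplaneMap.2 ((M.isOutwardUnitNormal T hT e he heT).orthogonal x hx x₀ hx₀)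

lemma measure_face_lt_top {e : Set (Pt d)} (he : e ∈ M.faces) :
    (μHE[d - 1] : Measure (Pt d)) e < ⊤ := by
  obtain ⟨T, hT, heT⟩ := M.exists_elem_of_face he
  obtain ⟨x₀, hx₀⟩ := (M.face_polyhedral e he).nonempty
  have h := volume_preimage_hyperplaneMap (M.norm_normal hT he heT) x₀ e
  rw [Set.inter_eq_left.2 (M.face_subset_hyperplane hT he heT hx₀)] at h
  rw [← h]
  exact ((isometry_hyperplaneMap _ x₀).isClosedEmbedding.isCompact_preimage
    (M.isCompact_face he)).measure_lt_top

/-- A face is the closure of its interior relative to its hyperplane, so any open set meeting it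
contains a nonempty relatively open piece of it. Hence integrals over faces detect continuous
functions pointwise. -/
lemma measure_face_inter_pos {e U : Set (Pt d)} (he : e ∈ M.faces) (hU : IsOpen U)
    (h : (e ∩ U).Nonempty) : 0 < (μHE[d - 1] : Measure (Pt d)) (e ∩ U) := by
  obtain ⟨T, hT, heT⟩ := M.exists_elem_of_face he
  obtain ⟨x₀, hx₀, hxU⟩ := h
  have hsub := M.face_subset_hyperplane hT he heT hx₀
  have hn := M.norm_normal hT he heT
  set L := hyperplaneMap (M.normal T e) x₀ with hL
  have hiso := isometry_hyperplaneMap (M.normal T e) x₀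
  have h1 := (M.face_polyhedral e he).preimage_subset_closure_interior L hiso.injective
    (finrank_perp hn) hsub
  have h0 : L 0 = x₀ := by simp [hL, hyperplaneMap_apply]
  have h2 : (0 : perp (M.normal T e)) ∈ closure (interior (L ⁻¹' e)) := by
    apply h1
    rw [Set.mem_preimage, h0]
    exact hx₀
  have hUo : IsOpen (L ⁻¹' U) := hU.preimage hiso.continuous
  have h3 : (L ⁻¹' U ∩ interior (L ⁻¹' e)).Nonempty :=
    mem_closure_iff.1 h2 _ hUo (by rw [Set.mem_preimage, h0]; exact hxU)
  have h4 : 0 < volume (L ⁻¹' U ∩ interior (L ⁻¹' e)) :=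
    (hUo.inter isOpen_interior).measure_pos _ h3
  have h5 := volume_preimage_hyperplaneMap hn x₀ (e ∩ U)
  rw [Set.inter_eq_left.2 (Set.inter_subset_left.trans hsub)] at h5
  rw [← h5]
  refine h4.trans_le (measure_mono ?_)
  rw [Set.preimage_inter, Set.inter_comm]
  exact Set.inter_subset_inter_left _ interior_subset

lemma faceMeasure_apply {e : Set (Pt d)} (he : e ∈ M.faces) (s : Set e) :
    faceMeasure e s = (μHE[d - 1] : Measure (Pt d)) (Subtype.val '' s) :=
  comap_subtype_coe_apply (M.isCompact_face he).measurableSet _ s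

lemma isFiniteMeasure_faceMeasure (e : M.faces) : IsFiniteMeasure (faceMeasure e.1) := by
  refine ⟨?_⟩
  rw [M.faceMeasure_apply e.2]
  simpa using M.measure_face_lt_top e.2

lemma isOpenPosMeasure_faceMeasure (e : M.faces) : (faceMeasure e.1).IsOpenPosMeasure := by
  refine ⟨fun s hs hne => ?_⟩
  obtain ⟨U, hU, rfl⟩ := isOpen_induced_iff.1 hs
  rw [M.faceMeasure_apply e.2, Subtype.image_preimage_coe]
  exact (M.measure_face_inter_pos e.2 hU (Subtype.preimage_coe_nonempty.1 hne)).ne'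

lemma compactSpace_face (e : M.faces) : CompactSpace e.1 :=
  isCompact_iff_compactSpace.1 (M.isCompact_face e.2)

attribute [instance] isFiniteMeasure_faceMeasure isOpenPosMeasure_faceMeasure compactSpace_face

lemma integral_faceMeasure {e : Set (Pt d)} (he : e ∈ M.faces) (f : Pt d → ℝ) :
    ∫ x, f x ∂(faceMeasure e) = ∫ x in e, f x ∂(μHE[d - 1] : Measure (Pt d)) :=
  integral_subtype_comap (M.isCompact_face he).measurableSet f

lemma volume_face {e : Set (Pt d)} (he : e ∈ M.faces) : volume e = 0 := by
  obtain ⟨T, hT, heT⟩ := M.exists_elem_of_face he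
  obtain ⟨x₀, hx₀⟩ := (M.face_polyhedral e he).nonempty
  exact measure_mono_null (M.face_subset_hyperplane hT he heT hx₀)
    (volume_hyperplane (M.norm_normal hT he heT) x₀)

lemma exists_face_of_mem_frontier {T : Set (Pt d)} (hT : T ∈ M.elems) {x : Pt d}
    (hx : x ∈ frontier T) : ∃ e ∈ M.faces, e ⊆ frontier T ∧ x ∈ e := by
  rw [M.frontier_elem T hT, Set.mem_iUnion₂] at hx
  obtain ⟨e, he, hxe⟩ := hx
  exact ⟨e, he.1, he.2, hxe⟩

lemma exists_face_of_mem_frontier_domain {x : Pt d} (hx : x ∈ frontier Ω) :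
    ∃ e ∈ M.faces, e ⊆ frontier Ω ∧ x ∈ e := by
  rw [M.frontier_domain, Set.mem_iUnion₂] at hx
  obtain ⟨e, he, hxe⟩ := hx
  exact ⟨e, he.1, he.2, hxe⟩

lemma volume_iUnion_faces : volume (⋃ e ∈ M.faces, e) = 0 :=
  (measure_biUnion_null_iff M.faces.countable_toSet).2 fun _ he => M.volume_face he

lemma volume_frontier_elem {T : Set (Pt d)} (hT : T ∈ M.elems) : volume (frontier T) = 0 := by
  refine measure_mono_null (fun x hx => ?_) M.volume_iUnion_faces
  obtain ⟨e, he, -, hxe⟩ := M.exists_face_of_mem_frontier hT hx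
  exact Set.mem_biUnion he hxe

lemma volume_frontier_domain {d : ℕ} {Ω : Set (Pt d)} (M : PolytopalMesh Ω) :
    volume (frontier Ω) = 0 := by
  refine measure_mono_null (fun x hx => ?_) M.volume_iUnion_faces
  obtain ⟨e, he, -, hxe⟩ := M.exists_face_of_mem_frontier_domain hx
  exact Set.mem_biUnion he hxe

/-! ### Regular boundary points -/

/-- `p` lies on no face other than `e`, and `T` lies on the side of `-n` of `e` at `p`. -/
structure IsRegularAt (T e : Set (Pt d)) (p : Pt d) : Prop where
  eq_of_mem : ∀ e' ∈ M.faces, p ∈ e' → e' = e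
  outward : ∀ᶠ t in 𝓝[>] (0 : ℝ),
    p - t • M.normal T e ∈ interior T ∧ p + t • M.normal T e ∉ T

/-- Almost every line in a given direction crosses the faces transversally, at regular points. -/
lemma ae_line_regular (v : Pt d) :
    ∀ᵐ x : Pt d, ∀ T ∈ M.elems, ∀ e ∈ M.faces, e ⊆ frontier T → ∀ t : ℝ, x + t • v ∈ e →
      inner ℝ (M.normal T e) v ≠ 0 ∧ M.IsRegularAt T e (x + t • v) := by
  refine (ae_ball_iff M.elems.countable_toSet).2 fun T hT =>
    (ae_ball_iff M.faces.countable_toSet).2 fun e he => ?_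
  by_cases heT : e ⊆ frontier T
  swap
  · exact Filter.Eventually.of_forall fun x h => absurd h heT
  obtain ⟨x₀, hx₀⟩ := (M.face_polyhedral e he).nonempty
  have hsub := M.face_subset_hyperplane hT he heT hx₀
  have hN := M.isOutwardUnitNormal T hT e he heT
  by_cases hv : inner ℝ (M.normal T e) v = 0
  · filter_upwards [ae_line_notMem_hyperplane hN.norm_eq_one x₀ hv] with x hx _ t ht
    exact absurd (hsub ht) (hx t)
  -- The overlaps with other faces, and below the set where the outward condition fails, are null
  -- subsets of the hyperplane of `e`; generic transversal lines avoid them.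
  have h1 : ∀ᵐ x : Pt d, ∀ e' ∈ M.faces, e' ≠ e → ∀ t : ℝ, x + t • v ∉ e ∩ e' := by
    refine (ae_ball_iff M.faces.countable_toSet).2 fun e' he' => ?_
    by_cases hne : e' = e
    · exact Filter.Eventually.of_forall fun x h => absurd hne h
    filter_upwards [ae_line_notMem_of_null hN.norm_eq_one hv (Set.inter_subset_left.trans hsub)
      (M.face_disjoint e he e' he' (Ne.symm hne))] with x hx _ using hx
  have h2 := hN.outward
  rw [ae_restrict_iff' (M.isCompact_face he).measurableSet, ae_iff] at h2
  have h3 := ae_line_notMem_of_null hN.norm_eq_one hv (x₀ := x₀) (fun x hx => by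
    simp only [Set.mem_ofPred_eq, Classical.not_imp] at hx
    exact hsub hx.1) h2
  filter_upwards [h1, h3] with x hx1 hx3 _ t ht
  refine ⟨hv, fun e' he' hmem => ?_, ?_⟩
  · by_contra hne
    exact hx1 e' he' hne t ⟨ht, hmem⟩
  · have := hx3 t
    simp only [not_not] at this
    exact this ht

/-- Near a regular boundary point, `T` is a half space. -/
lemma eventually_of_isRegularAt {T e : Set (Pt d)} (hT : T ∈ M.elems) (he : e ∈ M.faces)
    (heT : e ⊆ frontier T) {p : Pt d} (hp : p ∈ e) (hreg : M.IsRegularAt T e p) :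
    ∀ᶠ y in 𝓝 p, (inner ℝ (M.normal T e) (y - p) < 0 → y ∈ interior T) ∧
      (0 < inner ℝ (M.normal T e) (y - p) → y ∉ T) := by
  set n := M.normal T e with hn
  have hN : IsOutwardUnitNormal T e n := M.isOutwardUnitNormal T hT e he heT
  have hcl : IsClosed (⋃ e' ∈ {e' | e' ∈ M.faces ∧ e' ≠ e}, e') :=
    (M.faces.finite_toSet.subset fun e' he' => he'.1).isClosed_biUnion
      fun e' he' => (M.isCompact_face he'.1).isClosed
  have hpn : p ∉ ⋃ e' ∈ {e' | e' ∈ M.faces ∧ e' ≠ e}, e' := by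
    rw [Set.mem_iUnion₂]
    rintro ⟨e', he', hpe'⟩
    exact he'.2 (hreg.eq_of_mem e' he'.1 hpe')
  obtain ⟨r, hr, hball⟩ := Metric.isOpen_iff.1 hcl.isOpen_compl p hpn
  -- The ball misses all faces other than `e`, so inside it `frontier T` is contained in the
  -- hyperplane of `e`.
  have hfr : ∀ y ∈ Metric.ball p r, y ∈ frontier T → inner ℝ n (y - p) = 0 := by
    intro y hy hyT
    obtain ⟨e', he', -, hye'⟩ := M.exists_face_of_mem_frontier hT hyT
    by_cases hee : e' = e
    · subst hee
      exact hN.orthogonal y hye' p hp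
    · exact absurd (Set.mem_biUnion (show e' ∈ {e' | e' ∈ M.faces ∧ e' ≠ e} from ⟨he', hee⟩) hye')
        (hball hy)
  -- With `σ = ±1` these are the two open half balls. They are connected and avoid `frontier T`, so
  -- each lies entirely inside or entirely outside `T`; one point `p ∓ s n` on each side decides
  -- which.
  have hpre : ∀ σ : ℝ, IsPreconnected (Metric.ball p r ∩ {y | σ * inner ℝ n (y - p) < 0}) := by
    intro σ
    refine ((convex_ball p r).inter ?_).isPreconnected
    have h1 : IsLinearMap ℝ fun y : Pt d => σ * inner ℝ n y :=
      ⟨fun a b => by simp only [inner_add_right]; ring, fun c a => by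
        simp only [inner_smul_right, smul_eq_mul]; ring⟩
    have h2 : {y : Pt d | σ * inner ℝ n (y - p) < 0} = {y | σ * inner ℝ n y < σ * inner ℝ n p} := by
      ext y
      simp only [Set.mem_ofPred_eq, inner_sub_right, mul_sub, sub_neg]
    rw [h2]
    exact convex_halfSpace_lt h1 _
  obtain ⟨s, ⟨hin, hout⟩, hs⟩ := (hreg.outward.and
    (Ioo_mem_nhdsGT hr : ∀ᶠ t in 𝓝[>] (0 : ℝ), t ∈ Set.Ioo 0 r)).exists
  rw [← hn] at hin hout
  have hsn : ‖s • n‖ < r := by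
    rw [norm_smul, hN.norm_eq_one, mul_one, Real.norm_eq_abs, abs_of_pos hs.1]
    exact hs.2
  have hno : ∀ σ : ℝ, ∀ y ∈ Metric.ball p r ∩ {y | σ * inner ℝ n (y - p) < 0}, y ∉ frontier T := by
    rintro σ y ⟨hy, hy'⟩ hyT
    simp only [Set.mem_ofPred_eq, hfr y hy hyT, mul_zero, lt_irrefl] at hy'
  filter_upwards [Metric.isOpen_ball.mem_nhds (Metric.mem_ball_self hr)] with y hy
  constructor
  · intro hlt
    by_contra hyT
    have hyT' : y ∉ T := fun h => hyT (by
      rw [mem_interior_iff_notMem_frontier h]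
      exact hno 1 y ⟨hy, by simpa using hlt⟩)
    obtain ⟨z, hz, hzT⟩ := inter_frontier_nonempty_of_isPreconnected (T := T) (hpre 1)
      ⟨p - s • n, ⟨by simpa [Metric.mem_ball, dist_eq_norm] using hsn, by
        simpa [inner_smul_right, hN.norm_eq_one] using hs.1⟩, interior_subset hin⟩
      ⟨y, ⟨hy, by simpa using hlt⟩, hyT'⟩
    exact hno 1 z hz hzT
  · intro hlt hyT
    obtain ⟨z, hz, hzT⟩ := inter_frontier_nonempty_of_isPreconnected (T := T) (hpre (-1))
      ⟨y, ⟨hy, by simpa using hlt⟩, hyT⟩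
      ⟨p + s • n, ⟨by simpa [Metric.mem_ball, dist_eq_norm] using hsn, by
        simpa [inner_smul_right, hN.norm_eq_one] using hs.1⟩, hout⟩
    exact hno (-1) z hz hzT

end PolytopalMesh

/-! ### The divergence theorem on an element -/

/-- A function on the line which is constant on a punctured neighbourhood of each point takes the
same value on all these punctured neighbourhoods. -/
lemma exists_forall_eventually_eq {φ : ℝ → ℝ} (h : ∀ t, ∃ c, ∀ᶠ s in 𝓝[≠] t, φ s = c) :
    ∃ c, ∀ t, ∀ᶠ s in 𝓝[≠] t, φ s = c := by
  choose c hc using h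
  have hloc : IsLocallyConstant c := by
    rw [IsLocallyConstant.iff_eventually_eq]
    intro t
    have h1 : ∀ᶠ s in 𝓝[≠] t, c s = c t := by
      -- A punctured neighbourhood of `t` is also a neighbourhood of each of its points `s`, which
      -- forces `c s = c t`. So `c` is locally constant on the connected line.
      have h2 : ∀ᶠ s in 𝓝[≠] t, ∀ᶠ u in 𝓝 s, φ u = c t := by
        have := hc t
        rw [← eventually_eventually_nhdsWithin] at this
        filter_upwards [this, self_mem_nhdsWithin] with s hs hst
        rwa [IsOpen.nhdsWithin_eq isOpen_compl_singleton hst] at hs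
      filter_upwards [h2] with s hs
      obtain ⟨u, hu1, hu2⟩ := ((hs.filter_mono nhdsWithin_le_nhds).and (hc s)).exists
      rw [← hu1, hu2]
    rw [eventually_nhdsWithin_iff] at h1
    filter_upwards [h1] with s hs
    by_cases hst : s = t
    · rw [hst]
    · exact hs hst
  refine ⟨c 0, fun t => ?_⟩
  have : c t = c 0 := hloc.apply_eq_of_preconnectedSpace t 0
  rw [← this]
  exact hc t

/-! ### Shadows of faces along a direction -/

section Shadow

variable {d : ℕ}

/-- The points from which `e` is visible in the direction `v`. -/
def shadow (e : Set (Pt d)) (v : Pt d) : Set (Pt d) := {x | ∃ t : ℝ, 0 < t ∧ x + t • v ∈ e}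

/-- Along a line in direction `v`, membership in the shadow can change only where the line meets
`e`. -/
lemma eventually_shadow_iff {e : Set (Pt d)} (he : IsClosed e) {x v : Pt d} {s₀ : ℝ}
    (h : x + s₀ • v ∉ e) :
    ∀ᶠ s in 𝓝 s₀, (x + s • v ∈ shadow e v ↔ x + s₀ • v ∈ shadow e v) := by
  have hcont : Continuous fun s : ℝ => x + s • v := by fun_prop
  obtain ⟨r, hr, hball⟩ := Metric.isOpen_iff.1 (he.isOpen_compl.preimage hcont) s₀ h
  have hstep : ∀ a b : ℝ, |a - s₀| < r → |b - s₀| < r → x + a • v ∈ shadow e v →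
      x + b • v ∈ shadow e v := by
    rintro a b ha hb ⟨t, ht, hmem⟩
    refine ⟨a + t - b, ?_, ?_⟩
    -- Otherwise the hit at parameter `a + t` would lie between `a` and `b`, in the interval free of
    -- `e`.
    · by_contra hle
      have h1 : a + t ∈ Metric.ball s₀ r := by
        rw [Metric.mem_ball, Real.dist_eq]
        rw [abs_lt] at ha hb ⊢
        constructor <;> linarith
      apply hball h1
      rwa [add_assoc, ← add_smul] at hmem
    · rw [add_assoc, ← add_smul] at hmem ⊢
      simpa using hmem
  filter_upwards [Metric.ball_mem_nhds s₀ hr] with s hs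
  rw [Metric.mem_ball, Real.dist_eq] at hs
  have h0 : |s₀ - s₀| < r := by simpa using hr
  exact ⟨hstep s s₀ hs h0, hstep s₀ s h0 hs⟩

lemma mem_shadow_of_lt {e : Set (Pt d)} {x v : Pt d} {s s₀ : ℝ} (h : x + s₀ • v ∈ e)
    (hs : s < s₀) : x + s • v ∈ shadow e v :=
  ⟨s₀ - s, sub_pos.2 hs, by rw [add_assoc, ← add_smul]; simpa using h⟩

/-- A transversal line meets the hyperplane of `e` only once, so beyond that point nothing of `e`
lies ahead. -/
lemma notMem_shadow_of_gt {T e : Set (Pt d)} {n x v : Pt d} {s s₀ : ℝ}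
    (hN : IsOutwardUnitNormal T e n) (hv : inner ℝ n v ≠ 0) (h : x + s₀ • v ∈ e)
    (hs : s₀ < s) : x + s • v ∉ shadow e v := by
  rintro ⟨t, ht, hmem⟩
  have := hN.orthogonal _ hmem _ h
  have h2 : x + s • v + t • v - (x + s₀ • v) = (s + t - s₀) • v := by module
  rw [h2, inner_smul_right] at this
  rcases mul_eq_zero.1 this with h3 | h3
  · linarith
  · exact hv h3

end Shadow

namespace PolytopalMesh

variable {d : ℕ} {Ω : Set (Pt d)} (M : PolytopalMesh Ω)

open Classical in
/-- The faces of the element `T`. -/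
def facesOf (T : Set (Pt d)) : Finset (Set (Pt d)) := M.faces.filter fun e => e ⊆ frontier T

lemma mem_facesOf {T e : Set (Pt d)} : e ∈ M.facesOf T ↔ e ∈ M.faces ∧ e ⊆ frontier T := by
  simp [facesOf]

open Classical in
/-- Almost every point is in `T` precisely when a ray from it leaves `T` once more often than it
enters. -/
lemma indicator_eq_sum_shadow {T : Set (Pt d)} (hT : T ∈ M.elems) {v : Pt d} (hv : v ≠ 0) :
    ∀ᵐ x : Pt d, T.indicator (1 : Pt d → ℝ) x =
      ∑ e ∈ M.facesOf T, SignType.sign (inner ℝ (M.normal T e) v) *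
        (shadow e v).indicator (1 : Pt d → ℝ) x := by
  filter_upwards [M.ae_line_regular v, measure_eq_zero_iff_ae_notMem.1 (M.volume_frontier_elem hT)]
    with x hx hxT
  set a : Pt d → ℝ := T.indicator 1 with ha
  set b : Set (Pt d) → Pt d → ℝ := fun e => (shadow e v).indicator 1 with hb
  -- `φ` is the difference of both sides along the line through `x`. It is shown to be constant off
  -- isolated points, zero far away, and locally constant at `0`.
  set φ : ℝ → ℝ := fun s => a (x + s • v) -
    ∑ e ∈ M.facesOf T, SignType.sign (inner ℝ (M.normal T e) v) * b e (x + s • v) with hφ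
  have hTc := M.isClosed_elem hT
  have hcont : Continuous fun s : ℝ => x + s • v := by fun_prop
  have hbconst : ∀ e ∈ M.facesOf T, ∀ s₀ : ℝ, x + s₀ • v ∉ e →
      ∀ᶠ s in 𝓝 s₀, b e (x + s • v) = b e (x + s₀ • v) := by
    intro e he s₀ hs₀
    filter_upwards [eventually_shadow_iff (M.isCompact_face (M.mem_facesOf.1 he).1).isClosed hs₀]
      with s hs
    simp only [hb, Set.indicator_apply, hs, Pi.one_apply]
  have hoff : ∀ s₀ : ℝ, x + s₀ • v ∉ frontier T → ∀ᶠ s in 𝓝 s₀, φ s = φ s₀ := by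
    intro s₀ hs₀
    have h1 : ∀ᶠ s in 𝓝 s₀, a (x + s • v) = a (x + s₀ • v) := by
      by_cases hmem : x + s₀ • v ∈ T
      · have hinter := (mem_interior_iff_notMem_frontier hmem).2 hs₀
        filter_upwards [hcont.continuousAt.eventually (isOpen_interior.mem_nhds hinter)] with s hs
        simp [ha, hmem, interior_subset hs]
      · filter_upwards [hcont.continuousAt.eventually (hTc.isOpen_compl.mem_nhds hmem)] with s hs
        rw [ha, Set.indicator_of_notMem hmem, Set.indicator_of_notMem hs]
    have h2 : ∀ᶠ s in 𝓝 s₀, ∀ e ∈ M.facesOf T, b e (x + s • v) = b e (x + s₀ • v) :=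
      (Filter.eventually_all_finset _).2 fun e he =>
        hbconst e he s₀ fun h => hs₀ ((M.mem_facesOf.1 he).2 h)
    filter_upwards [h1, h2] with s h1 h2
    simp only [hφ, h1]
    rw [Finset.sum_congr rfl fun e he => by rw [h2 e he]]
  have hall : ∀ s₀, ∃ c, ∀ᶠ s in 𝓝[≠] s₀, φ s = c := by
    intro s₀
    by_cases hs₀ : x + s₀ • v ∈ frontier T
    swap
    · exact ⟨φ s₀, (hoff s₀ hs₀).filter_mono nhdsWithin_le_nhds⟩
    obtain ⟨e, heM, heT, hmem⟩ := M.exists_face_of_mem_frontier hT hs₀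
    have he : e ∈ M.facesOf T := M.mem_facesOf.2 ⟨heM, heT⟩
    obtain ⟨hne, hreg⟩ := hx T hT e heM heT s₀ hmem
    have hN := M.isOutwardUnitNormal T hT e heM heT
    have h2 : ∀ᶠ s in 𝓝 s₀, ∀ e' ∈ (M.facesOf T).erase e, b e' (x + s • v) = b e' (x + s₀ • v) :=
      (Filter.eventually_all_finset _).2 fun e' he' =>
        hbconst e' (Finset.mem_of_mem_erase he') s₀ fun h =>
          (Finset.ne_of_mem_erase he') (hreg.eq_of_mem e'
            (M.mem_facesOf.1 (Finset.mem_of_mem_erase he')).1 h)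
    have h3 := hcont.continuousAt.eventually (M.eventually_of_isRegularAt hT heM heT hmem hreg)
    -- At a crossing only `a` and the term of `e` change. Where the line leaves `T` both drop from 1
    -- to 0. Where it enters, `a` rises from 0 to 1 while the term of `e` rises from -1 to 0, so the
    -- difference is 1 on both sides.
    refine ⟨(if inner ℝ (M.normal T e) v < 0 then 1 else 0) -
      ∑ e' ∈ (M.facesOf T).erase e, SignType.sign (inner ℝ (M.normal T e') v) *
        b e' (x + s₀ • v), ?_⟩
    filter_upwards [h2.filter_mono nhdsWithin_le_nhds, h3.filter_mono nhdsWithin_le_nhds,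
      self_mem_nhdsWithin] with s h2 h3 hs
    have hsum : ∑ e' ∈ M.facesOf T, SignType.sign (inner ℝ (M.normal T e') v) * b e' (x + s • v) =
        SignType.sign (inner ℝ (M.normal T e) v) * b e (x + s • v) +
        ∑ e' ∈ (M.facesOf T).erase e, SignType.sign (inner ℝ (M.normal T e') v) *
          b e' (x + s₀ • v) := by
      rw [← Finset.add_sum_erase _ _ he]
      congr 1
      exact Finset.sum_congr rfl fun e' he' => by rw [h2 e' he']
    simp only [hφ, hsum]
    have hdiff : x + s • v - (x + s₀ • v) = (s - s₀) • v := by module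
    rw [hdiff, inner_smul_right] at h3
    suffices hsuff : a (x + s • v) - SignType.sign (inner ℝ (M.normal T e) v) * b e (x + s • v) =
        if inner ℝ (M.normal T e) v < 0 then 1 else 0 by
      linarith
    rcases lt_or_gt_of_ne (show s ≠ s₀ from hs) with hlt | hgt
    · have hbe : b e (x + s • v) = 1 := Set.indicator_of_mem (mem_shadow_of_lt hmem hlt) _
      rcases lt_or_gt_of_ne hne with hneg | hpos
      · have hout : x + s • v ∉ T := h3.2 (mul_pos_of_neg_of_neg (by linarith) hneg)
        have hae : a (x + s • v) = 0 := Set.indicator_of_notMem hout _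
        simp [hbe, hae, hneg, sign_neg hneg]
      · have hin : x + s • v ∈ interior T := h3.1 (mul_neg_of_neg_of_pos (by linarith) hpos)
        have hae : a (x + s • v) = 1 := Set.indicator_of_mem (interior_subset hin) _
        simp [hbe, hae, hpos.le, sign_pos hpos]
    · have hbe : b e (x + s • v) = 0 :=
        Set.indicator_of_notMem (notMem_shadow_of_gt hN hne hmem hgt) _
      rcases lt_or_gt_of_ne hne with hneg | hpos
      · have hin : x + s • v ∈ interior T := h3.1 (mul_neg_of_pos_of_neg (by linarith) hneg)
        have hae : a (x + s • v) = 1 := Set.indicator_of_mem (interior_subset hin) _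
        simp [hbe, hae, hneg]
      · have hout : x + s • v ∉ T := h3.2 (mul_pos (by linarith) hpos)
        have hae : a (x + s • v) = 0 := Set.indicator_of_notMem hout _
        simp [hbe, hae, hpos.le]
  obtain ⟨c, hc⟩ := exists_forall_eventually_eq hall
  -- For large `s` the line has left the compact set `T`, and no face of `T` lies ahead.
  have hc0 : c = 0 := by
    obtain ⟨R, hR⟩ := (M.isCompact_elem hT).isBounded.exists_norm_le
    set S := (R + ‖x‖) / ‖v‖ with hS
    have hvpos : 0 < ‖v‖ := norm_pos_iff.2 hv
    have hfar : ∀ s : ℝ, S < s → x + s • v ∉ T := by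
      intro s hs hmem
      have h1 := hR _ hmem
      have h2 : ‖s • v‖ ≤ ‖x + s • v‖ + ‖x‖ := by
        have := norm_sub_le (x + s • v) x
        simpa using this
      rw [hS, div_lt_iff₀ hvpos] at hs
      rw [norm_smul, Real.norm_eq_abs] at h2
      have h3 := mul_le_mul_of_nonneg_right (le_abs_self s) hvpos.le
      linarith
    have hφ0 : ∀ s : ℝ, S < s → φ s = 0 := by
      intro s hs
      have h1 : a (x + s • v) = 0 := Set.indicator_of_notMem (hfar s hs) _
      have h2 : ∀ e ∈ M.facesOf T, b e (x + s • v) = 0 := by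
        intro e he
        refine Set.indicator_of_notMem ?_ _
        rintro ⟨t, ht, hmem⟩
        rw [add_assoc, ← add_smul] at hmem
        exact hfar (s + t) (by linarith) (hTc.frontier_subset ((M.mem_facesOf.1 he).2 hmem))
      simp only [hφ, h1]
      rw [Finset.sum_eq_zero fun e he => by rw [h2 e he, mul_zero], sub_zero]
    obtain ⟨s, hs1, hs2⟩ := ((hc (S + 1)).and (mem_nhdsWithin_of_mem_nhds
      (Ioi_mem_nhds (show S < S + 1 by linarith)) :
      ∀ᶠ s in 𝓝[≠] (S + 1), s ∈ Set.Ioi S)).exists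
    rw [← hs1, hφ0 s hs2]
  -- The constant is known only on a punctured neighbourhood of `0`; as `x` is off `frontier T`, it
  -- is also the value at `0`.
  obtain ⟨s, hs1, hs2⟩ := ((hc 0).and ((hoff 0 (by simpa using hxT)).filter_mono
    nhdsWithin_le_nhds)).exists
  have hfin : φ 0 = 0 := by rw [← hs2, hs1, hc0]
  simp only [hφ, zero_smul, add_zero] at hfin
  linarith

/-- The integral of a directional derivative over the shadow of a face. -/
lemma integral_shadow {T e : Set (Pt d)} (hT : T ∈ M.elems) (he : e ∈ M.faces)
    (heT : e ⊆ frontier T) {v : Pt d} (hv : inner ℝ (M.normal T e) v ≠ 0) {f : Pt d → ℝ}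
    (hf : ContDiff ℝ 1 f) (hfc : HasCompactSupport f) :
    MeasurableSet (shadow e v) ∧ ∫ x in shadow e v, fderiv ℝ f x v =
      |inner ℝ (M.normal T e) v| * ∫ x in e, f x ∂(μHE[d - 1] : Measure (Pt d)) := by
  obtain ⟨x₀, hx₀⟩ := (M.face_polyhedral e he).nonempty
  have hsub := M.face_subset_hyperplane hT he heT hx₀
  have hn := M.norm_normal hT he heT
  have hem := (M.isCompact_face he).measurableSet
  have hN := M.isOutwardUnitNormal T hT e he heT
  set n := M.normal T e with hndef
  set c := inner ℝ n v with hc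
  set L := hyperplaneMap n x₀ with hL
  have hLc : Continuous L := (isometry_hyperplaneMap n x₀).continuous
  have hmp := measurePreserving_slanted hn x₀ hv
  have hemb := measurableEmbedding_slanted x₀ hv
  -- In slanted coordinates the shadow is the half cylinder `t < 0` over `e`.
  have himg : shadow e v =
      (fun p : ℝ × perp n => L p.2 + p.1 • v) '' (Set.Iio 0 ×ˢ (L ⁻¹' e)) := by
    ext x
    constructor
    · rintro ⟨t, ht, hmem⟩
      obtain ⟨w, hw⟩ := hsub hmem
      refine ⟨(-t, w), ⟨by simpa using ht, by simpa [hw] using hmem⟩, ?_⟩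
      simp [hw]
    · rintro ⟨⟨t, w⟩, ⟨ht, hw⟩, rfl⟩
      exact ⟨-t, by simpa using ht, by simpa using hw⟩
  have hmeas : MeasurableSet (shadow e v) := by
    rw [himg]
    exact hemb.measurableSet_image' (measurableSet_Iio.prod (hLc.measurable hem))
  refine ⟨hmeas, ?_⟩
  have hv0 : v ≠ 0 := by
    rintro rfl
    simp [hc] at hv
  set g : Pt d → ℝ := fun x => fderiv ℝ f x v with hg
  have hgc : Continuous g := (hf.continuous_fderiv (by simp)).clm_apply continuous_const
  have hgs : HasCompactSupport g := hfc.fderiv_apply (𝕜 := ℝ) v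
  have hgint : Integrable g := hgc.integrable_of_hasCompactSupport hgs
  have hpre : (fun p : ℝ × perp n => L p.2 + p.1 • v) ⁻¹' (shadow e v) =
      Set.Iio 0 ×ˢ (L ⁻¹' e) := by
    rw [himg, Set.preimage_image_eq _ hemb.injective]
  rw [← hmp.setIntegral_preimage_emb hemb, hpre, ← Measure.prod_restrict, integral_prod_symm]
  swap
  · rw [Measure.prod_restrict]
    exact ((hmp.integrable_comp_emb hemb).2 hgint).integrableOn
  -- This is the fundamental theorem of calculus on a half line; compact support removes the
  -- contribution at `-∞`.
  have hline : ∀ w : perp n, ∫ t, g (L w + t • v) ∂((ENNReal.ofReal |c| • volume : Measure ℝ).restrict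
      (Set.Iio 0)) = |c| * f (L w) := by
    intro w
    rw [Measure.restrict_smul, integral_smul_measure, ENNReal.toReal_ofReal (abs_nonneg c),
      smul_eq_mul, ← integral_Iic_eq_integral_Iio]
    congr 1
    have hd : ∀ t : ℝ, HasDerivAt (fun s : ℝ => f (L w + s • v)) (g (L w + t • v)) t := by
      intro t
      have h1 : HasDerivAt (fun s : ℝ => L w + s • v) v t := by
        simpa using ((hasDerivAt_id t).smul_const v).const_add (L w)
      exact ((hf.differentiable (by simp) (L w + t • v)).hasFDerivAt).comp_hasDerivAt t h1
    have hcl : Topology.IsClosedEmbedding fun t : ℝ => L w + t • v :=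
      (Homeomorph.addLeft (L w)).isClosedEmbedding.comp (isClosedEmbedding_smul_left hv0)
    have hcd : ContDiff ℝ 1 fun s : ℝ => f (L w + s • v) := by fun_prop
    have := HasCompactSupport.integral_Iic_deriv_eq hcd (hfc.comp_isClosedEmbedding hcl) 0
    simpa [funext fun t => (hd t).deriv] using this
  rw [integral_congr_ae (Filter.Eventually.of_forall hline), integral_const_mul,
    setIntegral_hyperplaneMap hn x₀ hem hsub]

/-- The divergence theorem on an element, for a compactly supported function. -/
theorem integral_fderiv_of_hasCompactSupport {T : Set (Pt d)} (hT : T ∈ M.elems) {f : Pt d → ℝ}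
    (hf : ContDiff ℝ 1 f) (hfc : HasCompactSupport f) (v : Pt d) :
    ∫ x in T, fderiv ℝ f x v =
      ∑ e ∈ M.facesOf T, inner ℝ (M.normal T e) v * ∫ x in e, f x ∂(μHE[d - 1] : Measure (Pt d)) := by
  by_cases hv : v = 0
  · simp [hv]
  set g : Pt d → ℝ := fun x => fderiv ℝ f x v with hg
  have hgc : Continuous g := (hf.continuous_fderiv (by simp)).clm_apply continuous_const
  have hgint : Integrable g := hgc.integrable_of_hasCompactSupport (hfc.fderiv_apply (𝕜 := ℝ) v)
  have h1 : ∫ x in T, g x = ∫ x, ∑ e ∈ M.facesOf T,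
      SignType.sign (inner ℝ (M.normal T e) v) * (shadow e v).indicator g x := by
    rw [← integral_indicator (M.isCompact_elem hT).measurableSet]
    refine integral_congr_ae ?_
    filter_upwards [M.indicator_eq_sum_shadow hT hv] with x hx
    have : T.indicator g x = T.indicator (1 : Pt d → ℝ) x * g x := by
      by_cases h : x ∈ T <;> simp [h]
    rw [this, hx, Finset.sum_mul]
    refine Finset.sum_congr rfl fun e _ => ?_
    by_cases h : x ∈ shadow e v <;> simp [h]
  rw [h1, integral_finsetSum]
  · refine Finset.sum_congr rfl fun e he => ?_
    obtain ⟨heM, heT⟩ := M.mem_facesOf.1 he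
    -- A face parallel to `v` has coefficient zero on both sides. For the others the sign and the
    -- factor `|n · v|` of the shadow integral combine to `n · v`.
    by_cases hne : inner ℝ (M.normal T e) v = 0
    · simp [hne]
    · obtain ⟨hm, hi⟩ := M.integral_shadow hT heM heT hne hf hfc
      rw [integral_const_mul, integral_indicator hm, hi, ← mul_assoc, sign_mul_abs]
  · intro e he
    obtain ⟨heM, heT⟩ := M.mem_facesOf.1 he
    by_cases hne : inner ℝ (M.normal T e) v = 0
    · simp [hne]
    · exact (hgint.indicator (M.integral_shadow hT heM heT hne hf hfc).1).const_mul _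

/-- The divergence theorem on an element. -/
theorem integral_fderiv {T : Set (Pt d)} (hT : T ∈ M.elems) {f : Pt d → ℝ}
    (hf : ContDiff ℝ 1 f) (v : Pt d) :
    ∫ x in T, fderiv ℝ f x v =
      ∑ e ∈ M.facesOf T, inner ℝ (M.normal T e) v * ∫ x in e, f x ∂(μHE[d - 1] : Measure (Pt d)) := by
  obtain ⟨R, hR0, hR⟩ := (M.isCompact_elem hT).isBounded.subset_ball_lt 0 0
  -- A cutoff equal to 1 on an open ball containing `T` changes neither `f` nor its derivative on
  -- `T`.
  let χ : ContDiffBump (0 : Pt d) := ⟨R, R + 1, hR0, by linarith⟩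
  have hχ : ContDiff ℝ 1 χ := χ.contDiff
  have hone : ∀ x ∈ Metric.ball (0 : Pt d) R, χ x = 1 := fun x hx =>
    χ.one_of_mem_closedBall (Metric.ball_subset_closedBall hx)
  have key := M.integral_fderiv_of_hasCompactSupport hT (f := fun x => χ x * f x) (hχ.mul hf)
    (χ.hasCompactSupport.mul_right) v
  have h1 : ∫ x in T, fderiv ℝ (fun x => χ x * f x) x v = ∫ x in T, fderiv ℝ f x v := by
    refine setIntegral_congr_fun (M.isCompact_elem hT).measurableSet fun x hx => ?_
    have : (fun x => χ x * f x) =ᶠ[𝓝 x] f := by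
      filter_upwards [Metric.isOpen_ball.mem_nhds (hR hx)] with y hy
      rw [hone y hy, one_mul]
    simp only [this.fderiv_eq]
  rw [← h1, key]
  refine Finset.sum_congr rfl fun e he => ?_
  obtain ⟨heM, heT⟩ := M.mem_facesOf.1 he
  congr 1
  refine setIntegral_congr_fun (M.isCompact_face heM).measurableSet fun x hx => ?_
  rw [hone x (hR ((M.isClosed_elem hT).frontier_subset (heT hx))), one_mul]

end PolytopalMesh

namespace PolytopalMesh

variable {d : ℕ} {Ω : Set (Pt d)} (M : PolytopalMesh Ω)

/-! ### Green's formula for polynomials -/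

lemma boundaryIntegral_eq_sum {T : Set (Pt d)} (F : Set (Pt d) → Pt d → ℝ) :
    M.boundaryIntegral T (fun e x => F e.1 x) =
      ∑ e ∈ M.facesOf T, ∫ x in e, F e x ∂(μHE[d - 1] : Measure (Pt d)) := by
  classical
  rw [boundaryIntegral, facesOf, Finset.sum_filter, Finset.sum_filter,
    ← Finset.sum_coe_sort M.faces fun e =>
      if e ⊆ frontier T then ∫ x in e, F e x ∂(μHE[d - 1] : Measure (Pt d)) else 0]
  refine Finset.sum_congr rfl fun e _ => ?_
  by_cases h : e.1 ⊆ frontier T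
  · simp only [h, if_true]
    exact M.integral_faceMeasure e.2 _
  · simp only [h, if_false]

lemma integrableOn_elem {T : Set (Pt d)} (hT : T ∈ M.elems) {f : Pt d → ℝ} (hf : Continuous f) :
    IntegrableOn f T :=
  hf.continuousOn.integrableOn_compact (M.isCompact_elem hT)

lemma integrableOn_face {e : Set (Pt d)} (he : e ∈ M.faces) {f : Pt d → ℝ} (hf : Continuous f) :
    IntegrableOn f e (μHE[d - 1] : Measure (Pt d)) :=
  hf.continuousOn.integrableOn_of_subset_isCompact (M.isCompact_face he)
    (M.isCompact_face he).measurableSet subset_rfl (M.measure_face_lt_top he).ne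

lemma integral_pderiv {T : Set (Pt d)} (hT : T ∈ M.elems) (q : Poly d) (i : Fin d) :
    ∫ x in T, evalAt (MvPolynomial.pderiv i q) x =
      ∑ e ∈ M.facesOf T, ∫ x in e, evalAt q x * M.normal T e i ∂(μHE[d - 1] : Measure (Pt d)) := by
  have h := M.integral_fderiv hT (contDiff_evalAt q) (EuclideanSpace.single i 1)
  simp only [fderiv_evalAt, ← evalAt_dirDerivation, dirDerivation_single] at h
  rw [h]
  refine Finset.sum_congr rfl fun e _ => ?_
  rw [integral_mul_const, mul_comm]
  simp [EuclideanSpace.inner_single_right]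

lemma continuous_dirDeriv (p : Poly d) (n : Pt d) : Continuous (dirDeriv p n) := by
  have : dirDeriv p n = evalAt (dirDerivation n p) := by
    ext x; rw [evalAt_dirDerivation]
  rw [this]
  exact continuous_evalAt _

/-- The divergence theorem is applied to the components `p ∂ᵢφ - φ ∂ᵢp`, where the products of first
derivatives cancel. The left side is the defining functional of the weak Laplacian for the triple of
`p`, its trace and its normal derivative. -/
theorem green {T : Set (Pt d)} (hT : T ∈ M.elems) (p φ : Poly d) :
    (∫ x in T, evalAt p x * evalAt (lap φ) x)
      - M.boundaryIntegral T (fun e x => evalAt p x * dirDeriv φ (M.normal T e.1) x)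
      + M.boundaryIntegral T (fun e x => dirDeriv p (M.normal T e.1) x * evalAt φ x) =
    ∫ x in T, evalAt (lap p) x * evalAt φ x := by
  have hi : ∀ i : Fin d, (∫ x in T, evalAt p x * evalAt (MvPolynomial.pderiv i (MvPolynomial.pderiv i φ)) x)
      - (∫ x in T, evalAt (MvPolynomial.pderiv i (MvPolynomial.pderiv i p)) x * evalAt φ x) =
      ∑ e ∈ M.facesOf T, ∫ x in e, (evalAt p x * evalAt (MvPolynomial.pderiv i φ) x -
        evalAt (MvPolynomial.pderiv i p) x * evalAt φ x) * M.normal T e i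
          ∂(μHE[d - 1] : Measure (Pt d)) := by
    intro i
    have h := M.integral_pderiv hT (p * MvPolynomial.pderiv i φ - MvPolynomial.pderiv i p * φ) i
    simp only [evalAt_sub, evalAt_mul] at h
    rw [← h, ← integral_sub (M.integrableOn_elem hT (by fun_prop))
      (M.integrableOn_elem hT (by fun_prop))]
    congr 1
    ext x
    simp only [map_sub, Derivation.leibniz, smul_eq_mul, evalAt_sub, evalAt_add, evalAt_mul]
    ring
  have hsum := Finset.sum_congr (rfl : (Finset.univ : Finset (Fin d)) = Finset.univ)
    fun i _ => hi i
  rw [Finset.sum_sub_distrib, ← integral_finsetSum _ fun i _ => M.integrableOn_elem hT (by fun_prop),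
    ← integral_finsetSum _ fun i _ => M.integrableOn_elem hT (by fun_prop), Finset.sum_comm] at hsum
  rw [M.boundaryIntegral_eq_sum (fun e x => evalAt p x * dirDeriv φ (M.normal T e) x),
    M.boundaryIntegral_eq_sum (fun e x => dirDeriv p (M.normal T e) x * evalAt φ x)]
  have hb : ∑ e ∈ M.facesOf T, ∑ i, ∫ x in e, (evalAt p x * evalAt (MvPolynomial.pderiv i φ) x -
        evalAt (MvPolynomial.pderiv i p) x * evalAt φ x) * M.normal T e i
          ∂(μHE[d - 1] : Measure (Pt d)) =
      ∑ e ∈ M.facesOf T, (∫ x in e, evalAt p x * dirDeriv φ (M.normal T e) x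
          ∂(μHE[d - 1] : Measure (Pt d))) -
        ∑ e ∈ M.facesOf T, ∫ x in e, dirDeriv p (M.normal T e) x * evalAt φ x
          ∂(μHE[d - 1] : Measure (Pt d)) := by
    rw [← Finset.sum_sub_distrib]
    refine Finset.sum_congr rfl fun e he => ?_
    have heM := (M.mem_facesOf.1 he).1
    have h1 : IntegrableOn (fun x => evalAt p x * dirDeriv φ (M.normal T e) x) e
        (μHE[d - 1] : Measure (Pt d)) :=
      M.integrableOn_face heM ((continuous_evalAt p).mul (continuous_dirDeriv _ _))
    have h2 : IntegrableOn (fun x => dirDeriv p (M.normal T e) x * evalAt φ x) e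
        (μHE[d - 1] : Measure (Pt d)) :=
      M.integrableOn_face heM ((continuous_dirDeriv _ _).mul (continuous_evalAt φ))
    rw [← integral_sub h1 h2, ← integral_finsetSum _ fun i _ => M.integrableOn_face heM (by fun_prop)]
    congr 1
    ext x
    simp only [dirDeriv, Finset.mul_sum, Finset.sum_mul, ← Finset.sum_sub_distrib]
    exact Finset.sum_congr rfl fun i _ => by ring
  rw [hb] at hsum
  have h1 : ∀ x, ∑ i, evalAt p x * evalAt (MvPolynomial.pderiv i (MvPolynomial.pderiv i φ)) x =
      evalAt p x * evalAt (lap φ) x := fun x => by rw [lap, evalAt_sum, Finset.mul_sum]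
  have h2 : ∀ x, ∑ i, evalAt (MvPolynomial.pderiv i (MvPolynomial.pderiv i p)) x * evalAt φ x =
      evalAt (lap p) x * evalAt φ x := fun x => by rw [lap, evalAt_sum, Finset.sum_mul]
  simp only [h1, h2] at hsum
  linarith

/-! ### Polynomials on elements and faces -/

lemma eq_zero_of_eqOn_interior {T : Set (Pt d)} (hT : T ∈ M.elems) {p : Poly d}
    (h : ∀ x ∈ interior T, evalAt p x = 0) : p = 0 := by
  obtain ⟨x₀, hx₀⟩ := (M.elem_connected T hT).nonempty
  have := (analyticOnNhd_evalAt p).eqOn_zero_of_preconnected_of_eventuallyEq_zero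
    isPreconnected_univ (Set.mem_univ x₀)
    (by filter_upwards [isOpen_interior.mem_nhds hx₀] with x hx using h x hx)
  exact eq_zero_of_evalAt_eq_zero fun x => this (Set.mem_univ x)

lemma eq_zero_of_integral_sq {T : Set (Pt d)} (hT : T ∈ M.elems) {p : Poly d}
    (h : ∫ x in T, evalAt p x * evalAt p x = 0) : p = 0 := by
  have hc : Continuous fun x => evalAt p x * evalAt p x := by fun_prop
  rw [integral_eq_zero_iff_of_nonneg (fun x => mul_self_nonneg _) (M.integrableOn_elem hT hc)] at h
  have h2 : (fun x => evalAt p x * evalAt p x) =ᵐ[volume.restrict (interior T)] 0 :=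
    ae_restrict_of_ae_restrict_of_subset interior_subset h
  have h3 := Measure.eqOn_open_of_ae_eq h2 isOpen_interior hc.continuousOn continuousOn_const
  exact M.eq_zero_of_eqOn_interior hT fun x hx => mul_self_eq_zero.1 (h3 hx)

lemma exists_mem_interior_preimage_face {T e : Set (Pt d)} (hT : T ∈ M.elems) (he : e ∈ M.faces)
    (heT : e ⊆ frontier T) {x₀ : Pt d} (hx₀ : x₀ ∈ e) :
    ∃ w₀, w₀ ∈ interior (hyperplaneMap (M.normal T e) x₀ ⁻¹' e) := by
  have h1 := (M.face_polyhedral e he).preimage_subset_closure_interior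
    (hyperplaneMap (M.normal T e) x₀) (isometry_hyperplaneMap _ _).injective
    (finrank_perp (M.norm_normal hT he heT)) (M.face_subset_hyperplane hT he heT hx₀)
  have h2 : (0 : perp (M.normal T e)) ∈ hyperplaneMap (M.normal T e) x₀ ⁻¹' e := by
    simpa [hyperplaneMap_apply] using hx₀
  exact closure_nonempty_iff.1 ⟨_, h1 h2⟩

/-- A polynomial which vanishes on a face vanishes on its hyperplane. -/
lemma evalAt_eq_zero_on_hyperplane {T e : Set (Pt d)} (hT : T ∈ M.elems) (he : e ∈ M.faces)
    (heT : e ⊆ frontier T) {x₀ : Pt d} (hx₀ : x₀ ∈ e) {p : Poly d}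
    (hp : ∀ x ∈ e, evalAt p x = 0) {w : Pt d} (hw : inner ℝ (M.normal T e) w = 0) :
    evalAt p (x₀ + w) = 0 := by
  obtain ⟨w₀, hw₀⟩ := M.exists_mem_interior_preimage_face hT he heT hx₀
  have h : ∀ᶠ w : perp (M.normal T e) in 𝓝 w₀, evalAt p (x₀ + w) = 0 := by
    filter_upwards [mem_interior_iff_mem_nhds.1 hw₀] with w hw
    rw [← hyperplaneMap_apply]
    exact hp _ hw
  exact evalAt_eq_zero_of_eventually h
    ⟨w, Submodule.mem_orthogonal_singleton_iff_inner_right.2 hw⟩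

/-- A harmonic polynomial with vanishing Cauchy data on a face is zero. -/
lemma eq_zero_of_cauchy_on_face {T e : Set (Pt d)} (hT : T ∈ M.elems) (he : e ∈ M.faces)
    (heT : e ⊆ frontier T) {p : Poly d} (hlap : lap p = 0) (h0 : ∀ x ∈ e, evalAt p x = 0)
    (h1 : ∀ x ∈ e, dirDeriv p (M.normal T e) x = 0) : p = 0 := by
  obtain ⟨x₀, hx₀⟩ := (M.face_polyhedral e he).nonempty
  refine eq_zero_of_lap_eq_zero_of_cauchy (x₀ := x₀) (M.norm_normal hT he heT) hlap
    (fun w hw => M.evalAt_eq_zero_on_hyperplane hT he heT hx₀ h0 hw)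
    (fun w hw => M.evalAt_eq_zero_on_hyperplane hT he heT hx₀ (fun x hx => ?_) hw)
  rw [evalAt_dirDerivation, h1 x hx]

/-! ### Adjacent elements -/

/-- The face has relative interior in its hyperplane, so both unit normals span the same line. If
they were equal, points just behind the face would be interior to both elements. -/
lemma normal_eq_neg {T T' e : Set (Pt d)} (hT : T ∈ M.elems) (hT' : T' ∈ M.elems) (hne : T ≠ T')
    (he : e ∈ M.faces) (heT : e ⊆ frontier T) (heT' : e ⊆ frontier T') :
    M.normal T' e = -M.normal T e := by
  obtain ⟨x₀, hx₀⟩ := (M.face_polyhedral e he).nonempty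
  have hN := M.isOutwardUnitNormal T hT e he heT
  have hN' := M.isOutwardUnitNormal T' hT' e he heT'
  obtain ⟨w₀, hw₀⟩ := M.exists_mem_interior_preimage_face hT he heT hx₀
  have horth : M.normal T' e ∈ (perp (M.normal T e))ᗮ := by
    rw [Submodule.mem_orthogonal]
    intro w hw
    have hcont : Continuous fun t : ℝ => w₀ + t • (⟨w, hw⟩ : perp (M.normal T e)) := by fun_prop
    have h1 : ∀ᶠ t in 𝓝[≠] (0 : ℝ), w₀ + t • (⟨w, hw⟩ : perp (M.normal T e)) ∈
        hyperplaneMap (M.normal T e) x₀ ⁻¹' e := by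
      refine Filter.Eventually.filter_mono nhdsWithin_le_nhds (hcont.continuousAt ?_)
      simpa only [zero_smul, add_zero] using mem_interior_iff_mem_nhds.1 hw₀
    obtain ⟨t, ht, ht0⟩ := (h1.and self_mem_nhdsWithin).exists
    have hw₀' : w₀ ∈ hyperplaneMap (M.normal T e) x₀ ⁻¹' e := interior_subset hw₀
    have h2 := hN'.orthogonal _ ht _ hw₀'
    have h3 : hyperplaneMap (M.normal T e) x₀ (w₀ + t • (⟨w, hw⟩ : perp (M.normal T e))) -
        hyperplaneMap (M.normal T e) x₀ w₀ = t • w := by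
      simp only [hyperplaneMap_apply, Submodule.coe_add, Submodule.coe_smul]
      abel
    rw [h3, inner_smul_right] at h2
    rw [real_inner_comm]
    exact (mul_eq_zero.1 h2).resolve_left ht0
  rw [Submodule.orthogonal_orthogonal, Submodule.mem_span_singleton] at horth
  obtain ⟨c, hc⟩ := horth
  have habs : |c| = 1 := by
    have := hN'.norm_eq_one
    rwa [← hc, norm_smul, hN.norm_eq_one, mul_one, Real.norm_eq_abs] at this
  rcases eq_or_eq_neg_of_abs_eq habs with rfl | rfl
  · exfalso
    rw [one_smul] at hc
    have hpos : (μHE[d - 1] : Measure (Pt d)) e ≠ 0 := by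
      have := M.measure_face_inter_pos he isOpen_univ (by simpa using ⟨x₀, hx₀⟩)
      simpa using this.ne'
    have : (ae ((μHE[d - 1] : Measure (Pt d)).restrict e)).NeBot := by
      rw [ae_neBot]
      simpa using hpos
    obtain ⟨x, hx, hx'⟩ := (hN.outward.and hN'.outward).exists
    obtain ⟨t, ht, ht'⟩ := (hx.and hx').exists
    rw [← hc] at ht'
    exact Set.disjoint_left.1 (M.elem_disjoint T hT T' hT' hne) ht.1 ht'.1
  · rw [← hc, neg_smul, one_smul]

lemma exists_neighbour {T e : Set (Pt d)} (he : e ∈ M.faces) (hb : ¬ e ⊆ frontier Ω) :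
    ∃ T' ∈ M.elems, e ⊆ frontier T' ∧ T' ≠ T := by
  have h := M.interior_face e he hb
  obtain ⟨T₁, T₂, hne, hset⟩ := Set.ncard_eq_two.1 h
  have h1 : T₁ ∈ {T | T ∈ M.elems ∧ e ⊆ frontier T} := by simp [hset]
  have h2 : T₂ ∈ {T | T ∈ M.elems ∧ e ⊆ frontier T} := by simp [hset]
  by_cases h3 : T₁ = T
  · exact ⟨T₂, h2.1, h2.2, fun h => hne (h3.trans h.symm)⟩
  · exact ⟨T₁, h1.1, h1.2, h3⟩

lemma interior_inter_elem {T T' : Set (Pt d)} (hT : T ∈ M.elems) (hT' : T' ∈ M.elems)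
    (hne : T ≠ T') : Disjoint (interior T) T' := by
  have h := (M.elem_disjoint T hT T' hT' hne).closure_right isOpen_interior
  exact h.mono_right (M.elem_polyhedral T' hT').subset_closure_interior

/-- Near a regular point of an interior face, the two elements which share the face fill up the
space. -/
lemma mem_interior_union {T T' e : Set (Pt d)} (hT : T ∈ M.elems) (hT' : T' ∈ M.elems) (hne : T ≠ T')
    (he : e ∈ M.faces) (heT : e ⊆ frontier T) (heT' : e ⊆ frontier T') {p : Pt d} (hp : p ∈ e)
    (hreg : M.IsRegularAt T e p) (hreg' : M.IsRegularAt T' e p) : p ∈ interior (T ∪ T') := by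
  have h1 := (M.eventually_of_isRegularAt hT he heT hp hreg).and
    (M.eventually_of_isRegularAt hT' he heT' hp hreg')
  rw [M.normal_eq_neg hT hT' hne he heT heT'] at h1
  set n := M.normal T e with hn
  have hn1 : ‖n‖ = 1 := M.norm_normal hT he heT
  rw [mem_interior_iff_mem_nhds]
  rw [← eventually_eventually_nhds] at h1
  filter_upwards [h1] with y hy
  obtain ⟨h2, h3⟩ := hy.self_of_nhds
  rcases lt_trichotomy (inner ℝ n (y - p)) 0 with hlt | heq | hgt
  · exact Or.inl (interior_subset (h2.1 hlt))
  -- A point of the hyperplane itself is a limit of points on the side of `T`, which is closed.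
  · left
    have htend : Filter.Tendsto (fun s : ℝ => y - s • n) (𝓝[>] 0) (𝓝 y) := by
      have : Continuous fun s : ℝ => y - s • n := by fun_prop
      have := this.tendsto 0
      simp only [zero_smul, sub_zero] at this
      exact this.mono_left nhdsWithin_le_nhds
    refine (M.isClosed_elem hT).mem_of_tendsto htend ?_
    filter_upwards [htend.eventually hy, self_mem_nhdsWithin] with s hs hs0
    refine interior_subset (hs.1.1 ?_)
    have : y - s • n - p = (y - p) - s • n := by abel
    rw [this, inner_sub_right, heq, inner_smul_right, real_inner_self_eq_norm_sq, hn1]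
    simpa using hs0
  · exact Or.inr (interior_subset (h3.1 (by rw [inner_neg_left]; linarith)))

lemma elem_subset_closure_domain {T : Set (Pt d)} (hT : T ∈ M.elems) : T ⊆ closure Ω := by
  rw [← M.iUnion_elems]
  exact Set.subset_biUnion_of_mem (u := fun T => T) hT

lemma exists_elem_of_mem {x : Pt d} (hx : x ∈ Ω) : ∃ T ∈ M.elems, x ∈ T := by
  have := subset_closure hx
  rw [← M.iUnion_elems, Set.mem_iUnion₂] at this
  obtain ⟨T, hT, hxT⟩ := this
  exact ⟨T, hT, hxT⟩

/-- The elements of the mesh are connected to each other through interior faces. -/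
theorem forall_elems_of_closed_under_neighbours (hΩo : IsOpen Ω) (hΩc : IsConnected Ω)
    (A : Set (Set (Pt d)))
    (hA : ∀ e ∈ M.faces, ¬ e ⊆ frontier Ω → ∀ T ∈ M.elems, ∀ T' ∈ M.elems, T ≠ T' →
      e ⊆ frontier T → e ⊆ frontier T' → T ∈ A → T' ∈ A)
    (hne : ∃ T ∈ M.elems, T ∈ A) : ∀ T ∈ M.elems, T ∈ A := by
  by_contra! hcon
  set F : Set (Set (Pt d)) → Set (Pt d) := fun B => ⋃ T ∈ {T | T ∈ M.elems ∧ T ∈ B}, T with hF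
  have hFc : ∀ B, IsClosed (F B) := fun B =>
    (M.elems.finite_toSet.subset fun T hT => hT.1).isClosed_biUnion fun T hT => M.isClosed_elem hT.1
  have hmemF : ∀ {B : Set (Set (Pt d))} {T : Set (Pt d)}, T ∈ M.elems → T ∈ B → T ⊆ F B :=
    fun hT hTB => Set.subset_biUnion_of_mem (u := fun T => T) (show _ ∈ {T | _} from ⟨hT, hTB⟩)
  have hmeet : ∀ B, (∃ T ∈ M.elems, T ∈ B) → (Ω ∩ F B).Nonempty := by
    rintro B ⟨T, hT, hTB⟩
    obtain ⟨x, hx⟩ := (M.elem_connected T hT).nonempty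
    obtain ⟨y, hy, hyΩ⟩ := mem_closure_iff.1
      (M.elem_subset_closure_domain hT (interior_subset hx)) _ isOpen_interior hx
    exact ⟨y, hyΩ, hmemF hT hTB (interior_subset hy)⟩
  have hcover : Ω ⊆ F A ∪ F Aᶜ := by
    intro x hx
    obtain ⟨T, hT, hxT⟩ := M.exists_elem_of_mem hx
    by_cases hTA : T ∈ A
    · exact Or.inl (hmemF hT hTA hxT)
    · exact Or.inr (hmemF hT hTA hxT)
  -- Two closed sets that cover the connected `Ω` and both meet it have a common point in `Ω`. A
  -- contradiction is sought in a ball around it.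
  obtain ⟨p, hpΩ, hpA, hpB⟩ := isPreconnected_closed_iff.1 hΩc.isPreconnected _ _ (hFc A) (hFc Aᶜ)
    hcover (hmeet A hne) (hmeet Aᶜ hcon)
  obtain ⟨r, hr, hball⟩ := Metric.isOpen_iff.1 hΩo p hpΩ
  have hpick : ∀ B, p ∈ F B → ∃ T ∈ M.elems, T ∈ B ∧ (Metric.ball p r ∩ interior T).Nonempty := by
    intro B hpB
    rw [hF, Set.mem_iUnion₂] at hpB
    obtain ⟨T, hT, hpT⟩ := hpB
    exact ⟨T, hT.1, hT.2, mem_closure_iff.1 ((M.elem_polyhedral T hT.1).subset_closure_interior hpT)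
      _ Metric.isOpen_ball (Metric.mem_ball_self hr)⟩
  obtain ⟨T, hT, hTA, x, hxb, hxT⟩ := hpick A hpA
  obtain ⟨T', hT', hTB, y, hyb, hyT⟩ := hpick Aᶜ hpB
  set v := y - x with hv
  have hopen : IsOpen ((Metric.ball p r ∩ interior T) ∩
      (fun z => z + v) ⁻¹' (Metric.ball p r ∩ interior T')) :=
    (Metric.isOpen_ball.inter isOpen_interior).inter
      ((Metric.isOpen_ball.inter isOpen_interior).preimage (by fun_prop))
  -- The starting point is perturbed so that the segment from `T` to `T'` crosses faces only at
  -- regular points.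
  obtain ⟨z, ⟨⟨hzb, hzT⟩, hzvb, hzvT⟩, hz⟩ :=
    (Measure.dense_of_ae (M.ae_line_regular v)).inter_open_nonempty _ hopen
      ⟨x, ⟨hxb, hxT⟩, by simpa [hv] using ⟨hyb, hyT⟩⟩
  -- Where the segment crosses a face, that face is interior to the domain, and its two elements
  -- fill a neighbourhood and belong to the same class.
  have hseg : ∀ t ∈ Set.Icc (0 : ℝ) 1, z + t • v ∈ interior (F A) ∪ interior (F Aᶜ) := by
    intro t ht
    have hb : z + t • v ∈ Metric.ball p r := by
      have h1 : z + t • v = (1 - t) • z + t • (z + v) := by module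
      rw [h1]
      exact convex_ball p r hzb hzvb (by linarith [ht.2]) ht.1 (by ring)
    obtain ⟨S, hS, hmemS⟩ := M.exists_elem_of_mem (hball hb)
    by_cases hfr : z + t • v ∈ frontier S
    swap
    · have hinter := (mem_interior_iff_notMem_frontier hmemS).2 hfr
      by_cases hSA : S ∈ A
      · exact Or.inl (interior_mono (hmemF hS hSA) hinter)
      · exact Or.inr (interior_mono (hmemF hS hSA) hinter)
    obtain ⟨e, he, heS, hmeme⟩ := M.exists_face_of_mem_frontier hS hfr
    have hnb : ¬ e ⊆ frontier Ω := fun h => by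
      have := h hmeme
      rw [hΩo.frontier_eq] at this
      exact this.2 (hball hb)
    obtain ⟨S', hS', heS', hne'⟩ := M.exists_neighbour (T := S) he hnb
    have hinter := M.mem_interior_union hS hS' hne'.symm he heS heS' hmeme
      (hz S hS e he heS t hmeme).2 (hz S' hS' e he heS' t hmeme).2
    by_cases hSA : S ∈ A
    · have hSA' := hA e he hnb S hS S' hS' hne'.symm heS heS' hSA
      exact Or.inl (interior_mono (Set.union_subset (hmemF hS hSA) (hmemF hS' hSA')) hinter)
    · have hSA' : S' ∈ Aᶜ := fun h => hSA (hA e he hnb S' hS' S hS hne' heS' heS h)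
      exact Or.inr (interior_mono (Set.union_subset (hmemF hS hSA) (hmemF hS' hSA')) hinter)
  have hpre : IsPreconnected ((fun t : ℝ => z + t • v) '' Set.Icc 0 1) :=
    isPreconnected_Icc.image _ (by fun_prop)
  obtain ⟨q, -, hq1, hq2⟩ := hpre _ _ isOpen_interior isOpen_interior
    (by rintro _ ⟨t, ht, rfl⟩; exact hseg t ht)
    ⟨z, ⟨0, by simp, by simp⟩, interior_mono (hmemF hT hTA) hzT⟩
    ⟨z + v, ⟨1, by simp, by simp⟩, interior_mono (hmemF hT' hTB) hzvT⟩
  -- By connectedness of the segment the two open sets overlap, with positive volume; but elements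
  -- of different classes meet only in faces, which are null.
  have hpos : 0 < volume (interior (F A) ∩ interior (F Aᶜ)) :=
    (isOpen_interior.inter isOpen_interior).measure_pos _ ⟨q, hq1, hq2⟩
  refine hpos.ne' (measure_mono_null ?_ M.volume_iUnion_faces)
  rintro q' ⟨hqA, hqB⟩
  have hqA' := interior_subset hqA
  have hqB' := interior_subset hqB
  rw [hF, Set.mem_iUnion₂] at hqA' hqB'
  obtain ⟨S, hS, hqS⟩ := hqA'
  obtain ⟨S', hS', hqS'⟩ := hqB'
  have hSS : S ≠ S' := by
    rintro rfl
    exact hS'.2 hS.2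
  have hfr : q' ∈ frontier S := by
    rw [mem_frontier_iff_notMem_interior hqS]
    exact fun h => Set.disjoint_left.1 (M.interior_inter_elem hS.1 hS'.1 hSS) h hqS'
  obtain ⟨e, he, -, hqe⟩ := M.exists_face_of_mem_frontier hS.1 hfr
  exact Set.mem_biUnion he hqe

/-- Unique continuation for piecewise harmonic polynomials with matching Cauchy data on the
interior faces. -/
theorem eq_zero_of_piecewise_harmonic (hΩo : IsOpen Ω) (hΩc : IsConnected Ω) (w : M.PiecewisePoly)
    (hlap : ∀ T, lap (w T) = 0)
    (hjump : ∀ e : M.faces, ¬ e.1 ⊆ frontier Ω → ∀ T T' : M.elems, T ≠ T' → e.1 ⊆ frontier T.1 →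
      e.1 ⊆ frontier T'.1 → ∀ x ∈ e.1, evalAt (w T) x = evalAt (w T') x ∧
        dirDeriv (w T) (M.normal T.1 e.1) x = dirDeriv (w T') (M.normal T.1 e.1) x)
    {e₀ : Set (Pt d)} (he₀ : e₀ ∈ M.faces) {T₀ : M.elems} (heT₀ : e₀ ⊆ frontier T₀.1)
    (h0 : ∀ x ∈ e₀, evalAt (w T₀) x = 0)
    (h1 : ∀ x ∈ e₀, dirDeriv (w T₀) (M.normal T₀.1 e₀) x = 0) : w = 0 := by
  have key := M.forall_elems_of_closed_under_neighbours hΩo hΩc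
    {T | ∃ h : T ∈ M.elems, w ⟨T, h⟩ = 0} ?_
    ⟨T₀.1, T₀.2, T₀.2, M.eq_zero_of_cauchy_on_face T₀.2 he₀ heT₀ (hlap _) h0 h1⟩
  · ext1 T
    obtain ⟨_, h⟩ := key T.1 T.2
    exact h
  · rintro e he hb T hT T' hT' hne heT heT' ⟨_, hwT⟩
    refine ⟨hT', ?_⟩
    have hj := hjump ⟨e, he⟩ hb ⟨T, hT⟩ ⟨T', hT'⟩ (by simpa using hne) heT heT'
    refine M.eq_zero_of_cauchy_on_face hT he heT (hlap _) (fun x hx => ?_) (fun x hx => ?_)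
    · rw [← (hj x hx).1, hwT, evalAt_zero]
    · rw [← (hj x hx).2, hwT]
      simp [dirDeriv]

end PolytopalMesh

/-! ### Bilinear integral pairings -/

/-- The pairing `(f, g) ↦ ∫ f g dμ` of continuous functions. -/
def intMul {X : Type*} [TopologicalSpace X] [MeasurableSpace X] (μ : Measure X)
    (hμ : ∀ f : C(X, ℝ), Integrable f μ) : C(X, ℝ) →ₗ[ℝ] C(X, ℝ) →ₗ[ℝ] ℝ :=
  LinearMap.mk₂ ℝ (fun f g => ∫ x, f x * g x ∂μ)
    (fun f f' g => by
      simp only [ContinuousMap.add_apply, add_mul]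
      exact integral_add (hμ (f * g)) (hμ (f' * g)))
    (fun c f g => by
      simp only [ContinuousMap.smul_apply, smul_eq_mul, mul_assoc]
      exact integral_const_mul _ _)
    (fun f g g' => by
      simp only [ContinuousMap.add_apply, mul_add]
      exact integral_add (hμ (f * g)) (hμ (f * g')))
    (fun c f g => by
      simp only [ContinuousMap.smul_apply, smul_eq_mul, mul_left_comm]
      exact integral_const_mul _ _)

lemma intMul_self_nonneg {X : Type*} [TopologicalSpace X] [MeasurableSpace X] (μ : Measure X)
    (hμ : ∀ f : C(X, ℝ), Integrable f μ) (f : C(X, ℝ)) : 0 ≤ intMul μ hμ f f :=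
  integral_nonneg fun _ => mul_self_nonneg _

/-- An injective linear map into the dual is bijective, by equality of dimensions. The `L²`
projections, the weak Laplacian and the scheme itself are all obtained in this way. -/
lemma existsUnique_of_injective {V : Type*} [AddCommGroup V] [Module ℝ V] [FiniteDimensional ℝ V]
    (B : V →ₗ[ℝ] V →ₗ[ℝ] ℝ) (hB : ∀ v, (∀ w, B v w = 0) → v = 0) (l : V →ₗ[ℝ] ℝ) :
    ∃! v, ∀ w, B v w = l w := by
  have hinj : Function.Injective (B : V →ₗ[ℝ] Module.Dual ℝ V) := by
    rw [← LinearMap.ker_eq_bot, LinearMap.ker_eq_bot']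
    intro v hv
    exact hB v fun w => by rw [hv]; rfl
  have hsurj := (LinearMap.injective_iff_surjective_of_finrank_eq_finrank
    (Subspace.dual_finrank_eq (K := ℝ) (V := V)).symm).1 hinj
  obtain ⟨v, hv⟩ := hsurj l
  refine ⟨v, fun w => by rw [hv], fun v' hv' => hinj ?_⟩
  rw [hv]
  exact LinearMap.ext hv'

/-! ### Polynomials and their restrictions as linear spaces -/

section Poly

variable {d : ℕ}

/-- A polynomial as a continuous function. -/
def polyC : Poly d →ₗ[ℝ] C(Pt d, ℝ) where
  toFun p := ⟨evalAt p, continuous_evalAt p⟩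
  map_add' p q := by ext x; simp
  map_smul' c p := by ext x; simp

/-- The restriction of a polynomial to a set. -/
def polyE (e : Set (Pt d)) : Poly d →ₗ[ℝ] C(e, ℝ) where
  toFun p := ⟨fun x => evalAt p x, by fun_prop⟩
  map_add' p q := by ext x; simp
  map_smul' c p := by ext x; simp

/-- The Laplacian as a linear map. -/
def lapL : Poly d →ₗ[ℝ] Poly d where
  toFun := lap
  map_add' := lap_add
  map_smul' := lap_smul

/-- The subspace underlying `polyOn`. -/
def polyOnSub (e : Set (Pt d)) (r : ℤ) : Submodule ℝ (e → ℝ) where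
  carrier := polyOn e r
  add_mem' := by
    rintro _ _ ⟨p, hp, hp'⟩ ⟨q, hq, hq'⟩
    exact ⟨p + q, add_mem hp hq, fun x => by simp [hp', hq']⟩
  zero_mem' := ⟨0, zero_mem _, fun x => by simp⟩
  smul_mem' := by
    rintro c _ ⟨p, hp, hp'⟩
    exact ⟨c • p, Submodule.smul_mem _ c hp, fun x => by simp [hp']⟩

lemma continuous_of_mem_polyOn {e : Set (Pt d)} {r : ℤ} {q : e → ℝ} (hq : q ∈ polyOn e r) :
    Continuous q := by
  obtain ⟨p, -, hp⟩ := hq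
  rw [funext hp]
  fun_prop

instance finiteDimensional_polyOnSub (e : Set (Pt d)) (r : ℤ) :
    FiniteDimensional ℝ (polyOnSub e r) := by
  let φ : polySpace d r →ₗ[ℝ] (e → ℝ) :=
    { toFun := fun p x => evalAt p.1 x
      map_add' := fun p q => by ext x; simp
      map_smul' := fun c p => by ext x; simp }
  have hle : polyOnSub e r ≤ LinearMap.range φ := by
    rintro q ⟨p, hp, hq⟩
    exact ⟨⟨p, hp⟩, funext fun x => (hq x).symm⟩
  exact Submodule.finiteDimensional_of_le hle

end Poly

namespace PolytopalMesh

variable {d : ℕ} {Ω : Set (Pt d)} (M : PolytopalMesh Ω)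

lemma integrable_face (e : M.faces) {f : e.1 → ℝ} (hf : Continuous f) :
    Integrable f (faceMeasure e.1) :=
  hf.integrable_of_hasCompactSupport (HasCompactSupport.of_compactSpace f)

/-- The `L²(e)` inner product of continuous functions. -/
def faceForm (e : M.faces) : C(e.1, ℝ) →ₗ[ℝ] C(e.1, ℝ) →ₗ[ℝ] ℝ :=
  intMul (faceMeasure e.1) fun f => M.integrable_face e f.continuous

/-- The `L²(T)` inner product of continuous functions. -/
def elemForm (T : M.elems) : C(Pt d, ℝ) →ₗ[ℝ] C(Pt d, ℝ) →ₗ[ℝ] ℝ :=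
  intMul (volume.restrict T.1) fun f => M.integrableOn_elem T.2 f.continuous

lemma faceForm_apply (e : M.faces) (f g : C(e.1, ℝ)) :
    M.faceForm e f g = ∫ x, f x * g x ∂(faceMeasure e.1) := rfl

lemma elemForm_apply (T : M.elems) (f g : C(Pt d, ℝ)) :
    M.elemForm T f g = ∫ x in T.1, f x * g x := rfl

lemma eq_zero_of_face_integral_sq (e : M.faces) {f : e.1 → ℝ} (hf : Continuous f)
    (h : ∫ x, f x * f x ∂(faceMeasure e.1) = 0) : f = 0 := by
  have hc : Continuous fun x => f x * f x := hf.mul hf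
  rw [integral_eq_zero_iff_of_nonneg (fun x => mul_self_nonneg _) (M.integrable_face e hc)] at h
  have h2 := Measure.eq_of_ae_eq h hc continuous_const
  ext x
  exact mul_self_eq_zero.1 (congrFun h2 x)

lemma eq_zero_of_faceForm_self (e : M.faces) {f : C(e.1, ℝ)} (h : M.faceForm e f f = 0) : f = 0 :=
  DFunLike.coe_injective (M.eq_zero_of_face_integral_sq e f.continuous h)

/-! ### `L²` projections onto polynomials on a face -/

/-- A projection of zero is orthogonal to itself. This turns the constraints of `V_h^0` into plain
vanishing conditions. -/
lemma isL2Projection_zero_iff (e : M.faces) {r : ℤ} {q : e.1 → ℝ} :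
    IsL2Projection e.1 r 0 q ↔ q = 0 := by
  constructor
  · rintro ⟨hq, h⟩
    apply M.eq_zero_of_face_integral_sq e (continuous_of_mem_polyOn hq)
    have := h q hq
    simpa [integral_neg] using this
  · rintro rfl
    exact ⟨(polyOnSub e.1 r).zero_mem, fun φ _ => by simp⟩

lemma integrable_mul_polyOn (e : M.faces) {r : ℤ} {g : Pt d → ℝ}
    (hg : IntegrableOn g e.1 (μHE[d - 1] : Measure (Pt d))) {φ : e.1 → ℝ} (hφ : φ ∈ polyOn e.1 r) :
    Integrable (fun x : e.1 => g x * φ x) (faceMeasure e.1) := by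
  have hm := (M.isCompact_face e.2).measurableSet
  have h1 : Integrable (fun x : e.1 => g x) (faceMeasure e.1) := by
    have hemb : MeasurableEmbedding (Subtype.val : e.1 → Pt d) := MeasurableEmbedding.subtype_coe hm
    have := hemb.integrable_map_iff (μ := faceMeasure e.1) (g := g)
    rw [faceMeasure, map_comap_subtype_coe hm] at this
    exact this.1 hg
  have h2 := IntegrableOn.mul_continuousOn (K := Set.univ) h1.integrableOn
    (continuous_of_mem_polyOn hφ).continuousOn isCompact_univ
  simpa using h2

/-- The `L²` projection onto polynomials on a face exists and is unique. -/
lemma existsUnique_isL2Projection (e : M.faces) (r : ℤ) {g : Pt d → ℝ}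
    (hg : IntegrableOn g e.1 (μHE[d - 1] : Measure (Pt d))) :
    ∃! q : e.1 → ℝ, IsL2Projection e.1 r g q := by
  -- The form lives on restrictions to the face. On polynomials it would be degenerate, since some
  -- nonzero ones vanish on the whole hyperplane of `e`.
  let B : polyOnSub e.1 r →ₗ[ℝ] polyOnSub e.1 r →ₗ[ℝ] ℝ :=
    LinearMap.mk₂ ℝ (fun p q => M.faceForm e ⟨p.1, continuous_of_mem_polyOn p.2⟩
        ⟨q.1, continuous_of_mem_polyOn q.2⟩)
      (fun p p' q => by
        rw [← LinearMap.add_apply, ← map_add]; rfl)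
      (fun c p q => by
        rw [← LinearMap.smul_apply, ← map_smul]; rfl)
      (fun p q q' => by
        rw [← map_add]; rfl)
      (fun c p q => by
        rw [← map_smul]; rfl)
  have hB : ∀ p q, B p q = ∫ x, p.1 x * q.1 x ∂(faceMeasure e.1) := fun p q => rfl
  let l : polyOnSub e.1 r →ₗ[ℝ] ℝ :=
    { toFun := fun φ => ∫ x : e.1, g x * φ.1 x ∂(faceMeasure e.1)
      map_add' := fun φ ψ => by
        simp only [Submodule.coe_add, Pi.add_apply, mul_add]
        exact integral_add (M.integrable_mul_polyOn e hg φ.2) (M.integrable_mul_polyOn e hg ψ.2)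
      map_smul' := fun c φ => by
        simp only [Submodule.coe_smul, Pi.smul_apply, smul_eq_mul, mul_left_comm, RingHom.id_apply]
        exact integral_const_mul _ _ }
  have hiff : ∀ q : polyOnSub e.1 r, (∀ φ, B q φ = l φ) ↔ IsL2Projection e.1 r g q.1 := by
    intro q
    have hstep : ∀ φ : polyOnSub e.1 r, B q φ = l φ ↔
        ∫ x : e.1, (g x - q.1 x) * φ.1 x ∂(faceMeasure e.1) = 0 := by
      intro φ
      have h1 : ∫ x : e.1, (g x - q.1 x) * φ.1 x ∂(faceMeasure e.1) = l φ - B q φ := by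
        simp only [sub_mul]
        exact integral_sub (M.integrable_mul_polyOn e hg φ.2)
          (M.integrable_face e ((continuous_of_mem_polyOn q.2).mul (continuous_of_mem_polyOn φ.2)))
      rw [h1, sub_eq_zero, eq_comm]
    exact ⟨fun h => ⟨q.2, fun φ hφ => (hstep ⟨φ, hφ⟩).1 (h ⟨φ, hφ⟩)⟩,
      fun h φ => (hstep φ).2 (h.2 φ.1 φ.2)⟩
  obtain ⟨q, hq, huniq⟩ := existsUnique_of_injective B (fun q hq => Subtype.ext
    (M.eq_zero_of_face_integral_sq e (continuous_of_mem_polyOn q.2) (by rw [← hB]; exact hq q))) l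
  exact ⟨q.1, (hiff q).1 hq, fun q' hq' =>
    congrArg Subtype.val (huniq ⟨q', hq'.1⟩ ((hiff ⟨q', hq'.1⟩).2 hq'))⟩

/-! ### The weak finite element spaces as vector spaces -/

lemma vn_add (v w : M.WeakFunction) (T : M.elems) (e : M.faces) :
    (v + w).vn T e = v.vn T e + w.vn T e := by
  ext x; exact inner_add_left _ _ _

lemma vn_smul (c : ℝ) (v : M.WeakFunction) (T : M.elems) (e : M.faces) :
    (c • v).vn T e = c • v.vn T e := by
  ext x; exact real_inner_smul_left _ _ _

lemma vn_zero (T : M.elems) (e : M.faces) : (0 : M.WeakFunction).vn T e = 0 := by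
  ext x; exact inner_zero_left _

/-- `V_h` as a vector space. -/
def VhSub (k : ℕ) : Submodule ℝ M.WeakFunction where
  carrier := M.Vh k
  add_mem' := by
    rintro v w ⟨hv0, hvb, hvn⟩ ⟨hw0, hwb, hwn⟩
    refine ⟨fun T => add_mem (hv0 T) (hw0 T),
      fun e => (polyOnSub e.1 k).add_mem (hvb e) (hwb e), fun T e he => ⟨?_, fun x => ?_⟩⟩
    · rw [vn_add]
      exact (polyOnSub e.1 _).add_mem (hvn T e he).1 (hwn T e he).1
    · rw [vn_add, Pi.add_apply, add_smul, ← (hvn T e he).2, ← (hwn T e he).2]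
      rfl
  zero_mem' := by
    refine ⟨fun T => zero_mem _, fun e => (polyOnSub e.1 k).zero_mem, fun T e he => ⟨?_, fun x => ?_⟩⟩
    · rw [vn_zero]
      exact (polyOnSub e.1 _).zero_mem
    · rw [vn_zero, Pi.zero_apply, zero_smul]
      rfl
  smul_mem' := by
    rintro c v ⟨hv0, hvb, hvn⟩
    refine ⟨fun T => Submodule.smul_mem _ c (hv0 T),
      fun e => (polyOnSub e.1 k).smul_mem c (hvb e), fun T e he => ⟨?_, fun x => ?_⟩⟩
    · rw [vn_smul]
      exact (polyOnSub e.1 _).smul_mem c (hvn T e he).1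
    · rw [vn_smul, Pi.smul_apply, smul_assoc, ← (hvn T e he).2]
      rfl

/-- `W_h` as a vector space. -/
def WhSub (k : ℕ) : Submodule ℝ M.PiecewisePoly where
  carrier := M.Wh k
  add_mem' hv hw T := add_mem (hv T) (hw T)
  zero_mem' _ := zero_mem _
  smul_mem' c _ hv T := Submodule.smul_mem _ c (hv T)

lemma mem_Vh0_iff {k : ℕ} {Γd Γn : Set (Pt d)} {v : M.WeakFunction} :
    v ∈ M.Vh0 k Γd Γn ↔ v ∈ M.Vh k ∧
      (∀ e : M.faces, IsFaceOf (Ω := Ω) Γd e.1 → v.vb e = 0) ∧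
      (∀ e : M.faces, IsFaceOf (Ω := Ω) Γn e.1 →
        ∀ T : M.elems, e.1 ⊆ frontier T.1 → v.vn T e = 0) := by
  simp only [Vh0, Vhg, Set.mem_ofPred_eq, isL2Projection_zero_iff]

/-- `V_h^0` as a subspace of `V_h`. -/
def Vh0Sub (k : ℕ) (Γd Γn : Set (Pt d)) : Submodule ℝ (M.VhSub k) where
  carrier := {v | v.1 ∈ M.Vh0 k Γd Γn}
  add_mem' := by
    intro v w hv hw
    rw [Set.mem_ofPred_eq, mem_Vh0_iff] at hv hw ⊢
    refine ⟨(v + w).2, fun e he => ?_, fun e he T hT => ?_⟩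
    · have : (v + w).1.vb e = v.1.vb e + w.1.vb e := rfl
      rw [this, hv.2.1 e he, hw.2.1 e he, add_zero]
    · rw [Submodule.coe_add, vn_add, hv.2.2 e he T hT, hw.2.2 e he T hT, add_zero]
  zero_mem' := by
    rw [Set.mem_ofPred_eq, mem_Vh0_iff]
    exact ⟨(0 : M.VhSub k).2, fun e he => rfl, fun e he T hT => M.vn_zero T e⟩
  smul_mem' := by
    intro c v hv
    rw [Set.mem_ofPred_eq, mem_Vh0_iff] at hv ⊢
    refine ⟨(c • v).2, fun e he => ?_, fun e he T hT => ?_⟩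
    · have : (c • v).1.vb e = c • v.1.vb e := rfl
      rw [this, hv.2.1 e he, smul_zero]
    · rw [Submodule.coe_smul, vn_smul, hv.2.2 e he T hT, smul_zero]

instance finiteDimensional_VhSub (k : ℕ) : FiniteDimensional ℝ (M.VhSub k) := by
  -- One element per face suffices: its normal and its scalar `v_n` recover the vector `v_n n`.
  choose! S hS hSe using fun e he => M.exists_elem_of_face (e := e) he
  let φ : ((M.elems → polySpace d k) × (M.faces → polySpace d k) ×
      (M.faces → polySpace d ((k : ℤ) - 1))) →ₗ[ℝ] M.WeakFunction :=
    { toFun := fun p => (fun T => (p.1 T).1, fun e x => evalAt (p.2.1 e).1 x,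
        fun e x => evalAt (p.2.2 e).1 x • M.normal (S e.1) e.1)
      map_add' := fun p q => by
        refine Prod.ext rfl (Prod.ext ?_ ?_)
        · funext e x; simp
        · funext e x; simp [add_smul]
      map_smul' := fun c p => by
        refine Prod.ext rfl (Prod.ext ?_ ?_)
        · funext e x; simp
        · funext e x; simp [mul_smul] }
  have hle : M.VhSub k ≤ LinearMap.range φ := by
    rintro v ⟨hv0, hvb, hvn⟩
    choose pb hpb hpb' using hvb
    choose pn hpn hpn' using fun e : M.faces => (hvn ⟨S e.1, hS e.1 e.2⟩ e (hSe e.1 e.2)).1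
    refine ⟨(fun T => ⟨v.v0 T, hv0 T⟩, fun e => ⟨pb e, hpb e⟩, fun e => ⟨pn e, hpn e⟩), ?_⟩
    refine Prod.ext rfl (Prod.ext ?_ ?_)
    · funext e x
      exact (hpb' e x).symm
    · funext e x
      have h := (hvn ⟨S e.1, hS e.1 e.2⟩ e (hSe e.1 e.2)).2 x
      rw [hpn' e x] at h
      exact h.symm
  exact Submodule.finiteDimensional_of_le hle

instance finiteDimensional_WhSub (k : ℕ) : FiniteDimensional ℝ (M.WhSub k) := by
  let φ : (M.elems → polySpace d ((k : ℤ) - 2)) →ₗ[ℝ] M.PiecewisePoly :=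
    { toFun := fun p T => (p T).1
      map_add' := fun p q => rfl
      map_smul' := fun c p => rfl }
  have hle : M.WhSub k ≤ LinearMap.range φ := fun w hw => ⟨fun T => ⟨w T, hw T⟩, rfl⟩
  exact Submodule.finiteDimensional_of_le hle

/-! ### Traces -/

/-- `T` need not have `e` on its boundary. Some element `S` does, and through it `vnn` is a
polynomial times a constant vector. -/
lemma continuous_vn {k : ℕ} (v : M.VhSub k) (T : M.elems) (e : M.faces) :
    Continuous (v.1.vn T e) := by
  obtain ⟨S, hS, heS⟩ := M.exists_elem_of_face e.2
  have h := v.2.2.2 ⟨S, hS⟩ e heS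
  have : v.1.vnn e = fun x => v.1.vn ⟨S, hS⟩ e x • M.normal S e.1 := funext h.2
  have hc : Continuous (v.1.vnn e) := by
    rw [this]
    exact (continuous_of_mem_polyOn h.1).smul continuous_const
  exact hc.inner continuous_const

/-- The component `v_b` on a face. -/
def traceB (k : ℕ) (e : M.faces) : M.VhSub k →ₗ[ℝ] C(e.1, ℝ) where
  toFun v := ⟨v.1.vb e, continuous_of_mem_polyOn (v.2.2.1 e)⟩
  map_add' _ _ := rfl
  map_smul' _ _ := rfl

/-- The component `v_n` on a face of an element. -/
def traceN (k : ℕ) (T : M.elems) (e : M.faces) : M.VhSub k →ₗ[ℝ] C(e.1, ℝ) where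
  toFun v := ⟨v.1.vn T e, M.continuous_vn v T e⟩
  map_add' v w := by ext x; exact congrFun (M.vn_add v.1 w.1 T e) x
  map_smul' c v := by ext x; exact congrFun (M.vn_smul c v.1 T e) x

/-- The component `v₀` on an element. -/
def interiorPart (k : ℕ) (T : M.elems) : M.VhSub k →ₗ[ℝ] Poly d where
  toFun v := v.1.v0 T
  map_add' _ _ := rfl
  map_smul' _ _ := rfl

/-- The jump `v₀ - v_b` on a face of an element. -/
def jumpB (k : ℕ) (T : M.elems) (e : M.faces) : M.VhSub k →ₗ[ℝ] C(e.1, ℝ) :=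
  polyE e.1 ∘ₗ M.interiorPart k T - M.traceB k e

/-- The jump `∇v₀ · n - v_n` on a face of an element. -/
def jumpN (k : ℕ) (T : M.elems) (e : M.faces) : M.VhSub k →ₗ[ℝ] C(e.1, ℝ) :=
  polyE e.1 ∘ₗ (dirDerivation (M.normal T.1 e.1)).toLinearMap ∘ₗ M.interiorPart k T -
    M.traceN k T e

lemma jumpB_apply {k : ℕ} (T : M.elems) (e : M.faces) (v : M.VhSub k) (x : e.1) :
    M.jumpB k T e v x = evalAt (v.1.v0 T) x - v.1.vb e x := rfl

lemma jumpN_apply {k : ℕ} (T : M.elems) (e : M.faces) (v : M.VhSub k) (x : e.1) :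
    M.jumpN k T e v x = dirDeriv (v.1.v0 T) (M.normal T.1 e.1) x - v.1.vn T e x := by
  rw [← evalAt_dirDerivation]; rfl

open Classical in
/-- The stabilizer as a bilinear form. -/
def stabForm (k : ℕ) : M.VhSub k →ₗ[ℝ] M.VhSub k →ₗ[ℝ] ℝ :=
  ∑ T : M.elems,
    ((Metric.diam T.1 ^ 3)⁻¹ • ∑ e : M.faces with e.1 ⊆ frontier T.1,
        (M.faceForm e).compl₁₂ (M.jumpB k T e) (M.jumpB k T e) +
      (Metric.diam T.1)⁻¹ • ∑ e : M.faces with e.1 ⊆ frontier T.1,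
        (M.faceForm e).compl₁₂ (M.jumpN k T e) (M.jumpN k T e))

lemma stabForm_apply {k : ℕ} (u v : M.VhSub k) : M.stabForm k u v = M.stab u.1 v.1 := by
  simp only [stabForm, stab, stabT, boundaryIntegral, LinearMap.sum_apply, LinearMap.add_apply,
    LinearMap.smul_apply, LinearMap.compl₁₂_apply, faceForm_apply, jumpB_apply, jumpN_apply,
    smul_eq_mul]

open Classical in
/-- The right-hand side of the definition of the discrete weak Laplacian on `T`. -/
def weakLapForm (k : ℕ) (T : M.elems) : M.VhSub k →ₗ[ℝ] Poly d →ₗ[ℝ] ℝ :=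
  (M.elemForm T).compl₁₂ (polyC ∘ₗ M.interiorPart k T) (polyC ∘ₗ lapL) -
    ∑ e : M.faces with e.1 ⊆ frontier T.1, (M.faceForm e).compl₁₂ (M.traceB k e)
      (polyE e.1 ∘ₗ (dirDerivation (M.normal T.1 e.1)).toLinearMap) +
    ∑ e : M.faces with e.1 ⊆ frontier T.1, (M.faceForm e).compl₁₂ (M.traceN k T e) (polyE e.1)

lemma weakLapForm_apply {k : ℕ} (T : M.elems) (v : M.VhSub k) (φ : Poly d) :
    M.weakLapForm k T v φ = (∫ x in T.1, evalAt (v.1.v0 T) x * evalAt (lap φ) x)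
        - M.boundaryIntegral T.1 (fun e x => v.1.vb e x * dirDeriv φ (M.normal T.1 e.1) x)
        + M.boundaryIntegral T.1 (fun e x => v.1.vn T e x * evalAt φ x) := by
  simp only [weakLapForm, boundaryIntegral, LinearMap.sum_apply, LinearMap.add_apply,
    LinearMap.sub_apply, LinearMap.compl₁₂_apply, faceForm_apply, elemForm_apply,
    ← evalAt_dirDerivation]
  rfl

/-- The discrete weak Laplacian exists. -/
lemma isDiscreteWeakLaplacian_weakLaplacian {k : ℕ} (r : ℤ) (T : M.elems) (v : M.VhSub k) :
    M.IsDiscreteWeakLaplacian r T v.1 (M.weakLaplacian r T v.1) := by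
  have hex : ∃ q, M.IsDiscreteWeakLaplacian r T v.1 q := by
    let P : polySpace d r →ₗ[ℝ] C(Pt d, ℝ) := polyC ∘ₗ (polySpace d r).subtype
    obtain ⟨q, hq, -⟩ := existsUnique_of_injective ((M.elemForm T).compl₁₂ P P)
      (fun q hq => Subtype.ext (M.eq_zero_of_integral_sq T.2 (hq q)))
      (M.weakLapForm k T v ∘ₗ (polySpace d r).subtype)
    refine ⟨q.1, q.2, fun φ hφ => ?_⟩
    rw [← weakLapForm_apply]
    exact hq ⟨φ, hφ⟩
  rw [weakLaplacian, dif_pos hex]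
  exact hex.choose_spec

/-- The pairing of discrete weak Laplacians with piecewise polynomials. -/
def dualForm (k : ℕ) : M.VhSub k →ₗ[ℝ] M.PiecewisePoly →ₗ[ℝ] ℝ :=
  ∑ T : M.elems, (M.weakLapForm k T).compl₁₂ LinearMap.id (LinearMap.proj T)

lemma dualForm_apply {k : ℕ} (v : M.VhSub k) (w : M.PiecewisePoly) :
    M.dualForm k v w = ∑ T, M.weakLapForm k T v (w T) := by
  simp [dualForm]

/-- This replaces the chosen weak Laplacian by an explicit bilinear form. It needs `w` in `W_h`,
since the weak Laplacian is defined by testing against `P_{k-2}` only. -/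
lemma innerPP_weakLaplacianH {k : ℕ} (v : M.VhSub k) {w : M.PiecewisePoly} (hw : w ∈ M.Wh k) :
    M.innerPP (M.weakLaplacianH k v.1) w = M.dualForm k v w := by
  rw [dualForm_apply, innerPP]
  refine Finset.sum_congr rfl fun T _ => ?_
  rw [weakLapForm_apply]
  exact (M.isDiscreteWeakLaplacian_weakLaplacian _ T v).2 (w T) (hw T)

end PolytopalMesh

namespace PolytopalMesh

variable {d : ℕ} {Ω : Set (Pt d)} (M : PolytopalMesh Ω)

/-! ### The primal component of the homogeneous system -/

lemma diam_elem_pos (hd : 0 < d) (T : M.elems) : 0 < Metric.diam T.1 := by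
  have : Nonempty (Fin d) := ⟨⟨0, hd⟩⟩
  refine Metric.diam_pos ?_ (M.isCompact_elem T.2).isBounded
  by_contra h
  rw [Set.not_nontrivial_iff] at h
  have h1 := isOpen_interior.measure_pos (volume : Measure (Pt d)) (M.elem_connected T.1 T.2).nonempty
  exact h1.ne' ((h.anti interior_subset).measure_zero _)

/-- `s(u, u)` is a sum of squared norms with positive weights, and the surface measure charges
relatively open sets. -/
lemma jump_eq_zero_of_stab_eq_zero (hd : 0 < d) {k : ℕ} {u : M.VhSub k}
    (h : M.stabForm k u u = 0) (T : M.elems) (e : M.faces) (he : e.1 ⊆ frontier T.1) :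
    M.jumpB k T e u = 0 ∧ M.jumpN k T e u = 0 := by
  classical
  have hnn : ∀ (e : M.faces) (g : C(e.1, ℝ)), 0 ≤ M.faceForm e g g := fun e g =>
    intMul_self_nonneg _ _ g
  simp only [stabForm, LinearMap.sum_apply, LinearMap.add_apply, LinearMap.smul_apply,
    LinearMap.compl₁₂_apply, smul_eq_mul] at h
  have hd1 := M.diam_elem_pos hd
  have h1 := (Finset.sum_eq_zero_iff_of_nonneg (fun S _ => add_nonneg
    (mul_nonneg (inv_nonneg.2 (pow_nonneg (hd1 S).le 3)) (Finset.sum_nonneg fun e _ => hnn e _))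
    (mul_nonneg (inv_nonneg.2 (hd1 S).le) (Finset.sum_nonneg fun e _ => hnn e _)))).1 h T
    (Finset.mem_univ T)
  obtain ⟨h2, h3⟩ := (add_eq_zero_iff_of_nonneg
    (mul_nonneg (inv_nonneg.2 (pow_nonneg (hd1 T).le 3)) (Finset.sum_nonneg fun e _ => hnn e _))
    (mul_nonneg (inv_nonneg.2 (hd1 T).le) (Finset.sum_nonneg fun e _ => hnn e _))).1 h1
  have h4 := (mul_eq_zero.1 h2).resolve_left (inv_ne_zero (pow_ne_zero 3 (hd1 T).ne'))
  have h5 := (mul_eq_zero.1 h3).resolve_left (inv_ne_zero (hd1 T).ne')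
  have hmem : e ∈ Finset.univ.filter fun e : M.faces => e.1 ⊆ frontier T.1 := by simpa using he
  exact ⟨M.eq_zero_of_faceForm_self e ((Finset.sum_eq_zero_iff_of_nonneg fun e _ => hnn e _).1 h4 e hmem),
    M.eq_zero_of_faceForm_self e ((Finset.sum_eq_zero_iff_of_nonneg fun e _ => hnn e _).1 h5 e hmem)⟩

/-- If the jumps of `u` vanish, then its weak Laplacian is the Laplacian of `u₀`. -/
lemma weakLapForm_eq_of_jump_eq_zero {k : ℕ} {u : M.VhSub k} (T : M.elems)
    (h : ∀ e : M.faces, e.1 ⊆ frontier T.1 → M.jumpB k T e u = 0 ∧ M.jumpN k T e u = 0)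
    (φ : Poly d) :
    M.weakLapForm k T u φ = ∫ x in T.1, evalAt (lap (u.1.v0 T)) x * evalAt φ x := by
  classical
  rw [← M.green T.2, weakLapForm_apply]
  have hb : ∀ e : M.faces, e.1 ⊆ frontier T.1 → ∀ x : e.1, u.1.vb e x = evalAt (u.1.v0 T) x := by
    intro e he x
    have := DFunLike.congr_fun (h e he).1 x
    rw [jumpB_apply, ContinuousMap.zero_apply] at this
    linarith
  have hn : ∀ e : M.faces, e.1 ⊆ frontier T.1 → ∀ x : e.1,
      u.1.vn T e x = dirDeriv (u.1.v0 T) (M.normal T.1 e.1) x := by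
    intro e he x
    have := DFunLike.congr_fun (h e he).2 x
    rw [jumpN_apply, ContinuousMap.zero_apply] at this
    linarith
  congr 1
  · congr 1
    refine Finset.sum_congr rfl fun e he => ?_
    simp only [hb e (Finset.mem_filter.1 he).2]
  · refine Finset.sum_congr rfl fun e he => ?_
    simp only [hn e (Finset.mem_filter.1 he).2]

lemma eq_zero_of_sum_integral_sq {p : M.PiecewisePoly}
    (h : ∑ T : M.elems, ∫ x in T.1, evalAt (p T) x * evalAt (p T) x = 0) (T : M.elems) : p T = 0 :=
  M.eq_zero_of_integral_sq T.2 ((Finset.sum_eq_zero_iff_of_nonneg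
    (fun _ _ => integral_nonneg fun _ => mul_self_nonneg _)).1 h T (Finset.mem_univ T))

lemma vn_eq_neg {k : ℕ} (v : M.VhSub k) (e : M.faces) {T T' : M.elems} (hne : T ≠ T')
    (heT : e.1 ⊆ frontier T.1) (heT' : e.1 ⊆ frontier T'.1) (x : e.1) :
    v.1.vn T' e x = -v.1.vn T e x := by
  simp only [WeakFunction.vn]
  rw [M.normal_eq_neg T.2 T'.2 (fun h => hne (Subtype.ext h)) e.2 heT heT', inner_neg_right]

lemma dirDeriv_neg (p : Poly d) (n x : Pt d) : dirDeriv p (-n) x = -dirDeriv p n x := by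
  simp [dirDeriv]

/-- Vanishing jumps make `u₀` piecewise harmonic with matching Cauchy data, and the face `e₀`, lying
in both boundary portions, supplies the zero data from which unique continuation starts. -/
theorem primal_eq_zero (hd : 0 < d) (hΩo : IsOpen Ω) (hΩc : IsConnected Ω) {k : ℕ}
    {Γd Γn : Set (Pt d)} {u : M.VhSub k} (hu : u.1 ∈ M.Vh0 k Γd Γn)
    {e₀ : M.faces} (hed : IsFaceOf (Ω := Ω) Γd e₀.1) (hen : IsFaceOf (Ω := Ω) Γn e₀.1)
    (hs : M.stabForm k u u = 0) (hw : ∀ w ∈ M.Wh k, M.dualForm k u w = 0) : u = 0 := by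
  have hjump := M.jump_eq_zero_of_stab_eq_zero hd hs
  have hb : ∀ (T : M.elems) (e : M.faces), e.1 ⊆ frontier T.1 → ∀ x : e.1,
      u.1.vb e x = evalAt (u.1.v0 T) x := by
    intro T e he x
    have := DFunLike.congr_fun (hjump T e he).1 x
    rw [jumpB_apply, ContinuousMap.zero_apply] at this
    linarith
  have hn : ∀ (T : M.elems) (e : M.faces), e.1 ⊆ frontier T.1 → ∀ x : e.1,
      u.1.vn T e x = dirDeriv (u.1.v0 T) (M.normal T.1 e.1) x := by
    intro T e he x
    have := DFunLike.congr_fun (hjump T e he).2 x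
    rw [jumpN_apply, ContinuousMap.zero_apply] at this
    linarith
  have hlap : ∀ T, lap (u.1.v0 T) = 0 := by
    refine M.eq_zero_of_sum_integral_sq (p := fun T => lap (u.1.v0 T)) ?_
    -- The degrees fit: `u₀` in `P_k` makes `Δu₀` an admissible test function in `W_h`.
    have h1 := hw (fun T => lap (u.1.v0 T)) fun T => lap_mem_polySpace (u.2.1 T)
    rw [dualForm_apply] at h1
    rw [← h1]
    exact Finset.sum_congr rfl fun T _ =>
      (M.weakLapForm_eq_of_jump_eq_zero T (hjump T) _).symm
  rw [mem_Vh0_iff] at hu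
  obtain ⟨T₀, hT₀, heT₀⟩ := M.exists_elem_of_face e₀.2
  have hz : u.1.1 = 0 := by
    refine M.eq_zero_of_piecewise_harmonic hΩo hΩc u.1.1 hlap ?_ e₀.2 (T₀ := ⟨T₀, hT₀⟩) heT₀ ?_ ?_
    -- The two traces agree because `v_b` is single valued. The normal derivatives agree because
    -- `v_n` and the normal change sign together.
    · intro e _ T T' hne heT heT' x hx
      refine ⟨(hb T e heT ⟨x, hx⟩).symm.trans (hb T' e heT' ⟨x, hx⟩), ?_⟩
      have h1 := hn T' e heT' ⟨x, hx⟩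
      rw [M.vn_eq_neg u e hne heT heT', hn T e heT ⟨x, hx⟩,
        M.normal_eq_neg T.2 T'.2 (fun h => hne (Subtype.ext h)) e.2 heT heT', dirDeriv_neg,
        neg_inj] at h1
      exact h1
    · intro x hx
      exact (hb ⟨T₀, hT₀⟩ e₀ heT₀ ⟨x, hx⟩).symm.trans (congrFun (hu.2.1 e₀ hed) ⟨x, hx⟩)
    · intro x hx
      exact (hn ⟨T₀, hT₀⟩ e₀ heT₀ ⟨x, hx⟩).symm.trans
        (congrFun (hu.2.2 e₀ hen ⟨T₀, hT₀⟩ heT₀) ⟨x, hx⟩)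
  have hz' : ∀ T, u.1.v0 T = 0 := fun T => congrFun hz T
  refine Subtype.ext (Prod.ext hz (Prod.ext ?_ ?_))
  · funext e x
    obtain ⟨T, hT, heT⟩ := M.exists_elem_of_face e.2
    have := hb ⟨T, hT⟩ e heT x
    rw [hz', evalAt_zero] at this
    exact this
  · funext e x
    obtain ⟨T, hT, heT⟩ := M.exists_elem_of_face e.2
    have h1 := (u.2.2.2 ⟨T, hT⟩ e heT).2 x
    rw [hn ⟨T, hT⟩ e heT x, hz'] at h1
    simp only [dirDeriv, map_zero, evalAt_zero, zero_mul, Finset.sum_const_zero, zero_smul] at h1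
    exact h1

/-! ### The dual component of the homogeneous system -/

open Classical in
/-- The elements which contain the face `e`. -/
def elemsOf (e : Set (Pt d)) : Finset M.elems := Finset.univ.filter fun T => e ⊆ frontier T.1

lemma mem_elemsOf {e : Set (Pt d)} {T : M.elems} : T ∈ M.elemsOf e ↔ e ⊆ frontier T.1 := by
  simp [elemsOf]

lemma card_elemsOf (e : Set (Pt d)) :
    (M.elemsOf e).card = {T | T ∈ M.elems ∧ e ⊆ frontier T}.ncard := by
  rw [← Finset.card_map (Function.Embedding.subtype _), ← Set.ncard_coe_finset]
  congr 1
  ext T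
  simp [mem_elemsOf, and_comm]

open Classical in
lemma elemsOf_interior {e : M.faces} (hb : ¬ e.1 ⊆ frontier Ω) {T T' : M.elems} (hne : T ≠ T')
    (heT : e.1 ⊆ frontier T.1) (heT' : e.1 ⊆ frontier T'.1) : M.elemsOf e.1 = {T, T'} := by
  symm
  apply Finset.eq_of_subset_of_card_le
  · intro S hS
    rw [Finset.mem_insert, Finset.mem_singleton] at hS
    rcases hS with rfl | rfl
    · exact M.mem_elemsOf.2 heT
    · exact M.mem_elemsOf.2 heT'
  · rw [card_elemsOf, M.interior_face e.1 e.2 hb, Finset.card_pair hne]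

lemma elemsOf_boundary {e : M.faces} (hb : e.1 ⊆ frontier Ω) {T : M.elems}
    (heT : e.1 ⊆ frontier T.1) : M.elemsOf e.1 = {T} := by
  have h := M.card_elemsOf e.1
  rw [M.boundary_face e.1 e.2 hb] at h
  obtain ⟨S, hS⟩ := Finset.card_eq_one.1 h
  have := M.mem_elemsOf.2 heT
  rw [hS, Finset.mem_singleton] at this
  rw [hS, this]

open Classical in
/-- A boundary integral summed over the elements, for an integrand concentrated on one face. -/
lemma sum_boundaryIntegral_of_single (e : M.faces) (F : M.elems → (e : M.faces) → e.1 → ℝ)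
    (hF : ∀ T e', e' ≠ e → F T e' = 0) :
    ∑ T : M.elems, M.boundaryIntegral T.1 (F T) =
      ∑ T ∈ M.elemsOf e.1, ∫ x, F T e x ∂(faceMeasure e.1) := by
  rw [elemsOf, Finset.sum_filter]
  refine Finset.sum_congr rfl fun T _ => ?_
  rw [boundaryIntegral, Finset.sum_filter, Finset.sum_eq_single e]
  · intro e' _ hne
    simp [hF T e' hne]
  · simp

/-- An element which contains the face `e`. -/
def side (e : M.faces) : M.elems :=
  ⟨(M.exists_elem_of_face e.2).choose, (M.exists_elem_of_face e.2).choose_spec.1⟩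

lemma face_subset_side (e : M.faces) : e.1 ⊆ frontier (M.side e).1 :=
  (M.exists_elem_of_face e.2).choose_spec.2

/-- The weak function with prescribed components, where `v_n` is given as seen from `side e`. -/
def weakFun {k : ℕ} (p : M.PiecewisePoly) (hp : ∀ T, p T ∈ polySpace d k)
    (qb : (e : M.faces) → e.1 → ℝ) (hqb : ∀ e, qb e ∈ polyOn e.1 k)
    (qn : (e : M.faces) → e.1 → ℝ) (hqn : ∀ e, qn e ∈ polyOn e.1 ((k : ℤ) - 1)) : M.VhSub k :=
  ⟨(p, qb, fun e x => qn e x • M.normal (M.side e).1 e.1), by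
    refine ⟨hp, hqb, fun T e heT => ?_⟩
    -- If `e` lies on the boundary of `T`, the inner product of the normals is `1` or `-1`, which is
    -- the sign change of `v_n` across the face.
    have hvn : WeakFunction.vn (M := M)
        (p, qb, fun e x => qn e x • M.normal (M.side e).1 e.1) T e =
        (inner ℝ (M.normal (M.side e).1 e.1) (M.normal T.1 e.1) : ℝ) • qn e := by
      ext x
      simp [WeakFunction.vn, WeakFunction.vnn, real_inner_smul_left, mul_comm]
    refine ⟨by rw [hvn]; exact (polyOnSub e.1 _).smul_mem _ (hqn e), fun x => ?_⟩
    rw [hvn]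
    have hn1 := M.norm_normal (M.side e).2 e.2 (M.face_subset_side e)
    by_cases hTS : M.side e = T
    · subst hTS
      simp [WeakFunction.vnn, hn1]
    · rw [M.normal_eq_neg (M.side e).2 T.2 (fun h => hTS (Subtype.ext h)) e.2
        (M.face_subset_side e) heT]
      simp [WeakFunction.vnn, hn1]⟩

section WeakFun

variable {k : ℕ} {p : M.PiecewisePoly} {hp : ∀ T, p T ∈ polySpace d k}
  {qb : (e : M.faces) → e.1 → ℝ} {hqb : ∀ e, qb e ∈ polyOn e.1 k}
  {qn : (e : M.faces) → e.1 → ℝ} {hqn : ∀ e, qn e ∈ polyOn e.1 ((k : ℤ) - 1)}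

lemma weakFun_v0 (T : M.elems) : (M.weakFun p hp qb hqb qn hqn).1.v0 T = p T := rfl

lemma weakFun_vb (e : M.faces) : (M.weakFun p hp qb hqb qn hqn).1.vb e = qb e := rfl

lemma weakFun_vn (T : M.elems) (e : M.faces) (x : e.1) :
    (M.weakFun p hp qb hqb qn hqn).1.vn T e x =
      qn e x * inner ℝ (M.normal (M.side e).1 e.1) (M.normal T.1 e.1) :=
  real_inner_smul_left _ _ _

lemma weakFun_mem_Vh0 {Γd Γn : Set (Pt d)} (hb : ∀ e : M.faces, IsFaceOf (Ω := Ω) Γd e.1 → qb e = 0)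
    (hn : ∀ e : M.faces, IsFaceOf (Ω := Ω) Γn e.1 → qn e = 0) :
    (M.weakFun p hp qb hqb qn hqn).1 ∈ M.Vh0 k Γd Γn := by
  rw [mem_Vh0_iff]
  refine ⟨(M.weakFun p hp qb hqb qn hqn).2, hb, fun e he T _ => ?_⟩
  ext x
  rw [weakFun_vn, hn e he, Pi.zero_apply, zero_mul]

end WeakFun

lemma zero_mem_polyOn (r : ℤ) (e : M.faces) : (0 : (e : M.faces) → e.1 → ℝ) e ∈ polyOn e.1 r :=
  (polyOnSub e.1 r).zero_mem

open Classical in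
lemma single_mem_polyOn {r : ℤ} {e : M.faces} {q : e.1 → ℝ} (hq : q ∈ polyOn e.1 r) (e' : M.faces) :
    (Pi.single e q : (e : M.faces) → e.1 → ℝ) e' ∈ polyOn e'.1 r := by
  by_cases h : e' = e
  · subst h
    rwa [Pi.single_eq_same]
  · rw [Pi.single_eq_of_ne h]
    exact (polyOnSub e'.1 r).zero_mem

/-- The weak function whose only component is `v₀ = p`. -/
def interiorFun {k : ℕ} (p : M.PiecewisePoly) (hp : ∀ T, p T ∈ polySpace d k) : M.VhSub k :=
  M.weakFun p hp 0 (M.zero_mem_polyOn _) 0 (M.zero_mem_polyOn _)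

open Classical in
/-- The weak function with `v_b = q` on the face `e` and no other component. -/
def singleB {k : ℕ} (e : M.faces) {q : e.1 → ℝ} (hq : q ∈ polyOn e.1 k) : M.VhSub k :=
  M.weakFun 0 (fun _ => zero_mem _) (Pi.single e q) (M.single_mem_polyOn hq) 0 (M.zero_mem_polyOn _)

open Classical in
/-- The weak function with `v_n = q` on the face `e`, as seen from `side e`, and no other
component. -/
def singleN {k : ℕ} (e : M.faces) {q : e.1 → ℝ} (hq : q ∈ polyOn e.1 ((k : ℤ) - 1)) : M.VhSub k :=
  M.weakFun 0 (fun _ => zero_mem _) 0 (M.zero_mem_polyOn _) (Pi.single e q) (M.single_mem_polyOn hq)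

/-! ### The dual form on weak functions with a single component -/

lemma boundaryIntegral_zero (T : Set (Pt d)) : M.boundaryIntegral T (fun _ _ => 0) = 0 := by
  simp [boundaryIntegral]

lemma dualForm_interiorFun {k : ℕ} {p : M.PiecewisePoly} (hp : ∀ T, p T ∈ polySpace d k)
    (w : M.PiecewisePoly) :
    M.dualForm k (M.interiorFun p hp) w =
      ∑ T : M.elems, ∫ x in T.1, evalAt (p T) x * evalAt (lap (w T)) x := by
  rw [dualForm_apply]
  refine Finset.sum_congr rfl fun T _ => ?_
  rw [weakLapForm_apply]
  simp [interiorFun, weakFun_v0, weakFun_vb, weakFun_vn, boundaryIntegral_zero]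

lemma dualForm_singleB {k : ℕ} {e : M.faces} {q : e.1 → ℝ} (hq : q ∈ polyOn e.1 k)
    (w : M.PiecewisePoly) :
    M.dualForm k (M.singleB e hq) w =
      -∑ T ∈ M.elemsOf e.1, ∫ x : e.1, q x * dirDeriv (w T) (M.normal T.1 e.1) x
        ∂(faceMeasure e.1) := by
  classical
  have h := M.sum_boundaryIntegral_of_single e (fun T e' x =>
    (Pi.single e q : (e : M.faces) → e.1 → ℝ) e' x * dirDeriv (w T) (M.normal T.1 e'.1) x)
    (fun T e' hne => by
      ext x
      simp [Pi.single_eq_of_ne hne])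
  simp only [Pi.single_eq_same] at h
  rw [dualForm_apply, ← h, ← Finset.sum_neg_distrib]
  refine Finset.sum_congr rfl fun T _ => ?_
  rw [weakLapForm_apply]
  simp [singleB, weakFun_v0, weakFun_vb, weakFun_vn, boundaryIntegral_zero]

lemma dualForm_singleN {k : ℕ} {e : M.faces} {q : e.1 → ℝ}
    (hq : q ∈ polyOn e.1 ((k : ℤ) - 1)) (w : M.PiecewisePoly) :
    M.dualForm k (M.singleN e hq) w =
      ∑ T ∈ M.elemsOf e.1, ∫ x : e.1,
        q x * (inner ℝ (M.normal (M.side e).1 e.1) (M.normal T.1 e.1) * evalAt (w T) x)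
        ∂(faceMeasure e.1) := by
  classical
  have h := M.sum_boundaryIntegral_of_single e (fun T e' x =>
    (Pi.single e q : (e : M.faces) → e.1 → ℝ) e' x *
      (inner ℝ (M.normal (M.side e').1 e'.1) (M.normal T.1 e'.1) * evalAt (w T) x))
    (fun T e' hne => by
      ext x
      simp [Pi.single_eq_of_ne hne])
  simp only [Pi.single_eq_same] at h
  rw [dualForm_apply, ← h]
  refine Finset.sum_congr rfl fun T _ => ?_
  rw [weakLapForm_apply]
  simp [singleN, weakFun_v0, weakFun_vb, weakFun_vn, boundaryIntegral_zero, mul_assoc]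

/-! ### Consequences of the homogeneous dual equation -/

section Dual

variable {M} {k : ℕ} {Γd Γn : Set (Pt d)} {lam : M.PiecewisePoly}

/-- The test function has `v₀ = Δλ` and no other component. It lies in `V_h^0` because the
constraints do not involve `v₀`. -/
lemma lap_eq_zero_of_dualForm (hlam : lam ∈ M.Wh k)
    (h : ∀ v : M.VhSub k, v.1 ∈ M.Vh0 k Γd Γn → M.dualForm k v lam = 0) (T : M.elems) :
    lap (lam T) = 0 := by
  have hmem : ∀ T, lap (lam T) ∈ polySpace d k := fun T =>
    polySpace_mono (by linarith) (lap_mem_polySpace (hlam T))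
  refine M.eq_zero_of_sum_integral_sq (p := fun T => lap (lam T)) ?_ T
  rw [← M.dualForm_interiorFun hmem]
  exact h _ (M.weakFun_mem_Vh0 (fun _ _ => rfl) fun _ _ => rfl)

/-- The sum itself is used as `v_b` on `e`; its degree is at most `k - 3`. On an interior face it is
the jump of the normal derivative, on a boundary face the normal derivative. -/
lemma sum_dirDeriv_eq_zero_of_dualForm (hlam : lam ∈ M.Wh k)
    (h : ∀ v : M.VhSub k, v.1 ∈ M.Vh0 k Γd Γn → M.dualForm k v lam = 0) {e : M.faces}
    (he : ¬ IsFaceOf (Ω := Ω) Γd e.1) (x : e.1) :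
    ∑ T ∈ M.elemsOf e.1, dirDeriv (lam T) (M.normal T.1 e.1) x = 0 := by
  set q : e.1 → ℝ := fun x => ∑ T ∈ M.elemsOf e.1, dirDeriv (lam T) (M.normal T.1 e.1) x with hqdef
  have hq : q ∈ polyOn e.1 k := by
    refine ⟨∑ T ∈ M.elemsOf e.1, dirDerivation (M.normal T.1 e.1) (lam T),
      Submodule.sum_mem _ fun T _ => polySpace_mono (by linarith)
        (dirDerivation_mem_polySpace (hlam T) _), fun x => ?_⟩
    simp only [evalAt_sum, evalAt_dirDerivation, hqdef]
  have h1 := h (M.singleB e hq) (M.weakFun_mem_Vh0 (fun e' he' =>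
    Pi.single_eq_of_ne (by rintro rfl; exact he he') _) fun _ _ => rfl)
  have hqc := continuous_of_mem_polyOn hq
  have hinter : ∀ T ∈ M.elemsOf e.1, Integrable (fun x : e.1 =>
      q x * dirDeriv (lam T) (M.normal T.1 e.1) x) (faceMeasure e.1) := fun T _ =>
    M.integrable_face e (hqc.mul ((continuous_dirDeriv _ _).comp continuous_subtype_val))
  rw [dualForm_singleB, neg_eq_zero, ← integral_finsetSum _ hinter] at h1
  simp only [← Finset.mul_sum] at h1
  exact congrFun (M.eq_zero_of_face_integral_sq e hqc h1) x

/-- The sum itself is used as `v_n` on `e`, which is possible because `P_{k-2} ⊆ P_{k-1}`. On an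
interior face the normals have opposite signs, so the sum is the jump of `λ` up to sign. -/
lemma sum_normal_eq_zero_of_dualForm (hlam : lam ∈ M.Wh k)
    (h : ∀ v : M.VhSub k, v.1 ∈ M.Vh0 k Γd Γn → M.dualForm k v lam = 0) {e : M.faces}
    (he : ¬ IsFaceOf (Ω := Ω) Γn e.1) (x : e.1) :
    ∑ T ∈ M.elemsOf e.1,
      inner ℝ (M.normal (M.side e).1 e.1) (M.normal T.1 e.1) * evalAt (lam T) x = 0 := by
  set q : e.1 → ℝ := fun x => ∑ T ∈ M.elemsOf e.1,
    inner ℝ (M.normal (M.side e).1 e.1) (M.normal T.1 e.1) * evalAt (lam T) x with hqdef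
  have hq : q ∈ polyOn e.1 ((k : ℤ) - 1) := by
    refine ⟨∑ T ∈ M.elemsOf e.1, (inner ℝ (M.normal (M.side e).1 e.1) (M.normal T.1 e.1) : ℝ) • lam T,
      Submodule.sum_mem _ fun T _ => Submodule.smul_mem _ _
        (polySpace_mono (by linarith) (hlam T)), fun x => ?_⟩
    simp only [evalAt_sum, evalAt_smul, hqdef]
  have h1 := h (M.singleN e hq) (M.weakFun_mem_Vh0 (fun _ _ => rfl) fun e' he' =>
    Pi.single_eq_of_ne (by rintro rfl; exact he he') _)
  have hqc := continuous_of_mem_polyOn hq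
  have hinter : ∀ T ∈ M.elemsOf e.1, Integrable (fun x : e.1 =>
      q x * (inner ℝ (M.normal (M.side e).1 e.1) (M.normal T.1 e.1) * evalAt (lam T) x))
      (faceMeasure e.1) := fun T _ => M.integrable_face e (hqc.mul (by fun_prop))
  rw [dualForm_singleN, ← integral_finsetSum _ hinter] at h1
  simp only [← Finset.mul_sum] at h1
  exact congrFun (M.eq_zero_of_face_integral_sq e hqc h1) x

/-- Where `u` carries no boundary condition, `v_b` and `v_n` are free, and this forces zero Cauchy
data for `λ`. The face `e₀` is free of both conditions. -/
theorem dual_eq_zero (hΩo : IsOpen Ω) (hΩc : IsConnected Ω) {e₀ : M.faces}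
    (he₀ : e₀.1 ⊆ frontier Ω) (hed : ¬ IsFaceOf (Ω := Ω) Γd e₀.1)
    (hen : ¬ IsFaceOf (Ω := Ω) Γn e₀.1) (hlam : lam ∈ M.Wh k)
    (h : ∀ v : M.VhSub k, v.1 ∈ M.Vh0 k Γd Γn → M.dualForm k v lam = 0) : lam = 0 := by
  classical
  have hself : ∀ (T : M.elems) (e : M.faces), e.1 ⊆ frontier T.1 →
      inner ℝ (M.normal T.1 e.1) (M.normal T.1 e.1) = (1 : ℝ) := by
    intro T e he
    rw [real_inner_self_eq_norm_sq, M.norm_normal T.2 e.2 he, one_pow]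
  refine M.eq_zero_of_piecewise_harmonic hΩo hΩc lam (lap_eq_zero_of_dualForm hlam h) ?_ e₀.2
    (M.face_subset_side e₀) ?_ ?_
  · intro e hb T T' hne heT heT' x hx
    -- An interior face belongs to no boundary portion, so both kinds of test function are available
    -- on it.
    have h1 := sum_dirDeriv_eq_zero_of_dualForm hlam h (e := e) (fun hf => hb hf.1) ⟨x, hx⟩
    have h2 := sum_normal_eq_zero_of_dualForm hlam h (e := e) (fun hf => hb hf.1) ⟨x, hx⟩
    have hneg := M.normal_eq_neg T.2 T'.2 (fun h => hne (Subtype.ext h)) e.2 heT heT'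
    rw [M.elemsOf_interior hb hne heT heT', Finset.sum_pair hne, hneg] at h1 h2
    rw [dirDeriv_neg] at h1
    refine ⟨?_, by linarith⟩
    have hS := M.mem_elemsOf.2 (M.face_subset_side e)
    rw [M.elemsOf_interior hb hne heT heT', Finset.mem_insert, Finset.mem_singleton] at hS
    -- The reference element `side e` may be either neighbour; this changes only the overall sign.
    rcases hS with hS | hS
    · rw [hS, inner_neg_right, hself T e heT] at h2
      linarith
    · rw [hS, hneg, inner_neg_neg, inner_neg_left, hself T e heT] at h2
      linarith
  · intro x hx
    have h2 := sum_normal_eq_zero_of_dualForm hlam h hen ⟨x, hx⟩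
    rwa [M.elemsOf_boundary he₀ (M.face_subset_side e₀), Finset.sum_singleton,
      hself _ e₀ (M.face_subset_side e₀), one_mul] at h2
  · intro x hx
    have h1 := sum_dirDeriv_eq_zero_of_dualForm hlam h hed ⟨x, hx⟩
    rwa [M.elemsOf_boundary he₀ (M.face_subset_side e₀), Finset.sum_singleton] at h1

end Dual

/-! ### The Cauchy data -/

/-- If no face were of both kinds, resolution by the partition would make `Γ_d ∩ Γ_n` null on each
of the finitely many boundary faces. -/
lemma exists_face_of_inter_pos {Γd Γn : Set (Pt d)} (hΓd : Γd ⊆ frontier Ω)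
    (hMd : M.Resolves Γd) (hMn : M.Resolves Γn)
    (hpos : 0 < (μHE[d - 1] : Measure (Pt d)) (Γd ∩ Γn)) :
    ∃ e : M.faces, IsFaceOf (Ω := Ω) Γd e.1 ∧ IsFaceOf (Ω := Ω) Γn e.1 := by
  by_contra! hcon
  refine hpos.ne' (measure_mono_null (t := ⋃ e ∈ {e | e ∈ M.faces ∧ e ⊆ frontier Ω}, e ∩ (Γd ∩ Γn))
    ?_ ?_)
  · intro x hx
    obtain ⟨e, he, heΩ, hxe⟩ := M.exists_face_of_mem_frontier_domain (hΓd hx.1)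
    exact Set.mem_biUnion (show e ∈ {e | e ∈ M.faces ∧ e ⊆ frontier Ω} from ⟨he, heΩ⟩) ⟨hxe, hx⟩
  · refine (measure_biUnion_null_iff
      (M.faces.finite_toSet.subset fun e he => he.1).countable).2 fun e he => ?_
    rcases hMd e he.1 he.2 with h1 | h1
    · rcases hMn e he.1 he.2 with h2 | h2
      · exact absurd ⟨he.2, h2⟩ (hcon ⟨e, he.1⟩ ⟨he.2, h1⟩)
      · exact measure_mono_null (Set.inter_subset_inter_right _ Set.inter_subset_right) h2
    · exact measure_mono_null (Set.inter_subset_inter_right _ Set.inter_subset_left) h1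

/-- The complement of the closed union is open and contains a boundary point. A face through that
point has positive measure outside the union, so it is almost contained in neither portion. -/
lemma exists_free_face {Γd Γn : Set (Pt d)} (hΓd : Γd ⊆ frontier Ω) (hΓn : Γn ⊆ frontier Ω)
    (hclosed : IsClosed (Γd ∪ Γn)) (hproper : Γd ∪ Γn ≠ frontier Ω) :
    ∃ e : M.faces, e.1 ⊆ frontier Ω ∧ ¬ IsFaceOf (Ω := Ω) Γd e.1 ∧
      ¬ IsFaceOf (Ω := Ω) Γn e.1 := by
  obtain ⟨x, hx, hxΓ⟩ : ∃ x ∈ frontier Ω, x ∉ Γd ∪ Γn := by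
    by_contra! h
    exact hproper (Set.Subset.antisymm (Set.union_subset hΓd hΓn) h)
  obtain ⟨e, he, heΩ, hxe⟩ := M.exists_face_of_mem_frontier_domain hx
  have hpos := M.measure_face_inter_pos he hclosed.isOpen_compl ⟨x, hxe, hxΓ⟩
  refine ⟨⟨e, he⟩, heΩ, fun h => hpos.ne' ?_, fun h => hpos.ne' ?_⟩
  · exact measure_mono_null (Set.inter_subset_inter_right _ (Set.compl_subset_compl.2
      Set.subset_union_left)) h.2
  · exact measure_mono_null (Set.inter_subset_inter_right _ (Set.compl_subset_compl.2
      Set.subset_union_right)) h.2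

/-! ### Lifting of the boundary data and the load -/

lemma integrableOn_of_isFaceOf {Γ : Set (Pt d)} {g : Pt d → ℝ}
    (hg : MemLp g 2 ((μHE[d - 1] : Measure (Pt d)).restrict Γ)) (e : M.faces)
    (he : IsFaceOf (Ω := Ω) Γ e.1) : IntegrableOn g e.1 (μHE[d - 1] : Measure (Pt d)) := by
  have hle : e.1 ≤ᵐ[(μHE[d - 1] : Measure (Pt d))] Γ := by
    rw [ae_le_set]
    exact he.2
  have h1 : MemLp g 2 ((μHE[d - 1] : Measure (Pt d)).restrict e.1) :=
    hg.mono_measure (Measure.restrict_mono' hle le_rfl)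
  have : IsFiniteMeasure ((μHE[d - 1] : Measure (Pt d)).restrict e.1) :=
    ⟨by simpa using M.measure_face_lt_top e.2⟩
  exact h1.integrable (by norm_num)

/-- There are weak functions with the prescribed boundary data. -/
lemma nonempty_Vhg (k : ℕ) {Γd Γn : Set (Pt d)} {g₁ g₂ : Pt d → ℝ}
    (hg₁ : MemLp g₁ 2 ((μHE[d - 1] : Measure (Pt d)).restrict Γd))
    (hg₂ : MemLp g₂ 2 ((μHE[d - 1] : Measure (Pt d)).restrict Γn)) :
    ∃ u : M.VhSub k, u.1 ∈ M.Vhg k Γd Γn g₁ g₂ := by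
  classical
  have hb : ∀ e : M.faces, ∃ q ∈ polyOn e.1 k,
      IsFaceOf (Ω := Ω) Γd e.1 → IsL2Projection e.1 k g₁ q := by
    intro e
    by_cases he : IsFaceOf (Ω := Ω) Γd e.1
    · obtain ⟨q, hq, -⟩ := M.existsUnique_isL2Projection e k (M.integrableOn_of_isFaceOf hg₁ e he)
      exact ⟨q, hq.1, fun _ => hq⟩
    · exact ⟨0, (polyOnSub e.1 k).zero_mem, fun h => absurd h he⟩
  have hn : ∀ e : M.faces, ∃ q ∈ polyOn e.1 ((k : ℤ) - 1),
      IsFaceOf (Ω := Ω) Γn e.1 → IsL2Projection e.1 ((k : ℤ) - 1) g₂ q := by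
    intro e
    by_cases he : IsFaceOf (Ω := Ω) Γn e.1
    · obtain ⟨q, hq, -⟩ := M.existsUnique_isL2Projection e ((k : ℤ) - 1)
        (M.integrableOn_of_isFaceOf hg₂ e he)
      exact ⟨q, hq.1, fun _ => hq⟩
    · exact ⟨0, (polyOnSub e.1 _).zero_mem, fun h => absurd h he⟩
  choose qb hqb hqb' using hb
  choose qn hqn hqn' using hn
  refine ⟨M.weakFun 0 (fun _ => zero_mem _) qb hqb qn hqn, (M.weakFun _ _ _ _ _ _).2,
    hqb', fun e he T heT => ?_⟩
  -- A boundary face has a single element, so no sign ambiguity affects the prescribed `v_n`.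
  have hT : T = M.side e := by
    have h1 := M.mem_elemsOf.2 heT
    rwa [M.elemsOf_boundary he.1 (M.face_subset_side e), Finset.mem_singleton] at h1
  have h2 : (M.weakFun 0 (fun _ => zero_mem _) qb hqb qn hqn).1.vn T e = qn e := by
    ext x
    rw [weakFun_vn, hT, real_inner_self_eq_norm_sq,
      M.norm_normal (M.side e).2 e.2 (M.face_subset_side e)]
    ring
  rw [h2]
  exact hqn' e he

/-- `V_h^g` is a translate of `V_h^0`. -/
lemma mem_Vhg_iff_sub_mem {k : ℕ} {Γd Γn : Set (Pt d)} {g₁ g₂ : Pt d → ℝ}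
    (hg₁ : MemLp g₁ 2 ((μHE[d - 1] : Measure (Pt d)).restrict Γd))
    (hg₂ : MemLp g₂ 2 ((μHE[d - 1] : Measure (Pt d)).restrict Γn))
    {u₀ u : M.VhSub k} (hu₀ : u₀.1 ∈ M.Vhg k Γd Γn g₁ g₂) :
    u.1 ∈ M.Vhg k Γd Γn g₁ g₂ ↔ (u - u₀).1 ∈ M.Vh0 k Γd Γn := by
  have hvb : ∀ e, (u - u₀).1.vb e = u.1.vb e - u₀.1.vb e := fun e => rfl
  have hvn : ∀ T e, (u - u₀).1.vn T e = u.1.vn T e - u₀.1.vn T e := fun T e => by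
    ext x; exact inner_sub_left _ _ _
  rw [mem_Vh0_iff]
  constructor
  · intro hu
    refine ⟨(u - u₀).2, fun e he => ?_, fun e he T heT => ?_⟩
    · rw [hvb, sub_eq_zero]
      exact (M.existsUnique_isL2Projection e k (M.integrableOn_of_isFaceOf hg₁ e he)).unique
        (hu.2.1 e he) (hu₀.2.1 e he)
    · rw [hvn, sub_eq_zero]
      exact (M.existsUnique_isL2Projection e _ (M.integrableOn_of_isFaceOf hg₂ e he)).unique
        (hu.2.2 e he T heT) (hu₀.2.2 e he T heT)
  · rintro ⟨-, h1, h2⟩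
    refine ⟨u.2, fun e he => ?_, fun e he T heT => ?_⟩
    · have := h1 e he
      rw [hvb, sub_eq_zero] at this
      rw [this]
      exact hu₀.2.1 e he
    · have := h2 e he T heT
      rw [hvn, sub_eq_zero] at this
      rw [this]
      exact hu₀.2.2 e he T heT

lemma integrableOn_elem_load {f : Pt d → ℝ} (hf : MemLp f 2 (volume.restrict Ω)) (T : M.elems) :
    IntegrableOn f T.1 := by
  -- Elements lie only in the closure of `Ω`, but `frontier Ω` is covered by faces and is null.
  have hle : T.1 ≤ᵐ[(volume : Measure (Pt d))] Ω := by
    rw [ae_le_set]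
    refine measure_mono_null ?_ M.volume_frontier_domain
    rintro x ⟨hx, hxΩ⟩
    exact ⟨M.elem_subset_closure_domain T.2 hx, fun h => hxΩ (interior_subset h)⟩
  have h1 : MemLp f 2 (volume.restrict T.1) := hf.mono_measure (Measure.restrict_mono' hle le_rfl)
  have : IsFiniteMeasure ((volume : Measure (Pt d)).restrict T.1) :=
    ⟨by simpa using (M.isCompact_elem T.2).measure_lt_top⟩
  exact h1.integrable (by norm_num)

/-- The load functional. -/
def loadForm {f : Pt d → ℝ} (hf : MemLp f 2 (volume.restrict Ω)) : M.PiecewisePoly →ₗ[ℝ] ℝ where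
  toFun := M.load f
  map_add' v w := by
    simp only [load, Pi.add_apply, evalAt_add, mul_add]
    rw [← Finset.sum_add_distrib]
    exact Finset.sum_congr rfl fun T _ => integral_add
      ((M.integrableOn_elem_load hf T).mul_continuousOn (by fun_prop) (M.isCompact_elem T.2))
      ((M.integrableOn_elem_load hf T).mul_continuousOn (by fun_prop) (M.isCompact_elem T.2))
  map_smul' c w := by
    simp only [load, Pi.smul_apply, evalAt_smul, mul_left_comm, RingHom.id_apply, smul_eq_mul,
      Finset.mul_sum]
    exact Finset.sum_congr rfl fun T _ => integral_const_mul _ _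

/-! ### The saddle point system -/

/-- The bilinear form of the scheme on `V_h × W_h`. -/
def saddleForm (k : ℕ) : (M.VhSub k × M.PiecewisePoly) →ₗ[ℝ] (M.VhSub k × M.PiecewisePoly) →ₗ[ℝ] ℝ :=
  (M.stabForm k).compl₁₂ (LinearMap.fst ℝ _ _) (LinearMap.fst ℝ _ _) +
    (M.dualForm k).flip.compl₁₂ (LinearMap.snd ℝ _ _) (LinearMap.fst ℝ _ _) +
    (M.dualForm k).compl₁₂ (LinearMap.fst ℝ _ _) (LinearMap.snd ℝ _ _)

lemma saddleForm_apply {k : ℕ} (x y : M.VhSub k × M.PiecewisePoly) :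
    M.saddleForm k x y = M.stabForm k x.1 y.1 + M.dualForm k y.1 x.2 + M.dualForm k x.1 y.2 := rfl

/-- The subspace `V_h^0 × W_h`. -/
abbrev testSpace (k : ℕ) (Γd Γn : Set (Pt d)) : Submodule ℝ (M.VhSub k × M.PiecewisePoly) :=
  (M.Vh0Sub k Γd Γn).prod (M.WhSub k)

instance finiteDimensional_testSpace (k : ℕ) (Γd Γn : Set (Pt d)) :
    FiniteDimensional ℝ (M.testSpace k Γd Γn) :=
  Module.Finite.iff_fg.2 (Submodule.FG.prod (Module.Finite.iff_fg.1 inferInstance)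
    (Module.Finite.iff_fg.1 inferInstance))

theorem existsUnique_isSolution (hd : 0 < d) (hΩo : IsOpen Ω) (hΩc : IsConnected Ω) (k : ℕ)
    {Γd Γn : Set (Pt d)} (hΓd : Γd ⊆ frontier Ω) (hΓn : Γn ⊆ frontier Ω)
    (hMd : M.Resolves Γd) (hMn : M.Resolves Γn) {f g₁ g₂ : Pt d → ℝ}
    (hf : MemLp f 2 (volume.restrict Ω))
    (hg₁ : MemLp g₁ 2 ((μHE[d - 1] : Measure (Pt d)).restrict Γd))
    (hg₂ : MemLp g₂ 2 ((μHE[d - 1] : Measure (Pt d)).restrict Γn))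
    (hCauchy : 0 < (μHE[d - 1] : Measure (Pt d)) (Γd ∩ Γn))
    (hclosed : IsClosed (Γd ∪ Γn)) (hproper : Γd ∪ Γn ≠ frontier Ω) :
    ∃! p : M.WeakFunction × M.PiecewisePoly, M.IsSolution k Γd Γn f g₁ g₂ p.1 p.2 := by
  obtain ⟨e₀, he₀d, he₀n⟩ := M.exists_face_of_inter_pos hΓd hMd hMn hCauchy
  obtain ⟨e₁, he₁, he₁d, he₁n⟩ := M.exists_free_face hΓd hΓn hclosed hproper
  obtain ⟨u₀, hu₀⟩ := M.nonempty_Vhg k hg₁ hg₂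
  set X := M.testSpace k Γd Γn with hX
  set B := (M.saddleForm k).compl₁₂ X.subtype X.subtype with hB
  have hinj : ∀ x, (∀ y, B x y = 0) → x = 0 := by
    rintro ⟨⟨u, lam⟩, hu, hlam⟩ h
    -- With the test pair `(u, -λ)` the two dual terms cancel.
    have hs : M.stabForm k u u = 0 := by
      have := h ⟨(u, -lam), hu, (M.WhSub k).neg_mem hlam⟩
      simpa [hB, saddleForm_apply] using this
    have hw : ∀ w ∈ M.Wh k, M.dualForm k u w = 0 := by
      intro w hw
      have := h ⟨(0, w), (M.Vh0Sub k Γd Γn).zero_mem, hw⟩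
      simpa [hB, saddleForm_apply] using this
    have hu0 : u = 0 := M.primal_eq_zero hd hΩo hΩc hu he₀d he₀n hs hw
    subst hu0
    have hv : ∀ v : M.VhSub k, v.1 ∈ M.Vh0 k Γd Γn → M.dualForm k v lam = 0 := by
      intro v hv
      have := h ⟨(v, 0), hv, (M.WhSub k).zero_mem⟩
      simpa [hB, saddleForm_apply] using this
    have hlam0 : lam = 0 := dual_eq_zero hΩo hΩc he₁ he₁d he₁n hlam hv
    subst hlam0
    rfl
  -- The unknown is `(u - u₀, λ)`, so the contribution of the lift `u₀` moves to the right-hand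
  -- side.
  set l : X →ₗ[ℝ] ℝ := (M.loadForm hf ∘ₗ LinearMap.snd ℝ _ _ - M.saddleForm k (u₀, 0)) ∘ₗ X.subtype
    with hl
  -- The single equation against pairs `(v, w)` is the sum of the two equations of the scheme; the
  -- pairs `(v, 0)` and `(0, w)` separate them.
  have hiff : ∀ (u : M.VhSub k) (lam : M.PiecewisePoly) (hx : (u - u₀, lam) ∈ X),
      (∀ y, B ⟨(u - u₀, lam), hx⟩ y = l y) ↔ M.IsSolution k Γd Γn f g₁ g₂ u.1 lam := by
    intro u lam hx
    have hstep : ∀ y : X, B ⟨(u - u₀, lam), hx⟩ y = l y ↔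
        M.stabForm k u y.1.1 + M.dualForm k y.1.1 lam + M.dualForm k u y.1.2 =
          M.load f y.1.2 := by
      intro y
      have h1 : B ⟨(u - u₀, lam), hx⟩ y = M.stabForm k u y.1.1 - M.stabForm k u₀ y.1.1 +
          M.dualForm k y.1.1 lam + (M.dualForm k u y.1.2 - M.dualForm k u₀ y.1.2) := by
        simp [hB, saddleForm_apply]
      have h2 : l y = M.load f y.1.2 - (M.stabForm k u₀ y.1.1 + M.dualForm k u₀ y.1.2) := by
        have : M.dualForm k y.1.1 0 = 0 := map_zero _
        simp [hl, saddleForm_apply, loadForm]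
      rw [h1, h2]
      constructor <;> intro h <;> linarith
    constructor
    · intro h
      refine ⟨(M.mem_Vhg_iff_sub_mem hg₁ hg₂ hu₀).2 hx.1, hx.2, fun v hv => ?_, fun w hw => ?_⟩
      · have := (hstep ⟨(⟨v, hv.1⟩, 0), hv, (M.WhSub k).zero_mem⟩).1 (h _)
        rw [M.innerPP_weakLaplacianH ⟨v, hv.1⟩ hx.2]
        rw [← M.stabForm_apply u ⟨v, hv.1⟩]
        simpa [load] using this
      · have := (hstep ⟨(0, w), (M.Vh0Sub k Γd Γn).zero_mem, hw⟩).1 (h _)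
        rw [M.innerPP_weakLaplacianH u hw]
        simpa using this
    · intro h y
      rw [hstep]
      have h1 := h.dual_eq y.1.1.1 y.2.1
      have h2 := h.primal_eq y.1.2 y.2.2
      rw [M.innerPP_weakLaplacianH y.1.1 hx.2, ← M.stabForm_apply] at h1
      rw [M.innerPP_weakLaplacianH u y.2.2] at h2
      rw [h1, h2, zero_add]
  obtain ⟨x, hx, huniq⟩ := existsUnique_of_injective (V := X) B hinj l
  refine ⟨((x.1.1 + u₀).1, x.1.2), ?_, ?_⟩
  · refine (hiff (x.1.1 + u₀) x.1.2 (by simp)).1 ?_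
    simpa using hx
  · rintro ⟨u, lam⟩ hsol
    have hmem : ((⟨u, hsol.u_mem.1⟩ : M.VhSub k) - u₀, lam) ∈ X :=
      ⟨(M.mem_Vhg_iff_sub_mem hg₁ hg₂ hu₀).1 hsol.u_mem, hsol.lam_mem⟩
    have h := huniq ⟨_, hmem⟩ ((hiff _ _ hmem).2 hsol)
    rw [← h]
    simp

end PolytopalMesh

end PDWG

end

theorem theorem3p1 (d : ℕ) (hd : d = 2 ∨ d = 3)
    (Ω : Set (PDWG.Pt d)) (hΩ_open : IsOpen Ω) (hΩ_bdd : Bornology.IsBounded Ω)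
    (hΩ_conn : IsConnected Ω)
    (M : PDWG.PolytopalMesh Ω) (k : ℕ) (hk : 1 ≤ k)
    (Γd Γn : Set (PDWG.Pt d)) (hΓd : Γd ⊆ frontier Ω) (hΓn : Γn ⊆ frontier Ω)
    (hMd : M.Resolves Γd) (hMn : M.Resolves Γn)
    (f g₁ g₂ : PDWG.Pt d → ℝ)
    (hf : MemLp f 2 (volume.restrict Ω))
    (hg₁ : MemLp g₁ 2 ((μHE[d - 1] : Measure (PDWG.Pt d)).restrict Γd))
    (hg₂ : MemLp g₂ 2 ((μHE[d - 1] : Measure (PDWG.Pt d)).restrict Γn))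
    (hCauchy : 0 < (μHE[d - 1] : Measure (PDWG.Pt d)) (Γd ∩ Γn))
    (hclosed : IsClosed (Γd ∪ Γn)) (hproper : Γd ∪ Γn ≠ frontier Ω) :
    ∃! p : M.WeakFunction × M.PiecewisePoly,
      M.IsSolution k Γd Γn f g₁ g₂ p.1 p.2 :=
  M.existsUnique_isSolution (by omega) hΩ_open hΩ_conn k hΓd hΓn hMd hMn hf hg₁ hg₂ hCauchy
    hclosed hproper
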